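/- Call a finite graph $G$ \emph{even-decomposable} if there is a sequence $V(G)=V_0\supset V_1\supset\dots\supset V_k=\emptyset$ such that for each $0\le i\le k-1$ the induced subgraph $G[V_i]$ has an even number of edges and $V_i\setminus V_{i+1}$ is an independent set in $G$. Call $G$ \emph{even-non-decomposable} if it has an even number of edges but is not even-decomposable. Let $G(n,p)$ denote the binomial random graph on $n$ vertices with edge probability $p\in[0,1]$. (i) There exists an absolute constant $c_1>0$ such that if $0\le p\le 1-\frac{c_1}{n}$ and $H\sim G(n,p)$, then $$\mathbb{P}(H\text{ is even-non-decomposable})=o(1)\qquad\text{as } n\to\infty,$$ uniformly in $p$. (ii) More precisely, there is an absolute constant $C>0$ such that for all integers $n\ge 1$ and all $0\le p\le 1-\frac{10^5}{n}$, if $H\sim G(n,p)$, then $$\mathbb{P}(H\text{ is even-non-decomposable})\le \frac{C}{n^2}.$$ -/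

import Mathlib

namespace SimpleGraph

/-- A finite graph `G` is even-decomposable if there is a chain
`V(G) = W 0 ⊃ W 1 ⊃ ⋯ ⊃ W k = ∅` such that, for each `i < k`, the induced graph `G[W i]` has an
even number of edges and `W i \ W (i + 1)` is an independent set of `G`.
(The values `W i` for `i > k` play no role.) -/
def EvenDecomposable {V : Type*} [Finite V] (G : SimpleGraph V) : Prop :=
  ∃ (k : ℕ) (W : ℕ → Set V), W 0 = Set.univ ∧ W k = ∅ ∧
    ∀ i < k, W (i + 1) ⊂ W i ∧ Even (G.induce (W i)).edgeSet.ncard ∧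
      G.IsIndepSet (W i \ W (i + 1))

/-- A finite graph is even-non-decomposable if it has an even number of edges, but is not
even-decomposable. -/
def EvenNonDecomposable {V : Type*} [Finite V] (G : SimpleGraph V) : Prop :=
  Even G.edgeSet.ncard ∧ ¬ G.EvenDecomposable

end SimpleGraph

/-! A decomposition is built by deleting a vertex of even degree, or two non-adjacent vertices whose
degrees have equal parity; both keep the number of edges even. When this gets stuck inside a set,
the rest of that set is a clique of odd-degree vertices (`exists_reach_clique`). Hence a `K₄`-free
graph with an even number of edges always decomposes (`reach_empty_of_cliqueFreeOn_four`), and it is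
enough to reduce `G` to a `K₄`-free set.

Two absorbers get rid of stuck cliques. An edge `ab` not contained in the neighbourhood of an odd
vertex `q` allows `q` to be removed together with some of `a`, `b` (`exists_reach_subset`). A vertex
distinguishing two odd vertices can be removed together with one of them
(`exists_reach_of_distinguish`). If `G` is sparse, a set `S` minus a maximal packing of `K₄`'s is
`K₄`-free and still contains a large matching, which absorbs all other vertices
(`not_evenNonDecomposable_of_sparse`).

For dense `G` one passes to the parity graph of a partition into independent classes: classes are
adjacent when an odd number of edges joins them, and reductions of the parity graph lift to `G`
(`Reach.classes`). With classes of size two, edges and non-edges between classes have the same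
parity, so on these pairs the parity graph is governed by the sparse complement, and the sparse
argument applies again (`not_evenNonDecomposable_of_dense`). At intermediate density one looks for a
set on which the complement consists of disjoint four-vertex paths; its parity graph is then a
matching (`not_evenNonDecomposable_of_pathPattern`). Among about `√n` disjoint blocks one carries
such a pattern with very high probability.

The hypotheses of these criteria hold outside events bounded by first moments. With `d = 1 - p` and
`t` the integer part of `(log n) ^ (1 / 16)`, the cases are: `p ≤ 10 ^ 5 / n` (no `K₄` at all), `p ≤
t ^ (-16)` (sparse), both `p ≥ t ^ (-16)` and `d ≥ t ^ (-13)` (paths), and `d ≤ t ^ (-13)` (dense,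
split again at `d = t ^ (-51)`). -/

namespace SimpleGraph

open Finset

set_option linter.unusedSectionVars false

variable {V : Type*} [Fintype V] [DecidableEq V] (G : SimpleGraph V)

/-! ### Edge parities and removal of one or two vertices -/

/-- The parity of the number of edges of `G` inside `W`. -/
noncomputable def par (W : Finset V) : ZMod 2 :=
  ((G.edgeSet ∩ {e | ∀ x ∈ e, x ∈ W}).ncard : ZMod 2)

open Classical in
/-- The adjacency indicator of `G` modulo two. -/
noncomputable def adjPar (x y : V) : ZMod 2 := if G.Adj x y then 1 else 0

/-- The parity of the number of neighbours of `v` in `W`. -/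
noncomputable def degPar (W : Finset V) (v : V) : ZMod 2 := ∑ y ∈ W, G.adjPar v y

lemma zmod_two_cases (a : ZMod 2) : a = 0 ∨ a = 1 := by revert a; decide

lemma zmod_two_add_self (a : ZMod 2) : a + a = 0 := by revert a; decide

variable {G}

lemma adjPar_self (x : V) : G.adjPar x x = 0 := by simp [adjPar]

lemma adjPar_of_adj {x y : V} (h : G.Adj x y) : G.adjPar x y = 1 := by simp [adjPar, h]

lemma adjPar_of_not_adj {x y : V} (h : ¬ G.Adj x y) : G.adjPar x y = 0 := by simp [adjPar, h]

lemma adjPar_comm (x y : V) : G.adjPar x y = G.adjPar y x := by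
  by_cases h : G.Adj x y
  · rw [adjPar_of_adj h, adjPar_of_adj h.symm]
  · rw [adjPar_of_not_adj h, adjPar_of_not_adj fun h' => h h'.symm]

lemma par_empty : G.par ∅ = 0 := by
  have : G.edgeSet ∩ {e | ∀ x ∈ e, x ∈ (∅ : Finset V)} = ∅ := by
    ext e
    induction e with | _ a b =>
    simp only [Set.mem_inter_iff, Set.mem_ofPred_eq, notMem_empty, Set.mem_empty_iff_false,
      iff_false, not_and]
    exact fun _ h => h a (by simp)
  rw [par, this]; simp

lemma degPar_eq_card (W : Finset V) (v : V) :
    G.degPar W v = ((G.neighborSet v ∩ W).ncard : ZMod 2) := by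
  classical
  have : G.neighborSet v ∩ W = ((W.filter (G.Adj v) : Finset V) : Set V) := by
    ext x; simp [and_comm]
  rw [this, Set.ncard_coe_finset, degPar]
  simp [adjPar]

lemma par_insert {W : Finset V} {v : V} (hv : v ∉ W) :
    G.par (insert v W) = G.par W + G.degPar W v := by
  have h : G.edgeSet ∩ {e | ∀ x ∈ e, x ∈ insert v W} =
      (G.edgeSet ∩ {e | ∀ x ∈ e, x ∈ W}) ∪ (fun w => s(v, w)) '' (G.neighborSet v ∩ W) := by
    ext e
    induction e with | _ a b =>
    simp only [Set.mem_inter_iff, mem_edgeSet, Set.mem_ofPred_eq, Sym2.mem_iff, Set.mem_union,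
      Set.mem_image, mem_neighborSet, Sym2.eq_iff, mem_insert, mem_coe]
    constructor
    · rintro ⟨hab, h⟩
      have ha := h a (Or.inl rfl)
      have hb := h b (Or.inr rfl)
      rcases ha with rfl | ha
      · rcases hb with rfl | hb
        · exact absurd hab G.irrefl
        · exact Or.inr ⟨b, ⟨hab, hb⟩, Or.inl ⟨rfl, rfl⟩⟩
      · rcases hb with rfl | hb
        · exact Or.inr ⟨a, ⟨hab.symm, ha⟩, Or.inr ⟨rfl, rfl⟩⟩
        · refine Or.inl ⟨hab, ?_⟩
          rintro x (rfl | rfl) <;> assumption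
    · rintro (⟨hab, h⟩ | ⟨w, ⟨hvw, hw⟩, ⟨rfl, rfl⟩ | ⟨rfl, rfl⟩⟩)
      · exact ⟨hab, fun x hx => Or.inr (h x hx)⟩
      · refine ⟨hvw, ?_⟩
        rintro x (rfl | rfl) <;> simp [hw]
      · refine ⟨hvw.symm, ?_⟩
        rintro x (rfl | rfl) <;> simp [hw]
  have hd : Disjoint (G.edgeSet ∩ {e | ∀ x ∈ e, x ∈ W})
      ((fun w => s(v, w)) '' (G.neighborSet v ∩ W)) := by
    rw [Set.disjoint_right]
    rintro _ ⟨w, -, rfl⟩ ⟨-, h⟩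
    exact hv (h v (by simp))
  rw [par, h, Set.ncard_union_eq hd (Set.toFinite _) (Set.toFinite _), Set.ncard_image_of_injective,
    Nat.cast_add, degPar_eq_card, par]
  intro x y hxy
  simpa only [Sym2.congr_right] using hxy

lemma degPar_insert {W : Finset V} {v w : V} (hv : v ∉ W) :
    G.degPar (insert v W) w = G.adjPar w v + G.degPar W w := by
  rw [degPar, sum_insert hv, degPar]

lemma degPar_erase {W : Finset V} {v w : V} (hv : v ∈ W) :
    G.degPar (W.erase v) w = G.degPar W w + G.adjPar w v := by
  have h := degPar_insert (G := G) (w := w) (notMem_erase v W)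
  rw [insert_erase hv] at h
  rw [h]
  have := zmod_two_add_self (G.adjPar w v)
  linear_combination -this

lemma par_erase {W : Finset V} {v : V} (hv : v ∈ W) :
    G.par (W.erase v) = G.par W + G.degPar W v := by
  have h := par_insert (G := G) (notMem_erase v W)
  rw [insert_erase hv, degPar_erase hv, adjPar_self, add_zero] at h
  rw [h]
  have := zmod_two_add_self (G.degPar W v)
  linear_combination -this

variable (G) in
/-- `G.Reach W W'` says that `W'` is obtained from `W` by removing single vertices and pairs of
non-adjacent vertices, without changing the parity of the number of edges. -/
inductive Reach : Finset V → Finset V → Prop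
  | refl (W : Finset V) : Reach W W
  | step {W W' : Finset V} (v w : V) (hv : v ∈ W) (hw : w ∈ W) (hvw : ¬ G.Adj v w)
      (hp : G.par (W \ {v, w}) = G.par W) (h : Reach (W \ {v, w}) W') : Reach W W'

lemma Reach.par_eq {W W' : Finset V} (h : G.Reach W W') : G.par W' = G.par W := by
  induction h with
  | refl => rfl
  | step v w hv hw hvw hp h ih => rw [ih, hp]

lemma Reach.trans {W W' W'' : Finset V} (h : G.Reach W W') (h' : G.Reach W' W'') :
    G.Reach W W'' := by
  induction h with
  | refl => exact h'
  | step v w hv hw hvw hp h ih => exact .step v w hv hw hvw hp (ih h')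

lemma Reach.subset {W W' : Finset V} (h : G.Reach W W') : W' ⊆ W := by
  induction h with
  | refl => rfl
  | step v w hv hw hvw hp h ih => exact ih.trans sdiff_subset

lemma reach_erase {W : Finset V} {v : V} (hv : v ∈ W) (h : G.degPar W v = 0) :
    G.Reach W (W.erase v) := by
  have e : W \ {v, v} = W.erase v := by ext; simp [and_comm]
  refine .step v v hv hv G.irrefl ?_ (e ▸ .refl _)
  rw [e, par_erase hv, h, add_zero]

lemma sdiff_pair_eq {W : Finset V} {v w : V} : W \ {v, w} = (W.erase v).erase w := by
  ext x; simp; tauto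

lemma reach_pair {W : Finset V} {v w : V} (hv : v ∈ W) (hw : w ∈ W) (hvw : v ≠ w)
    (ha : ¬ G.Adj v w) (h : G.degPar W v = G.degPar W w) :
    G.Reach W ((W.erase v).erase w) := by
  refine .step v w hv hw ha ?_ (sdiff_pair_eq (W := W) ▸ .refl _)
  rw [sdiff_pair_eq, par_erase (mem_erase.2 ⟨hvw.symm, hw⟩), par_erase hv, degPar_erase hv,
    adjPar_of_not_adj (fun h => ha h.symm), h]
  have := zmod_two_add_self (G.degPar W w)
  linear_combination this

/-- Every `B` can be removed from `A ∪ B` up to a clique of vertices of odd degree. -/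
lemma exists_reach_clique (A : Finset V) : ∀ B : Finset V, Disjoint A B →
    ∃ Q ⊆ B, G.Reach (A ∪ B) (A ∪ Q) ∧ G.IsClique (Q : Set V) ∧
      ∀ q ∈ Q, G.degPar (A ∪ Q) q = 1 := by
  intro B
  induction B using Finset.strongInduction with
  | H B ih =>
  intro hAB
  by_cases h1 : ∃ v ∈ B, G.degPar (A ∪ B) v = 0
  · obtain ⟨v, hv, h0⟩ := h1
    obtain ⟨Q, hQ, hr, hc, hd⟩ := ih (B.erase v) (erase_ssubset hv)
      (hAB.mono_right (erase_subset _ _))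
    refine ⟨Q, hQ.trans (erase_subset _ _), ?_, hc, hd⟩
    have e : (A ∪ B).erase v = A ∪ B.erase v := by
      ext x
      have := Finset.disjoint_right.1 hAB hv
      simp only [mem_erase, mem_union]
      constructor
      · tauto
      · rintro (hx | hx)
        · exact ⟨fun h => this (h ▸ hx), Or.inl hx⟩
        · tauto
    exact (reach_erase (mem_union_right _ hv) h0).trans (e ▸ hr)
  by_cases h2 : ∃ v ∈ B, ∃ w ∈ B, v ≠ w ∧ ¬ G.Adj v w
  · obtain ⟨v, hv, w, hw, hvw, ha⟩ := h2
    obtain ⟨Q, hQ, hr, hc, hd⟩ := ih ((B.erase v).erase w)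
      ((erase_subset _ _).trans_ssubset (erase_ssubset hv))
      (hAB.mono_right ((erase_subset _ _).trans (erase_subset _ _)))
    refine ⟨Q, hQ.trans ((erase_subset _ _).trans (erase_subset _ _)), ?_, hc, hd⟩
    have e : ((A ∪ B).erase v).erase w = A ∪ (B.erase v).erase w := by
      ext x
      have h1 := Finset.disjoint_right.1 hAB hv
      have h2 := Finset.disjoint_right.1 hAB hw
      simp only [mem_erase, mem_union]
      constructor
      · tauto
      · rintro (hx | hx)
        · exact ⟨fun h => h2 (h ▸ hx), fun h => h1 (h ▸ hx), Or.inl hx⟩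
        · tauto
    have hd' : G.degPar (A ∪ B) v = G.degPar (A ∪ B) w := by
      rw [(zmod_two_cases _).resolve_left (fun h => h1 ⟨v, hv, h⟩),
        (zmod_two_cases _).resolve_left (fun h => h1 ⟨w, hw, h⟩)]
    exact (reach_pair (mem_union_right _ hv) (mem_union_right _ hw) hvw ha hd').trans (e ▸ hr)
  -- No move is left in `B`: all its vertices have odd degree and any two of them are adjacent.
  · push Not at h1 h2
    exact ⟨B, subset_rfl, .refl _, fun v hv w hw h => h2 v hv w hw h,
      fun q hq => (zmod_two_cases _).resolve_left (h1 q hq)⟩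

lemma IsClique.card_le_of_cliqueFreeOn {Q S : Finset V} {k : ℕ} (hQ : G.IsClique (Q : Set V))
    (hQS : Q ⊆ S) (h : G.CliqueFreeOn (S : Set V) (k + 1)) : #Q ≤ k := by
  by_contra! hk
  obtain ⟨Q', hQ', hc⟩ := exists_subset_card_eq hk
  exact h (coe_subset.2 (hQ'.trans hQS)) ⟨hQ.subset (coe_subset.2 hQ'), hc⟩

/-- A triangle-free set can be removed as soon as the parities of the edge numbers agree. -/
lemma reach_sdiff_of_cliqueFreeOn_three {W T : Finset V} (hT : T ⊆ W)
    (hf : G.CliqueFreeOn (T : Set V) 3) (hp : G.par (W \ T) = G.par W) :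
    G.Reach W (W \ T) := by
  obtain ⟨Q, hQ, hr, hc, hd⟩ := exists_reach_clique (G := G) (W \ T) T sdiff_disjoint
  rw [sdiff_union_of_subset hT] at hr
  have hcard := hc.card_le_of_cliqueFreeOn hQ hf
  have hpar := hr.par_eq
  rw [← hp] at hpar
  have hdis : ∀ q ∈ Q, q ∉ W \ T := fun q hq h => (mem_sdiff.1 h).2 (hQ hq)
  -- Deleting a single odd vertex, or two adjacent odd vertices, changes the parity of the number of
  -- edges. Since `hp` says that the parities at both ends agree, only `Q = ∅` is possible.
  interval_cases h : #Q
  · rw [card_eq_zero] at h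
    simpa [h] using hr
  · obtain ⟨q, rfl⟩ := card_eq_one.1 h
    have h1 := hd q (by simp)
    have h2 := par_erase (G := G) (mem_union_right (W \ T) (mem_singleton_self q))
    have e : (W \ T ∪ {q}).erase q = W \ T := by
      ext x
      have := hdis q (by simp)
      simp only [mem_erase, mem_union, mem_singleton]
      constructor
      · tauto
      · intro hx; exact ⟨fun h => this (h ▸ hx), Or.inl hx⟩
    rw [e, h1, hpar] at h2
    exact absurd h2 (by generalize G.par (W \ T) = a; revert a; decide)
  · obtain ⟨q, r, hqr, rfl⟩ := card_eq_two.1 h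
    have h1 := hd q (by simp)
    have h2 := hd r (by simp)
    have ha : G.Adj q r := hc (by simp) (by simp) hqr
    have hq : q ∈ W \ T ∪ {q, r} := by simp
    have hr' : r ∈ (W \ T ∪ {q, r}).erase q := by simp [hqr.symm]
    have e : ((W \ T ∪ {q, r}).erase q).erase r = W \ T := by
      ext x
      have hq' := hdis q (by simp)
      have hr' := hdis r (by simp)
      simp only [mem_erase, mem_union, mem_singleton, mem_insert]
      constructor
      · tauto
      · intro hx; exact ⟨fun h => hr' (h ▸ hx), fun h => hq' (h ▸ hx), Or.inl hx⟩
    have h3 := par_erase (G := G) hr'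
    rw [e, par_erase hq, degPar_erase hq, h1, h2, adjPar_of_adj ha.symm, hpar] at h3
    exact absurd h3 (by generalize G.par (W \ T) = a; revert a; decide)

/-- A `K₄`-free set with an even number of edges can be removed. -/
lemma reach_empty_of_cliqueFreeOn_four {W : Finset V} (hf : G.CliqueFreeOn (W : Set V) 4)
    (hp : G.par W = 0) : G.Reach W ∅ := by
  obtain ⟨Q, hQ, hr, hc, hd⟩ := exists_reach_clique (G := G) ∅ W (by simp)
  simp only [empty_union] at hr hd
  have hcard := hc.card_le_of_cliqueFreeOn hQ hf
  -- Nothing but the clique `Q` is left, so every degree is `#Q - 1` and must be odd. This excludes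
  -- sizes one and three; size two would leave exactly one edge, against even parity.
  have hdeg : ∀ q ∈ Q, ((#Q - 1 : ℕ) : ZMod 2) = 1 := by
    intro q hq
    rw [← hd q hq, degPar, ← add_sum_erase _ _ hq, adjPar_self, zero_add, ← card_erase_of_mem hq,
      card_eq_sum_ones, Nat.cast_sum]
    refine sum_congr rfl fun y hy => ?_
    rw [adjPar_of_adj (hc hq (mem_of_mem_erase hy) (ne_of_mem_erase hy).symm), Nat.cast_one]
  interval_cases h : #Q
  · rw [card_eq_zero] at h
    exact h ▸ hr
  · obtain ⟨q, rfl⟩ := card_eq_one.1 h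
    simpa using hdeg q (by simp)
  · obtain ⟨q, r, hqr, rfl⟩ := card_eq_two.1 h
    have hpar := hr.par_eq
    have h1 := par_erase (G := G) (W := {q, r}) (v := q) (by simp)
    have e : ({q, r} : Finset V).erase q = {r} := by
      ext x
      simp only [mem_erase, mem_insert, mem_singleton]
      constructor
      · tauto
      · rintro rfl; exact ⟨hqr.symm, Or.inr rfl⟩
    have h2 := par_erase (G := G) (W := {r}) (v := r) (by simp)
    rw [erase_singleton, par_empty] at h2
    simp only [degPar, sum_singleton, adjPar_self, add_zero] at h2
    rw [e, ← h2, hpar, hp, hd q (by simp)] at h1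
    simp at h1
  · obtain ⟨q, hq⟩ := card_pos.1 (by omega : 0 < #Q)
    exact absurd (hdeg q hq) (by decide)

end SimpleGraph

/-! ### Absorbing odd vertices by disjoint edges and by distinguishing vertices -/

namespace SimpleGraph

open Finset

set_option linter.unusedSectionVars false

variable {V : Type*} [Fintype V] [DecidableEq V] {G : SimpleGraph V}

lemma sdiff_pair_comm {W : Finset V} {v w : V} : (W.erase w).erase v = W \ {v, w} := by
  ext x; simp; tauto

/-- If `q` and `a` are adjacent, `hne` makes `a` even, and deleting `a` turns `q` even. If not,
`hne` makes `a` odd, so `q` and `a` go together as a pair. -/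
lemma reach_sdiff_pair_of_degPar_ne {W : Finset V} {q a : V} (hq : q ∈ W) (ha : a ∈ W)
    (hqa : q ≠ a) (hd : G.degPar W q = 1) (hne : G.degPar W a ≠ G.adjPar q a) :
    G.Reach W (W \ {q, a}) := by
  by_cases h : G.Adj q a
  · rw [adjPar_of_adj h] at hne
    have h0 := (zmod_two_cases _).resolve_right hne
    refine (reach_erase ha h0).trans ?_
    rw [← sdiff_pair_comm]
    refine reach_erase (mem_erase.2 ⟨hqa, hq⟩) ?_
    rw [degPar_erase ha, hd, adjPar_of_adj h]
    decide
  · rw [adjPar_of_not_adj h] at hne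
    rw [sdiff_pair_eq]
    exact reach_pair hq ha hqa h (hd.trans ((zmod_two_cases _).resolve_left hne).symm)

/-- An edge that is not contained in the neighbourhood of `q` allows one to remove `q`. -/
lemma exists_reach_sdiff_of_adj {W : Finset V} {q a b : V} (hq : q ∈ W) (ha : a ∈ W)
    (hb : b ∈ W) (hqa : q ≠ a) (hqb : q ≠ b) (hab : G.Adj a b)
    (hn : ¬ (G.Adj q a ∧ G.Adj q b)) (hd : G.degPar W q = 1) :
    ∃ Y ⊆ ({q, a, b} : Finset V), q ∈ Y ∧ G.Reach W (W \ Y) := by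
  by_cases h1 : G.degPar W a = G.adjPar q a
  swap
  · exact ⟨{q, a}, by simp [insert_subset_iff], by simp, reach_sdiff_pair_of_degPar_ne hq ha hqa hd h1⟩
  by_cases h2 : G.degPar W b = G.adjPar q b
  swap
  · exact ⟨{q, b}, by simp [insert_subset_iff], by simp, reach_sdiff_pair_of_degPar_ne hq hb hqb hd h2⟩
  -- When neither pair works, all three vertices go at once. The degrees contribute `1 + adjPar q a
  -- + adjPar q b` and the inner edges `adjPar q a + adjPar q b + 1`, so the parity is unchanged;
  -- `hn` makes the triple triangle-free.
  refine ⟨{q, a, b}, subset_rfl, by simp, reach_sdiff_of_cliqueFreeOn_three ?_ ?_ ?_⟩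
  · simp [insert_subset_iff, hq, ha, hb]
  · intro t ht hc
    have : t = {q, a, b} := by
      refine eq_of_subset_of_card_le (coe_subset.1 ht) ?_
      rw [hc.card_eq]
      exact card_le_three
    subst this
    exact hn ⟨hc.isClique (by simp) (by simp) hqa, hc.isClique (by simp) (by simp) hqb⟩
  · have e : W \ {q, a, b} = ((W.erase q).erase a).erase b := by
      ext x; simp; tauto
    have hb' : b ∈ (W.erase q).erase a := mem_erase.2 ⟨hab.ne', mem_erase.2 ⟨hqb.symm, hb⟩⟩
    have ha' : a ∈ W.erase q := mem_erase.2 ⟨hqa.symm, ha⟩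
    rw [e, par_erase hb', par_erase ha', par_erase hq, degPar_erase ha', degPar_erase hq,
      degPar_erase hq, hd, h1, h2, adjPar_of_adj hab.symm, adjPar_comm a q, adjPar_comm b q]
    generalize G.par W = x
    generalize G.adjPar q a = y
    generalize G.adjPar q b = z
    revert x y z
    decide

/-- A vertex that distinguishes two odd vertices allows one to remove one of them. -/
lemma reach_sdiff_of_distinguish {W : Finset V} {q q' r : V} (hq : q ∈ W) (hq' : q' ∈ W)
    (hr : r ∈ W) (hrq' : r ≠ q') (ha : G.Adj r q) (hn : ¬ G.Adj r q')
    (hd : G.degPar W q = 1) (hd' : G.degPar W q' = 1) :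
    G.Reach W (W \ {q, r}) ∨ G.Reach W (W \ {q', r}) := by
  -- An even `r` goes with its neighbour `q`, an odd `r` with its non-neighbour `q'`.
  rcases zmod_two_cases (G.degPar W r) with h | h
  · refine Or.inl (reach_sdiff_pair_of_degPar_ne hq hr ha.ne' hd ?_)
    rw [h, adjPar_of_adj ha.symm]; decide
  · refine Or.inr (reach_sdiff_pair_of_degPar_ne hq' hr hrq'.symm hd' ?_)
    rw [h, adjPar_of_not_adj (fun h => hn h.symm)]; decide

variable (G) in
/-- A family of pairwise disjoint edges of `G` inside `X`, given as ordered pairs. -/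
structure IsEdgeFamily (X : Finset V) (E : Finset (V × V)) : Prop where
  left_mem : ∀ e ∈ E, e.1 ∈ X
  right_mem : ∀ e ∈ E, e.2 ∈ X
  adj : ∀ e ∈ E, G.Adj e.1 e.2
  disjoint : ∀ e ∈ E, ∀ f ∈ E, e ≠ f → Disjoint ({e.1, e.2} : Finset V) {f.1, f.2}

/-- Induction on the size of the set to be absorbed. Each round first shrinks it to an odd clique
and then removes at least one clique vertex at the cost of a single edge of `E`. As long as `Q` is
non-empty, more than `b` edges are available, so one of them is not contained in the neighbourhood
of the chosen vertex. -/
lemma exists_reach_subset_of_card_le {b : ℕ} : ∀ (N : ℕ) (Q X : Finset V) (E : Finset (V × V)),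
    #Q ≤ N → Disjoint X Q → G.IsEdgeFamily X E →
    (∀ q ∈ Q, ∀ E' ⊆ E, (∀ e ∈ E', G.Adj q e.1 ∧ G.Adj q e.2) → #E' ≤ b) → b + N ≤ #E →
    ∃ X' ⊆ X, G.Reach (X ∪ Q) X' := by
  classical
  intro N
  induction N with
  | zero =>
    intro Q X E hQ _ _ _ _
    rw [Nat.le_zero, card_eq_zero] at hQ
    subst hQ
    exact ⟨X, subset_rfl, by simpa using Reach.refl X⟩
  | succ N ih =>
    intro Q X E hQ hdis hE hbad hcard
    obtain ⟨Q₁, hQ₁, hr, hc, hd⟩ := exists_reach_clique (G := G) X Q hdis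
    rcases Q₁.eq_empty_or_nonempty with rfl | ⟨q, hq⟩
    · exact ⟨X, subset_rfl, by simpa using hr⟩
    obtain ⟨e, he, hne⟩ : ∃ e ∈ E, ¬ (G.Adj q e.1 ∧ G.Adj q e.2) := by
      by_contra! h
      have := hbad q (hQ₁ hq) E subset_rfl h
      omega
    have hqX : q ∉ X := Finset.disjoint_right.1 hdis (hQ₁ hq)
    have h1 := hE.left_mem e he
    have h2 := hE.right_mem e he
    obtain ⟨Y, hY, hqY, hr'⟩ := exists_reach_sdiff_of_adj (W := X ∪ Q₁) (mem_union_right _ hq)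
      (mem_union_left _ h1) (mem_union_left _ h2) (fun h => hqX (h ▸ h1)) (fun h => hqX (h ▸ h2))
      (hE.adj e he) hne (hd q hq)
    -- `Y` consists of `q` and ends of `e`, so every other edge of `E` survives.
    have key : ∀ f ∈ E.erase e, f.1 ∉ Y ∧ f.2 ∉ Y := by
      intro f hf
      have hf' := mem_of_mem_erase hf
      have hdj := hE.disjoint f hf' e he (ne_of_mem_erase hf)
      rw [Finset.disjoint_left] at hdj
      have aux : ∀ x ∈ X, x ∈ ({f.1, f.2} : Finset V) → x ∉ Y := by
        intro x hx hxf hxY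
        have := hY hxY
        rw [mem_insert] at this
        rcases this with rfl | h
        · exact hqX hx
        · exact hdj hxf h
      exact ⟨aux _ (hE.left_mem f hf') (by simp), aux _ (hE.right_mem f hf') (by simp)⟩
    have hc1 : #(Q₁ \ Y) < #Q₁ := card_lt_card
      ⟨sdiff_subset, fun h => (mem_sdiff.1 (h hq)).2 hqY⟩
    obtain ⟨X', hX', hr''⟩ := ih (Q₁ \ Y) (X \ Y) (E.erase e)
      (by have := card_le_card hQ₁; omega)
      (hdis.mono sdiff_subset (sdiff_subset.trans hQ₁))
      ⟨fun f hf => mem_sdiff.2 ⟨hE.left_mem f (mem_of_mem_erase hf), (key f hf).1⟩,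
        fun f hf => mem_sdiff.2 ⟨hE.right_mem f (mem_of_mem_erase hf), (key f hf).2⟩,
        fun f hf => hE.adj f (mem_of_mem_erase hf),
        fun f hf g hg => hE.disjoint f (mem_of_mem_erase hf) g (mem_of_mem_erase hg)⟩
      (fun x hx E' hE' => hbad x (hQ₁ (mem_sdiff.1 hx).1) E' (hE'.trans (erase_subset _ _)))
      (by rw [card_erase_of_mem he]; omega)
    refine ⟨X', hX'.trans sdiff_subset, hr.trans (hr'.trans ?_)⟩
    rwa [union_sdiff_distrib]

/-- A set `B` without large cliques can be removed at the cost of a part of `X`, if `X` contains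
many disjoint edges most of which are not contained in the neighbourhood of a vertex of `B`. -/
lemma exists_reach_subset {b w : ℕ} {B X : Finset V} {E : Finset (V × V)} (hdis : Disjoint X B)
    (hE : G.IsEdgeFamily X E)
    (hbad : ∀ q ∈ B, ∀ E' ⊆ E, (∀ e ∈ E', G.Adj q e.1 ∧ G.Adj q e.2) → #E' ≤ b)
    (hB : ∀ Q ⊆ B, G.IsClique (Q : Set V) → #Q ≤ w) (hcard : b + w ≤ #E) :
    ∃ X' ⊆ X, G.Reach (X ∪ B) X' := by
  obtain ⟨Q, hQ, hr, hc, -⟩ := exists_reach_clique (G := G) X B hdis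
  obtain ⟨X', hX', hr'⟩ := exists_reach_subset_of_card_le w Q X E (hB Q hQ hc)
    (hdis.mono_right hQ) hE (fun q hq => hbad q (hQ hq)) hcard
  exact ⟨X', hX', hr.trans hr'⟩

open Classical in
-- As long as the stuck clique has two vertices, a vertex `r` of `R` distinguishing them is spent to
-- remove one of them. Every count of distinguishing vertices then drops by at most one, in step
-- with the induction parameter `N`. The set `S` is never touched.
lemma exists_reach_of_distinguish_aux (S : Finset V) : ∀ (N : ℕ) (Q R : Finset V),
    #Q ≤ N → Disjoint (S ∪ R) Q → Disjoint S R →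
    (∀ q ∈ Q, ∀ q' ∈ Q, q ≠ q' → N ≤ #{r ∈ R | ¬ (G.Adj r q ↔ G.Adj r q')}) →
    ∃ R' ⊆ R, ∃ Q' ⊆ Q, #Q' ≤ 1 ∧ G.Reach (S ∪ R ∪ Q) (S ∪ R' ∪ Q') := by
  intro N
  induction N with
  | zero =>
    intro Q R hQ _ _ _
    exact ⟨R, subset_rfl, Q, subset_rfl, by omega, .refl _⟩
  | succ N ih =>
    intro Q R hQ hdis hSR hdist
    obtain ⟨Q₁, hQ₁, hr, hc, hd⟩ := exists_reach_clique (G := G) (S ∪ R) Q hdis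
    rcases le_or_gt #Q₁ 1 with h1 | h1
    · exact ⟨R, subset_rfl, Q₁, hQ₁, h1, hr⟩
    obtain ⟨q, hq, q', hq', hqq⟩ := one_lt_card.1 h1
    obtain ⟨r, hr'⟩ := card_pos.1 (lt_of_lt_of_le N.succ_pos (hdist q (hQ₁ hq) q' (hQ₁ hq') hqq))
    rw [mem_filter] at hr'
    obtain ⟨hrR, hrn⟩ := hr'
    have hrQ : r ∉ Q := Finset.disjoint_left.1 hdis (mem_union_right _ hrR)
    have hrS : r ∉ S := Finset.disjoint_right.1 hSR hrR
    obtain ⟨x, hx, hr''⟩ : ∃ x ∈ Q₁, G.Reach (S ∪ R ∪ Q₁) ((S ∪ R ∪ Q₁) \ {x, r}) := by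
      have hrW : r ∈ S ∪ R ∪ Q₁ := mem_union_left _ (mem_union_right _ hrR)
      by_cases ha : G.Adj r q
      · have hn : ¬ G.Adj r q' := fun h => hrn ⟨fun _ => h, fun _ => ha⟩
        rcases reach_sdiff_of_distinguish (mem_union_right _ hq) (mem_union_right _ hq') hrW
          (fun h => hrQ (h ▸ hQ₁ hq')) ha hn (hd q hq) (hd q' hq') with h | h
        exacts [⟨q, hq, h⟩, ⟨q', hq', h⟩]
      · have hn : G.Adj r q' := by tauto
        rcases reach_sdiff_of_distinguish (mem_union_right _ hq') (mem_union_right _ hq) hrW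
          (fun h => hrQ (h ▸ hQ₁ hq)) hn ha (hd q' hq') (hd q hq) with h | h
        exacts [⟨q', hq', h⟩, ⟨q, hq, h⟩]
    have hxQ := hQ₁ hx
    have hxSR : x ∉ S ∪ R := Finset.disjoint_right.1 hdis hxQ
    have e : (S ∪ R ∪ Q₁) \ {x, r} = S ∪ R.erase r ∪ Q₁.erase x := by
      ext y
      simp only [mem_sdiff, mem_union, mem_insert, mem_singleton, mem_erase] at hxSR ⊢
      constructor
      · tauto
      · have h3 : r ∉ Q₁ := fun h => hrQ (hQ₁ h)
        rintro ((h | h) | h)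
        · refine ⟨Or.inl (Or.inl h), ?_⟩
          rintro (rfl | rfl) <;> tauto
        · refine ⟨Or.inl (Or.inr h.2), ?_⟩
          rintro (rfl | rfl) <;> tauto
        · refine ⟨Or.inr h.2, ?_⟩
          rintro (rfl | rfl) <;> tauto
    obtain ⟨R', hR', Q', hQ', hc', hr3⟩ := ih (Q₁.erase x) (R.erase r)
      (by rw [card_erase_of_mem hx]; have := card_le_card hQ₁; omega)
      (hdis.mono (union_subset_union_right (erase_subset _ _)) ((erase_subset _ _).trans hQ₁))
      (hSR.mono_right (erase_subset _ _))
      (fun y hy z hz hyz => by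
        have h := hdist y (hQ₁ (mem_of_mem_erase hy)) z (hQ₁ (mem_of_mem_erase hz)) hyz
        rw [filter_erase]
        have := pred_card_le_card_erase (s := {r ∈ R | ¬ (G.Adj r y ↔ G.Adj r z)}) (a := r)
        omega)
    refine ⟨R', hR'.trans (erase_subset _ _), Q', hQ'.trans ((erase_subset _ _).trans hQ₁), hc', ?_⟩
    exact hr.trans (hr''.trans (e ▸ hr3))

open Classical in
/-- A set `B` without large cliques can be removed, up to one vertex, at the cost of a part
of `R`, if any two vertices of `B` are distinguished by many vertices of `R`. -/
lemma exists_reach_of_distinguish {w : ℕ} {S R B : Finset V} (hdis : Disjoint (S ∪ R) B)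
    (hSR : Disjoint S R) (hB : ∀ Q ⊆ B, G.IsClique (Q : Set V) → #Q ≤ w)
    (hdist : ∀ q ∈ B, ∀ q' ∈ B, q ≠ q' → w ≤ #{r ∈ R | ¬ (G.Adj r q ↔ G.Adj r q')}) :
    ∃ R' ⊆ R, ∃ Q' ⊆ B, #Q' ≤ 1 ∧ G.Reach (S ∪ R ∪ B) (S ∪ R' ∪ Q') := by
  obtain ⟨Q, hQ, hr, hc, -⟩ := exists_reach_clique (G := G) (S ∪ R) B hdis
  obtain ⟨R', hR', Q', hQ', hc', hr'⟩ := exists_reach_of_distinguish_aux (G := G) S w Q R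
    (hB Q hQ hc) (hdis.mono_right hQ) hSR (fun q hq q' hq' => hdist q (hQ hq) q' (hQ hq'))
  exact ⟨R', hR', Q', hQ'.trans hQ, hc', hr.trans hr'⟩

end SimpleGraph

namespace SimpleGraph

open Finset

set_option linter.unusedSectionVars false

/-! ### From parity-preserving removals to even decompositions -/

section Soundness

variable {V : Type*} [Fintype V] [DecidableEq V] {G : SimpleGraph V}

lemma even_ncard_edgeSet_induce_iff (W : Finset V) :
    Even (G.induce (W : Set V)).edgeSet.ncard ↔ G.par W = 0 := by
  have h : (G.induce (W : Set V)).edgeSet.ncard =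
      (G.edgeSet ∩ {e | ∀ x ∈ e, x ∈ W}).ncard := by
    rw [← Set.ncard_image_of_injective _ (Sym2.map.injective Subtype.val_injective)]
    congr 1
    ext e
    induction e with | _ a b =>
    constructor
    · rintro ⟨f, hf, h⟩
      induction f with | _ c d =>
      rw [← h]
      refine ⟨hf, ?_⟩
      intro x hx
      simp only [Sym2.map_mk, Sym2.mem_iff] at hx
      rcases hx with rfl | rfl
      exacts [c.2, d.2]
    · rintro ⟨hab, h⟩
      exact ⟨s(⟨a, h a (by simp)⟩, ⟨b, h b (by simp)⟩), hab, rfl⟩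
  rw [h, par, ZMod.natCast_eq_zero_iff_even]

lemma Reach.exists_chain {W W' : Finset V} (h : G.Reach W W') (hp : G.par W = 0) :
    ∃ (k : ℕ) (F : ℕ → Set V), F 0 = W ∧ F k = W' ∧ ∀ i < k, F (i + 1) ⊂ F i ∧
      Even (G.induce (F i)).edgeSet.ncard ∧ G.IsIndepSet (F i \ F (i + 1)) := by
  induction h with
  | refl W => exact ⟨0, fun _ => W, rfl, rfl, by simp⟩
  | @step W W' v w hv hw hvw hp' h ih =>
    obtain ⟨k, F, h0, hk, hF⟩ := ih (hp'.trans hp)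
    refine ⟨k + 1, fun i => Nat.casesOn i (W : Set V) F, rfl, hk, ?_⟩
    rintro (_ | i) hi
    · simp only [h0]
      refine ⟨coe_ssubset.2 ⟨sdiff_subset, fun h => (mem_sdiff.1 (h hv)).2 (by simp)⟩,
        (even_ncard_edgeSet_induce_iff W).2 hp, ?_⟩
      rintro x ⟨hx, hx'⟩ y ⟨hy, hy'⟩ hxy
      have hx2 : x = v ∨ x = w := by
        by_contra hcon; exact hx' (by simpa [mem_coe.1 hx] using hcon)
      have hy2 : y = v ∨ y = w := by
        by_contra hcon; exact hy' (by simpa [mem_coe.1 hy] using hcon)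
      rcases hx2 with rfl | rfl <;> rcases hy2 with rfl | rfl
      · exact absurd rfl hxy
      · exact hvw
      · exact fun h => hvw h.symm
      · exact absurd rfl hxy
    · exact hF i (by omega)

lemma evenDecomposable_of_reach (hp : G.par univ = 0) (h : G.Reach univ ∅) :
    G.EvenDecomposable := by
  obtain ⟨k, F, h0, hk, hF⟩ := h.exists_chain hp
  exact ⟨k, F, by simpa using h0, by simpa using hk, hF⟩

lemma par_univ_of_even (h : Even G.edgeSet.ncard) : G.par univ = 0 := by
  have : G.edgeSet ∩ {e | ∀ x ∈ e, x ∈ (univ : Finset V)} = G.edgeSet := by simp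
  rwa [par, this, ZMod.natCast_eq_zero_iff_even]

/-- If removing vertices leads to a `K₄`-free set, then the graph is not
even-non-decomposable. -/
lemma not_evenNonDecomposable_of_reach {W : Finset V} (h : G.Reach univ W)
    (hf : G.CliqueFreeOn (W : Set V) 4) : ¬ G.EvenNonDecomposable := by
  rintro ⟨he, hn⟩
  have hp := par_univ_of_even he
  exact hn (evenDecomposable_of_reach hp
    (h.trans (reach_empty_of_cliqueFreeOn_four hf (h.par_eq.trans hp))))

end Soundness

/-! ### The parity graph of a partition into independent classes -/

section Quotient

variable {V : Type*} [Fintype V] [DecidableEq V] {G : SimpleGraph V}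

variable (G) in
/-- The parity of the number of edges between `A` and `B`. -/
noncomputable def crossPar (A B : Finset V) : ZMod 2 := ∑ x ∈ A, G.degPar B x

lemma crossPar_comm (A B : Finset V) : G.crossPar A B = G.crossPar B A := by
  simp only [crossPar, degPar]
  rw [sum_comm]
  simp only [adjPar_comm]

/-- The preimage of a finite set of classes of a partition, given by a map `π`. -/
def classes (π : V → V) (A : Finset V) : Finset V := {x | π x ∈ A}

variable (G) in
/-- The parity graph of a partition: two classes are adjacent if the number of edges between them
is odd. -/
noncomputable def parityQuotient (π : V → V) : SimpleGraph V where
  Adj i j := i ≠ j ∧ G.crossPar (classes π {i}) (classes π {j}) = 1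
  symm := ⟨fun _ _ h => ⟨h.1.symm, crossPar_comm (G := G) _ _ ▸ h.2⟩⟩
  loopless := ⟨fun _ h => h.1 rfl⟩

lemma par_union_of_indep {W : Finset V} : ∀ {T : Finset V}, Disjoint W T →
    (∀ x ∈ T, ∀ y ∈ T, ¬ G.Adj x y) → G.par (W ∪ T) = G.par W + G.crossPar T W := by
  intro T
  induction T using Finset.induction_on with
  | empty => simp [crossPar]
  | insert a T ha ih =>
    intro hd hi
    have haW : a ∉ W := Finset.disjoint_right.1 hd (by simp)
    have h0 : G.degPar (W ∪ T) a = G.degPar W a := by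
      rw [degPar, sum_union (hd.mono_right (subset_insert _ _)), degPar,
        sum_eq_zero (s := T), add_zero]
      exact fun y hy => adjPar_of_not_adj (hi a (by simp) y (by simp [hy]))
    rw [union_insert, par_insert (by simp [haW, ha]), ih (hd.mono_right (subset_insert _ _))
      (fun x hx y hy => hi x (by simp [hx]) y (by simp [hy])), crossPar, crossPar, sum_insert ha, h0]
    ring

lemma classes_insert (π : V → V) (i : V) (A : Finset V) :
    classes π (insert i A) = classes π A ∪ classes π {i} := by
  ext x; simp [classes, or_comm]

lemma disjoint_classes {π : V → V} {A B : Finset V} (h : Disjoint A B) :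
    Disjoint (classes π A) (classes π B) := by
  rw [Finset.disjoint_left]
  intro x hx hx'
  exact Finset.disjoint_left.1 h (mem_filter.1 hx).2 (mem_filter.1 hx').2

/-- Classes are independent, so adding the class `i` adds only its cross edges to the classes
already present. Sorting these by class gives the degree of `i` in the parity graph. -/
lemma par_parityQuotient {π : V → V} (hπ : ∀ x y, π x = π y → ¬ G.Adj x y) (A : Finset V) :
    (G.parityQuotient π).par A = G.par (classes π A) := by
  induction A using Finset.induction_on with
  | empty => simp [classes, par_empty]
  | insert i A hi ih =>
    rw [par_insert hi, ih, classes_insert, par_union_of_indep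
      (disjoint_classes (by simpa using hi))]
    · congr 1
      have h : G.crossPar (classes π {i}) (classes π A) =
          ∑ j ∈ A, G.crossPar (classes π {i}) (classes π {j}) := by
        simp only [crossPar]
        rw [sum_comm]
        refine sum_congr rfl fun x _ => ?_
        simp only [degPar]
        rw [← sum_fiberwise_of_maps_to (s := classes π A) (t := A) (g := π)
          (fun y hy => (mem_filter.1 hy).2)]
        refine sum_congr rfl fun j hj => sum_congr ?_ fun _ _ => rfl
        ext y
        simp only [classes, mem_filter, mem_univ, true_and, mem_singleton]
        exact ⟨fun h => h.2, fun h => ⟨h ▸ hj, h⟩⟩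
      rw [h, degPar]
      refine sum_congr rfl fun j hj => ?_
      have hij : i ≠ j := fun h => hi (h ▸ hj)
      rcases zmod_two_cases (G.crossPar (classes π {i}) (classes π {j})) with h0 | h0
      · rw [h0, adjPar_of_not_adj]
        rintro ⟨-, h1⟩
        exact absurd (h0.symm.trans h1) (by decide)
      · rw [h0, adjPar_of_adj (G := G.parityQuotient π) ⟨hij, h0⟩]
    · intro x hx y hy
      simp only [classes, mem_filter, mem_univ, true_and, mem_singleton] at hx hy
      exact hπ x y (hx.trans hy.symm)

/-- Removing classes in the parity graph of a proper colouring can be done in the graph. -/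
lemma Reach.classes {π : V → V} (hπ : ∀ x y, π x = π y → ¬ G.Adj x y) {A A' : Finset V}
    (h : (G.parityQuotient π).Reach A A') : G.Reach (classes π A) (classes π A') := by
  induction h with
  | refl W => exact .refl _
  | @step W W' v w hv hw hvw hp h ih =>
    have e : SimpleGraph.classes π (W \ {v, w}) =
        SimpleGraph.classes π W \ SimpleGraph.classes π {v, w} := by
      ext x; simp [SimpleGraph.classes]
    refine Reach.trans ?_ ih
    rw [e]
    -- One step removes at most two independent classes. Their union is bipartite, hence
    -- triangle-free, and the parity condition transfers by `par_parityQuotient`. Adjacency in `G`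
    -- between the two classes is allowed; only the parity matters.
    refine reach_sdiff_of_cliqueFreeOn_three ?_ ?_ ?_
    · intro x
      simp only [SimpleGraph.classes, mem_filter, mem_univ, true_and, mem_insert, mem_singleton]
      rintro (h | h) <;> rw [h] <;> assumption
    · intro t ht hc
      obtain ⟨x, hx, y, hy, hxy, hπxy⟩ := exists_ne_map_eq_of_card_lt_of_maps_to
        (s := t) (t := {v, w}) (f := π) (by rw [hc.card_eq]; exact lt_of_le_of_lt card_le_two (by simp))
        (fun x hx => by
          have := ht hx
          simpa [SimpleGraph.classes] using this)
      exact hπ x y hπxy (hc.isClique hx hy hxy)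
    · rw [← e, ← par_parityQuotient hπ, ← par_parityQuotient hπ, hp]

end Quotient

/-! ### Maximal disjoint families and maximal matchings -/

section MaximalFamily

variable {α : Type*} [DecidableEq α]

/-- Every finite family of non-empty finite sets has a maximal pairwise disjoint subfamily. -/
lemma exists_maximal_pairwiseDisjoint (F : Finset (Finset α)) :
    ∃ M ⊆ F, (M : Set (Finset α)).PairwiseDisjoint id ∧
      ∀ A ∈ F, A.Nonempty → ¬ Disjoint A (M.biUnion id) := by
  classical
  obtain ⟨M, hM, hmax⟩ := exists_max_image
    (F.powerset.filter fun M : Finset (Finset α) =>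
      (M : Set (Finset α)).PairwiseDisjoint id) card
    ⟨∅, by simp⟩
  rw [mem_filter, mem_powerset] at hM
  refine ⟨M, hM.1, hM.2, fun A hA hne hd => ?_⟩
  have hAM : A ∉ M := by
    intro h
    obtain ⟨x, hx⟩ := hne
    exact Finset.disjoint_left.1 hd hx (mem_biUnion.2 ⟨A, h, hx⟩)
  have := hmax (insert A M) (by
    rw [mem_filter, mem_powerset]
    refine ⟨insert_subset hA hM.1, ?_⟩
    rw [coe_insert]
    refine hM.2.insert fun B hB _ => ?_
    exact (Finset.disjoint_biUnion_right _ _ _).1 hd B hB)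
  rw [card_insert_of_notMem hAM] at this
  omega

end MaximalFamily

end SimpleGraph

namespace SimpleGraph

open Finset

set_option linter.unusedSectionVars false

variable {V : Type*} [Fintype V] [DecidableEq V] {G : SimpleGraph V}

lemma IsEdgeFamily.subset {X : Finset V} {E E' : Finset (V × V)} (h : G.IsEdgeFamily X E)
    (hE : E' ⊆ E) : G.IsEdgeFamily X E' :=
  ⟨fun e he => h.left_mem e (hE he), fun e he => h.right_mem e (hE he),
    fun e he => h.adj e (hE he), fun e he f hf => h.disjoint e (hE he) f (hE hf)⟩

lemma IsEdgeFamily.eq_of_mem {X : Finset V} {E : Finset (V × V)} (h : G.IsEdgeFamily X E)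
    {e f : V × V} (he : e ∈ E) (hf : f ∈ E) {x : V} (hx : x ∈ ({e.1, e.2} : Finset V))
    (hy : x ∈ ({f.1, f.2} : Finset V)) : e = f := by
  by_contra hne
  exact Finset.disjoint_left.1 (h.disjoint e he f hf hne) hx hy

lemma IsEdgeFamily.injOn_fst {X : Finset V} {E : Finset (V × V)} (h : G.IsEdgeFamily X E) :
    Set.InjOn Prod.fst (E : Set (V × V)) := fun e he f hf hef =>
  h.eq_of_mem he hf (x := e.1) (by simp) (by simp [hef])

/-- There is a family of disjoint edges covering all but an independent set. -/
lemma exists_isEdgeFamily (X : Finset V) : ∃ E : Finset (V × V), G.IsEdgeFamily X E ∧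
    ∃ I ⊆ X, (∀ x ∈ I, ∀ y ∈ I, ¬ G.Adj x y) ∧ #X ≤ 2 * #E + #I := by
  classical
  obtain ⟨E, hE, hmax⟩ := exists_max_image
    (univ.filter fun E : Finset (V × V) => G.IsEdgeFamily X E) card
    ⟨∅, by simp only [mem_filter, mem_univ, true_and]; constructor <;> simp⟩
  simp only [mem_filter, mem_univ, true_and] at hE hmax
  set U : Finset V := E.biUnion fun e => {e.1, e.2} with hU
  refine ⟨E, hE, X \ U, sdiff_subset, fun x hx y hy hxy => ?_, ?_⟩
  · rw [mem_sdiff] at hx hy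
    have hnot : (x, y) ∉ E := fun h => hx.2 (mem_biUnion.2 ⟨_, h, by simp⟩)
    have hd : ∀ e ∈ E, Disjoint ({x, y} : Finset V) {e.1, e.2} := by
      intro e he
      rw [Finset.disjoint_left]
      intro z hz hze
      rw [mem_insert, mem_singleton] at hz
      rcases hz with rfl | rfl
      · exact hx.2 (mem_biUnion.2 ⟨e, he, hze⟩)
      · exact hy.2 (mem_biUnion.2 ⟨e, he, hze⟩)
    have := hmax (insert (x, y) E) ⟨by simpa using ⟨hx.1, fun a b => hE.left_mem (a, b)⟩,
      by simpa using ⟨hy.1, fun a b => hE.right_mem (a, b)⟩,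
      by simpa using ⟨hxy, fun a b => hE.adj (a, b)⟩, by
        intro e he f hf hef
        rw [mem_insert] at he hf
        rcases he with rfl | he <;> rcases hf with rfl | hf
        · exact absurd rfl hef
        · exact hd f hf
        · exact (hd e he).symm
        · exact hE.disjoint e he f hf hef⟩
    rw [card_insert_of_notMem hnot] at this
    omega
  · have h1 : #U ≤ #E * 2 := card_biUnion_le_card_mul _ _ _ fun e _ => card_le_two
    have h2 := le_card_sdiff U X
    omega

/-- If every vertex has few neighbours in `S`, it is joined to both ends of few disjoint edges. -/
lemma IsEdgeFamily.card_le_of_adj {X S : Finset V} {E : Finset (V × V)} (hE : G.IsEdgeFamily X E)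
    (hX : X ⊆ S) {q : V} {b : ℕ} [DecidableRel G.Adj] (h : #{x ∈ S | G.Adj q x} ≤ b)
    (hq : ∀ e ∈ E, G.Adj q e.1 ∧ G.Adj q e.2) : #E ≤ b := by
  rw [← card_image_of_injOn hE.injOn_fst]
  refine (card_le_card ?_).trans h
  intro x hx
  obtain ⟨e, he, rfl⟩ := mem_image.1 hx
  exact mem_filter.2 ⟨hX (hE.left_mem e he), (hq e he).1⟩

/-! ### The criteria for sparse graphs and for parity graphs -/

open Classical in
/-- The deterministic criterion for sparse graphs. -/
lemma not_evenNonDecomposable_of_sparse {S : Finset V} {u : ℕ} (hS : 100 * u ≤ #S)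
    (h1 : ∀ A ⊆ S, (∀ x ∈ A, ∀ y ∈ A, ¬ G.Adj x y) → #A < u)
    (h2 : ∀ 𝒜 : Finset (Finset V), (𝒜 : Set (Finset V)).PairwiseDisjoint id →
      (∀ A ∈ 𝒜, A ⊆ S ∧ G.IsNClique 4 A) → #𝒜 < u)
    (h3 : ∀ v, #{x ∈ S | G.Adj v x} < u)
    (h4 : ∀ Q : Finset V, G.IsClique (Q : Set V) → #Q < u) : ¬ G.EvenNonDecomposable := by
  obtain ⟨𝒦, h𝒦, hd, hmax⟩ := exists_maximal_pairwiseDisjoint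
    (S.powerset.filter fun A => G.IsNClique 4 A)
  have hk := h2 𝒦 hd fun A hA => by
    have := mem_filter.1 (h𝒦 hA)
    exact ⟨mem_powerset.1 this.1, this.2⟩
  set X := S \ 𝒦.biUnion id with hX
  have hXS : X ⊆ S := sdiff_subset
  have hcard : #S ≤ #X + 4 * u := by
    have h5 := le_card_sdiff (𝒦.biUnion id) S
    have h6 : #(𝒦.biUnion id) ≤ #𝒦 * 4 := card_biUnion_le_card_mul _ _ _ fun A hA =>
      (mem_filter.1 (h𝒦 hA)).2.card_eq.le
    rw [← hX] at h5
    omega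
  have hfree : G.CliqueFreeOn (X : Set V) 4 := by
    intro t ht hc
    have ht' : t ⊆ X := coe_subset.1 ht
    refine hmax t (mem_filter.2 ⟨mem_powerset.2 (ht'.trans hXS), hc⟩)
      (card_pos.1 (by rw [hc.card_eq]; omega)) ?_
    exact disjoint_of_subset_left ht' sdiff_disjoint
  obtain ⟨E, hE, I, hIX, hI, hle⟩ := exists_isEdgeFamily (G := G) X
  have hIu := h1 I (hIX.trans hXS) hI
  -- The absorption needs `2 * u` edges. From `#X ≥ 96 * u` and `#I < u` the matching has more than
  -- `47 * u`.
  obtain ⟨X', hX', hr⟩ := exists_reach_subset (G := G) (b := u) (w := u) (B := univ \ X)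
    disjoint_sdiff hE
    (fun q _ E' hE' hq => (hE.subset hE').card_le_of_adj hXS (h3 q).le hq)
    (fun Q _ hQ => (h4 Q hQ).le) (by omega)
  rw [union_sdiff_of_subset (subset_univ _)] at hr
  exact not_evenNonDecomposable_of_reach hr fun t ht => hfree (ht.trans (coe_subset.2 hX'))

/-- If `G` reduces to a union of classes which reduces to a `K₄`-free set in the parity graph, then
`G` is not even-non-decomposable. -/
lemma not_evenNonDecomposable_of_parityQuotient {π : V → V}
    (hπ : ∀ x y, π x = π y → ¬ G.Adj x y) {A A' : Finset V} (h : G.Reach univ (classes π A))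
    (h' : (G.parityQuotient π).Reach A A')
    (hf : (G.parityQuotient π).CliqueFreeOn (A' : Set V) 4) : ¬ G.EvenNonDecomposable := by
  rintro ⟨he, hn⟩
  have hp := par_univ_of_even he
  have hp' : (G.parityQuotient π).par A' = 0 := by
    rw [h'.par_eq, par_parityQuotient hπ, h.par_eq, hp]
  have h3 := Reach.classes hπ (h'.trans (reach_empty_of_cliqueFreeOn_four hf hp'))
  have e : classes π ∅ = ∅ := by simp [classes]
  exact hn (evenDecomposable_of_reach hp (h.trans (e ▸ h3)))

/-! ### Partitions into pairs and singletons -/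

/-- The map identifying the two vertices of every pair of `M`. -/
noncomputable def pairMap (M : Finset (V × V)) (v : V) : V :=
  open Classical in if h : ∃ e ∈ M, e.2 = v then h.choose.1 else v

section PairMap

variable {S : Finset V} {M : Finset (V × V)} {H : SimpleGraph V}

lemma pairMap_snd (hM : H.IsEdgeFamily S M) {e : V × V} (he : e ∈ M) : pairMap M e.2 = e.1 := by
  have h : ∃ f ∈ M, f.2 = e.2 := ⟨e, he, rfl⟩
  rw [pairMap, dif_pos h, hM.eq_of_mem h.choose_spec.1 he (x := e.2)
    (by simp [h.choose_spec.2]) (by simp)]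

lemma pairMap_fst (hM : H.IsEdgeFamily S M) {e : V × V} (he : e ∈ M) : pairMap M e.1 = e.1 := by
  have h : ¬ ∃ f ∈ M, f.2 = e.1 := by
    rintro ⟨f, hf, hfe⟩
    have := hM.eq_of_mem hf he (x := e.1) (by simp [hfe]) (by simp)
    subst this
    exact (hM.adj f hf).ne hfe.symm
  rw [pairMap, dif_neg h]

lemma pairMap_of_notMem {v : V} (hv : ∀ e ∈ M, v ≠ e.1 ∧ v ≠ e.2) : pairMap M v = v := by
  have h : ¬ ∃ f ∈ M, f.2 = v := fun ⟨f, hf, hfe⟩ => (hv f hf).2 hfe.symm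
  rw [pairMap, dif_neg h]

lemma pairMap_eq_fst_iff (hM : H.IsEdgeFamily S M) {e : V × V} (he : e ∈ M) {v : V} :
    pairMap M v = e.1 ↔ v = e.1 ∨ v = e.2 := by
  constructor
  · intro h
    by_cases hv : ∀ f ∈ M, v ≠ f.1 ∧ v ≠ f.2
    · rw [pairMap_of_notMem hv] at h; exact Or.inl h
    · push Not at hv
      obtain ⟨f, hf, hv⟩ := hv
      by_cases h1 : v = f.1
      · subst h1; rw [pairMap_fst hM hf] at h; exact Or.inl h
      · have h2 := hv h1
        subst h2
        rw [pairMap_snd hM hf] at h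
        rw [hM.eq_of_mem hf he (x := f.1) (by simp) (by simp [h])]
        exact Or.inr rfl
  · rintro (rfl | rfl)
    exacts [pairMap_fst hM he, pairMap_snd hM he]

lemma pairMap_eq_iff_of_notMem (hM : H.IsEdgeFamily S M) {v w : V}
    (hw : ∀ e ∈ M, w ≠ e.1 ∧ w ≠ e.2) : pairMap M v = w ↔ v = w := by
  constructor
  · intro h
    by_cases hv : ∀ f ∈ M, v ≠ f.1 ∧ v ≠ f.2
    · rwa [pairMap_of_notMem hv] at h
    · push Not at hv
      obtain ⟨f, hf, hv⟩ := hv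
      by_cases h1 : v = f.1
      · subst h1; rwa [pairMap_fst hM hf] at h
      · have h2 := hv h1
        subst h2
        rw [pairMap_snd hM hf] at h
        exact absurd h.symm (hw f hf).1
  · rintro rfl
    exact pairMap_of_notMem hw

lemma classes_pairMap_fst (hM : H.IsEdgeFamily S M) {e : V × V} (he : e ∈ M) :
    classes (pairMap M) {e.1} = {e.1, e.2} := by
  ext v; simp [classes, pairMap_eq_fst_iff hM he]

lemma classes_pairMap_of_notMem (hM : H.IsEdgeFamily S M) {w : V}
    (hw : ∀ e ∈ M, w ≠ e.1 ∧ w ≠ e.2) : classes (pairMap M) {w} = {w} := by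
  ext v; simp [classes, pairMap_eq_iff_of_notMem hM hw]

lemma not_adj_of_pairMap_eq (hM : Gᶜ.IsEdgeFamily S M) (x y : V)
    (h : pairMap M x = pairMap M y) : ¬ G.Adj x y := by
  by_cases hv : ∀ e ∈ M, y ≠ e.1 ∧ y ≠ e.2
  · rw [pairMap_of_notMem hv, pairMap_eq_iff_of_notMem hM hv] at h
    subst h; exact G.irrefl
  · push Not at hv
    obtain ⟨e, he, hv⟩ := hv
    have hy : y = e.1 ∨ y = e.2 := by tauto
    rw [(pairMap_eq_fst_iff hM he).2 hy, pairMap_eq_fst_iff hM he] at h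
    have hne : ¬ G.Adj e.1 e.2 := ((compl_adj _ _ _).1 (hM.adj e he)).2
    rcases h with rfl | rfl <;> rcases hy with rfl | rfl
    exacts [G.irrefl, hne, fun h => hne h.symm, G.irrefl]

lemma classes_image_pairMap (hM : H.IsEdgeFamily S M) {W : Finset V} (hW : S ⊆ W) :
    classes (pairMap M) (W.image (pairMap M)) = W := by
  ext x
  simp only [classes, mem_filter, mem_univ, true_and, mem_image]
  constructor
  · rintro ⟨y, hy, hxy⟩
    by_cases hv : ∀ e ∈ M, y ≠ e.1 ∧ y ≠ e.2
    · rw [pairMap_of_notMem hv, eq_comm, pairMap_eq_iff_of_notMem hM hv] at hxy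
      exact hxy ▸ hy
    · push Not at hv
      obtain ⟨e, he, hv⟩ := hv
      have hy' : y = e.1 ∨ y = e.2 := by tauto
      rw [(pairMap_eq_fst_iff hM he).2 hy', eq_comm, pairMap_eq_fst_iff hM he] at hxy
      rcases hxy with rfl | rfl
      exacts [hW (hM.left_mem e he), hW (hM.right_mem e he)]
  · exact fun hx => ⟨x, hx, rfl⟩

/-- A vertex of the image of `W` either represents a pair or is a vertex of `W` outside all
pairs. -/
lemma mem_image_pairMap (hM : H.IsEdgeFamily S M) {W : Finset V} {v : V}
    (hv : v ∈ W.image (pairMap M)) :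
    (∃ e ∈ M, v = e.1) ∨ (v ∈ W ∧ ∀ e ∈ M, v ≠ e.1 ∧ v ≠ e.2) := by
  obtain ⟨y, hy, rfl⟩ := mem_image.1 hv
  by_cases hv : ∀ e ∈ M, y ≠ e.1 ∧ y ≠ e.2
  · rw [pairMap_of_notMem hv]; exact Or.inr ⟨hy, hv⟩
  · push Not at hv
    obtain ⟨e, he, hv⟩ := hv
    have hy' : y = e.1 ∨ y = e.2 := by tauto
    exact Or.inl ⟨e, he, (pairMap_eq_fst_iff hM he).2 hy'⟩

end PairMap

end SimpleGraph

/-! ### Non-edges between pairs -/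

namespace SimpleGraph

open Finset

set_option linter.unusedSectionVars false

variable {V : Type*} [Fintype V] [DecidableEq V] {G : SimpleGraph V}

/-- `H.EdgeRich k A` says that `A` spans at least `k` edges of `H`. -/
def EdgeRich (H : SimpleGraph V) (k : ℕ) (A : Finset V) : Prop :=
  ∃ F : Finset (Sym2 V), #F = k ∧ ∀ x ∈ F, x ∈ H.edgeSet ∧ ∀ y ∈ x, y ∈ A

lemma adjPar_add_adjPar_compl {x y : V} (h : x ≠ y) : G.adjPar x y + Gᶜ.adjPar x y = 1 := by
  by_cases ha : G.Adj x y
  · rw [adjPar_of_adj ha, adjPar_of_not_adj (by simp [ha]), add_zero]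
  · rw [adjPar_of_not_adj ha, adjPar_of_adj (by simp [ha, h]), zero_add]

lemma crossPar_add_crossPar_compl {A B : Finset V} (h : Disjoint A B) :
    G.crossPar A B + Gᶜ.crossPar A B = (#A : ZMod 2) * #B := by
  simp only [crossPar, degPar, ← sum_add_distrib]
  rw [sum_congr rfl fun x hx => sum_congr rfl fun y hy =>
    adjPar_add_adjPar_compl (disjoint_iff_ne.1 h x hx y hy)]
  simp

/-- Edges and non-edges between `A` and `B` add up to `2 * #A`. This is why pairing makes the parity
graph of a dense graph sparse. -/
lemma crossPar_compl_of_card_eq_two {A B : Finset V} (h : Disjoint A B) (hB : #B = 2) :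
    Gᶜ.crossPar A B = G.crossPar A B := by
  have := crossPar_add_crossPar_compl (G := G) h
  rw [hB, show ((2 : ℕ) : ZMod 2) = 0 from rfl, mul_zero] at this
  have h2 := zmod_two_add_self (G.crossPar A B)
  linear_combination this - h2

lemma exists_adj_of_crossPar_ne_zero {A B : Finset V} (h : G.crossPar A B ≠ 0) :
    ∃ x ∈ A, ∃ y ∈ B, G.Adj x y := by
  by_contra! hcon
  exact h (sum_eq_zero fun x hx => sum_eq_zero fun y hy => adjPar_of_not_adj (hcon x hx y hy))

section Pairs

variable {S : Finset V} {M : Finset (V × V)}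

lemma card_classes_pairMap (hM : G.IsEdgeFamily S M) {K : Finset V}
    (hK : K ⊆ M.image Prod.fst) : #(classes (pairMap M) K) = 2 * #K := by
  have e : classes (pairMap M) K = K.biUnion fun i => classes (pairMap M) {i} := by
    ext x; simp [classes]
  rw [e, card_biUnion]
  · rw [sum_congr rfl (g := fun _ => 2), sum_const, smul_eq_mul, mul_comm]
    intro i hi
    obtain ⟨f, hf, rfl⟩ := mem_image.1 (hK hi)
    rw [classes_pairMap_fst hM hf, card_pair (hM.adj f hf).ne]
  · intro i _ j _ hij
    exact disjoint_classes (by simpa using hij)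

lemma classes_pairMap_subset (hM : G.IsEdgeFamily S M) {K : Finset V}
    (hK : K ⊆ M.image Prod.fst) : classes (pairMap M) K ⊆ S := by
  intro x hx
  obtain ⟨f, hf, hxf⟩ := mem_image.1 (hK (mem_filter.1 hx).2)
  rcases (pairMap_eq_fst_iff hM hf).1 hxf.symm with rfl | rfl
  exacts [hM.left_mem f hf, hM.right_mem f hf]

/-- Pairwise joined classes span many edges. -/
lemma edgeRich_classes (hM : G.IsEdgeFamily S M) {K : Finset V} (hK : K ⊆ M.image Prod.fst)
    (h : ∀ i ∈ K, ∀ j ∈ K, i ≠ j →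
      ∃ x ∈ classes (pairMap M) {i}, ∃ y ∈ classes (pairMap M) {j}, G.Adj x y) :
    G.EdgeRich ((#K + 1).choose 2) (classes (pairMap M) K) := by
  -- Diagonal elements `s(i, i)` stand for the edge inside the class of `i`, which accounts for `(#K
  -- + 1).choose 2`. The chosen edges are distinct because `pairMap M` maps each of them back to its
  -- `s`.
  have key : ∀ s ∈ K.sym2, ∃ e : Sym2 V, e ∈ G.edgeSet ∧
      (∀ y ∈ e, y ∈ classes (pairMap M) K) ∧ e.map (pairMap M) = s := by
    intro s hs
    induction s with | _ i j =>
    rw [mk_mem_sym2_iff] at hs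
    by_cases hij : i = j
    · subst hij
      obtain ⟨f, hf, rfl⟩ := mem_image.1 (hK hs.1)
      refine ⟨s(f.1, f.2), hM.adj f hf, ?_, ?_⟩
      · intro y hy
        rw [Sym2.mem_iff, ← pairMap_eq_fst_iff hM hf] at hy
        simp [classes, hy, hs.1]
      · rw [Sym2.map_mk, pairMap_fst hM hf, pairMap_snd hM hf]
    · obtain ⟨x, hx, y, hy, hxy⟩ := h i hs.1 j hs.2 hij
      simp only [classes, mem_filter, mem_univ, true_and, mem_singleton] at hx hy
      refine ⟨s(x, y), hxy, ?_, ?_⟩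
      · intro z hz
        rw [Sym2.mem_iff] at hz
        rcases hz with rfl | rfl
        · simp [classes, hx, hs.1]
        · simp [classes, hy, hs.2]
      · rw [Sym2.map_mk, hx, hy]
  choose! f hf1 hf2 hf3 using key
  refine ⟨K.sym2.image f, ?_, ?_⟩
  · rw [card_image_of_injOn, card_sym2]
    intro s hs t ht hst
    rw [← hf3 s hs, ← hf3 t ht, hst]
  · intro x hx
    obtain ⟨s, hs, rfl⟩ := mem_image.1 hx
    exact ⟨hf1 s hs, hf2 s hs⟩

lemma disjoint_classes_singleton {π : V → V} {i j : V} (hij : i ≠ j) :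
    Disjoint (classes π {i}) (classes π {j}) :=
  disjoint_classes (by simpa using hij)

/-- Two classes joined by a positive even number of edges span at least four edges. -/
lemma edgeRich_four (hM : G.IsEdgeFamily S M) {i j : V} (hi : i ∈ M.image Prod.fst)
    (hj : j ∈ M.image Prod.fst) (hij : i ≠ j) {x y : V} (hx : x ∈ classes (pairMap M) {i})
    (hy : y ∈ classes (pairMap M) {j}) (hxy : G.Adj x y)
    (hp : G.crossPar (classes (pairMap M) {i}) (classes (pairMap M) {j}) = 0) :
    G.EdgeRich 4 (classes (pairMap M) {i, j}) := by
  -- A unique cross edge would make the parity one, so there is a second. Together with the edges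
  -- inside the two classes this gives four.
  obtain ⟨x', hx', y', hy', hxy', hne⟩ : ∃ x' ∈ classes (pairMap M) {i},
      ∃ y' ∈ classes (pairMap M) {j}, G.Adj x' y' ∧ (x', y') ≠ (x, y) := by
    by_contra! hcon
    have : G.crossPar (classes (pairMap M) {i}) (classes (pairMap M) {j}) = 1 := by
      simp only [crossPar, degPar]
      rw [← sum_product', sum_eq_single (x, y)]
      · exact adjPar_of_adj hxy
      · rintro ⟨a, b⟩ hab hne
        rw [mem_product] at hab
        exact adjPar_of_not_adj fun h => hne (hcon a hab.1 b hab.2 h)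
      · intro h; exact absurd (mem_product.2 ⟨hx, hy⟩) h
    exact absurd (hp.symm.trans this) (by decide)
  obtain ⟨e, he, rfl⟩ := mem_image.1 hi
  obtain ⟨f, hf, rfl⟩ := mem_image.1 hj
  simp only [classes, mem_filter, mem_univ, true_and, mem_singleton] at hx hy hx' hy'
  have m1 : Sym2.map (pairMap M) s(e.1, e.2) = s(e.1, e.1) := by
    rw [Sym2.map_mk, pairMap_fst hM he, pairMap_snd hM he]
  have m2 : Sym2.map (pairMap M) s(f.1, f.2) = s(f.1, f.1) := by
    rw [Sym2.map_mk, pairMap_fst hM hf, pairMap_snd hM hf]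
  have m3 : Sym2.map (pairMap M) s(x, y) = s(e.1, f.1) := by rw [Sym2.map_mk, hx, hy]
  have m4 : Sym2.map (pairMap M) s(x', y') = s(e.1, f.1) := by rw [Sym2.map_mk, hx', hy']
  have n12 : s(e.1, e.2) ≠ s(f.1, f.2) := by
    intro h
    have := congrArg (Sym2.map (pairMap M)) h
    rw [m1, m2] at this
    simp [hij] at this
  have n1 : ∀ s : Sym2 V, s.map (pairMap M) = s(e.1, f.1) → s(e.1, e.2) ≠ s := by
    rintro s hs rfl
    rw [m1] at hs
    simp [hij] at hs
  have n2 : ∀ s : Sym2 V, s.map (pairMap M) = s(e.1, f.1) → s(f.1, f.2) ≠ s := by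
    rintro s hs rfl
    rw [m2] at hs
    simp [hij.symm] at hs
  have n34 : s(x, y) ≠ s(x', y') := by
    intro h
    rw [Sym2.eq_iff] at h
    rcases h with ⟨rfl, rfl⟩ | ⟨rfl, rfl⟩
    · exact hne rfl
    · exact hij (hx.symm.trans hy')
  refine ⟨{s(e.1, e.2), s(f.1, f.2), s(x, y), s(x', y')}, ?_, ?_⟩
  · rw [card_insert_of_notMem, card_insert_of_notMem, card_pair n34]
    · simp only [mem_insert, mem_singleton, not_or]
      exact ⟨n2 _ m3, n2 _ m4⟩
    · simp only [mem_insert, mem_singleton, not_or]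
      exact ⟨n12, n1 _ m3, n1 _ m4⟩
  · have k1 := pairMap_fst hM he
    have k2 := pairMap_snd hM he
    have k3 := pairMap_fst hM hf
    have k4 := pairMap_snd hM hf
    intro s hs
    simp only [mem_insert, mem_singleton] at hs
    rcases hs with rfl | rfl | rfl | rfl
    · exact ⟨hM.adj e he, fun z hz => by
        rcases Sym2.mem_iff.1 hz with rfl | rfl <;> simp [classes, *]⟩
    · exact ⟨hM.adj f hf, fun z hz => by
        rcases Sym2.mem_iff.1 hz with rfl | rfl <;> simp [classes, *]⟩
    · exact ⟨hxy, fun z hz => by rcases Sym2.mem_iff.1 hz with rfl | rfl <;> simp [classes, *]⟩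
    · exact ⟨hxy', fun z hz => by rcases Sym2.mem_iff.1 hz with rfl | rfl <;> simp [classes, *]⟩

end Pairs

end SimpleGraph

namespace SimpleGraph

open Finset

set_option linter.unusedSectionVars false

variable {V : Type*} [Fintype V] [DecidableEq V] {G : SimpleGraph V}

section Pairs

variable {S W : Finset V} {M : Finset (V × V)}

lemma card_classes_singleton_le (hM : Gᶜ.IsEdgeFamily S M) {q : V}
    (hq : q ∈ W.image (pairMap M)) : #(classes (pairMap M) {q}) ≤ 2 := by
  rcases mem_image_pairMap hM hq with ⟨e, he, rfl⟩ | ⟨-, h⟩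
  · rw [classes_pairMap_fst hM he]; exact card_le_two
  · rw [classes_pairMap_of_notMem hM h]; simp

lemma exists_compl_adj_of_parityQuotient_adj (hM : Gᶜ.IsEdgeFamily S M) {q j : V}
    (hj : j ∈ M.image Prod.fst) (h : (G.parityQuotient (pairMap M)).Adj q j) :
    ∃ x ∈ classes (pairMap M) {q}, ∃ y ∈ classes (pairMap M) {j}, Gᶜ.Adj x y := by
  refine exists_adj_of_crossPar_ne_zero ?_
  have hc : #(classes (pairMap M) {j}) = 2 := by
    rw [card_classes_pairMap hM (by simpa using hj)]; simp
  rw [crossPar_compl_of_card_eq_two (disjoint_classes_singleton h.1) hc, h.2]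
  decide

lemma classes_fst_subset (hM : Gᶜ.IsEdgeFamily S M) {j : V} (hj : j ∈ M.image Prod.fst) :
    classes (pairMap M) {j} ⊆ S := classes_pairMap_subset hM (by simpa using hj)

open Classical in
-- Each `e ∈ E` yields a vertex of the class of `e.1` that is a non-neighbour of some vertex in the
-- class of `q`. These vertices are distinct, and the class of `q` has at most two vertices with at
-- most `u` non-neighbours each in `S`.
lemma card_edgeFamily_le_of_parityQuotient_adj (hM : Gᶜ.IsEdgeFamily S M) {u : ℕ}
    (h4 : ∀ v, #{x ∈ S | Gᶜ.Adj v x} ≤ u) {X : Finset V} (hX : X ⊆ M.image Prod.fst)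
    {E : Finset (V × V)} (hE : (G.parityQuotient (pairMap M)).IsEdgeFamily X E) {q : V}
    (hq : q ∈ W.image (pairMap M))
    (hadj : ∀ e ∈ E, (G.parityQuotient (pairMap M)).Adj q e.1) : #E ≤ 2 * u := by
  have key : ∀ e ∈ E, ∃ y, pairMap M y = e.1 ∧ y ∈ S ∧ ∃ x ∈ classes (pairMap M) {q},
      Gᶜ.Adj x y := by
    intro e he
    have hj := hX (hE.left_mem e he)
    obtain ⟨x, hx, y, hy, hxy⟩ := exists_compl_adj_of_parityQuotient_adj hM hj (hadj e he)
    exact ⟨y, by simpa [classes] using hy, classes_fst_subset hM hj hy, x, hx, hxy⟩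
  have : Nonempty V := ⟨q⟩
  choose! y hy1 hy2 hy3 using key
  have hinj : Set.InjOn y (E : Set (V × V)) := fun e he f hf hef =>
    hE.injOn_fst he hf (by rw [← hy1 e he, ← hy1 f hf, hef])
  rw [← card_image_of_injOn hinj]
  calc #(E.image y) ≤ #((classes (pairMap M) {q}).biUnion fun x => {z ∈ S | Gᶜ.Adj x z}) := by
        refine card_le_card fun z hz => ?_
        obtain ⟨e, he, rfl⟩ := mem_image.1 hz
        obtain ⟨x, hx, hxy⟩ := hy3 e he
        exact mem_biUnion.2 ⟨x, hx, mem_filter.2 ⟨hy2 e he, hxy⟩⟩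
    _ ≤ #(classes (pairMap M) {q}) * u := card_biUnion_le_card_mul _ _ _ fun x _ => h4 x
    _ ≤ 2 * u := Nat.mul_le_mul_right _ (card_classes_singleton_le hM hq)

lemma parityQuotient_adj_of_notMem (hM : Gᶜ.IsEdgeFamily S M) {v v' : V}
    (hv : ∀ e ∈ M, v ≠ e.1 ∧ v ≠ e.2) (hv' : ∀ e ∈ M, v' ≠ e.1 ∧ v' ≠ e.2)
    (h : (G.parityQuotient (pairMap M)).Adj v v') : G.Adj v v' := by
  have := h.2
  rw [classes_pairMap_of_notMem hM hv, classes_pairMap_of_notMem hM hv'] at this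
  by_contra hn
  simp [crossPar, degPar, adjPar_of_not_adj hn] at this

end Pairs

/-! ### The criterion for dense graphs -/

open Classical in
/-- The deterministic criterion for dense graphs. -/
lemma not_evenNonDecomposable_of_dense {S R : Finset V} {u w : ℕ} (hSR : Disjoint S R)
    (hS : 100 * u ≤ #S)
    (h1 : ∀ Q ⊆ S ∪ R, G.IsClique (Q : Set V) → #Q < u)
    (h2 : ∀ 𝒜 : Finset (Finset V), (𝒜 : Set (Finset V)).PairwiseDisjoint id →
      (∀ A ∈ 𝒜, A ⊆ S ∧ #A = 8 ∧ Gᶜ.EdgeRich 10 A) → #𝒜 < u)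
    (h3 : ∀ 𝒜 : Finset (Finset V), (𝒜 : Set (Finset V)).PairwiseDisjoint id →
      (∀ A ∈ 𝒜, A ⊆ S ∧ #A = 4 ∧ Gᶜ.EdgeRich 4 A) → #𝒜 < u)
    (h4 : ∀ v, #{x ∈ S | Gᶜ.Adj v x} < u)
    (h5 : ∀ Q ⊆ univ \ (S ∪ R), G.IsClique (Q : Set V) → #Q ≤ w)
    (h6 : ∀ q ∈ univ \ (S ∪ R), ∀ q' ∈ univ \ (S ∪ R), q ≠ q' →
      w ≤ #{r ∈ R | ¬ (G.Adj r q ↔ G.Adj r q')}) : ¬ G.EvenNonDecomposable := by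
  have hu : 0 < u := h1 ∅ (by simp) (by simp)
  -- All vertices outside `S ∪ R` except at most one are removed at the expense of `R`, so that
  -- afterwards only cliques inside `S ∪ R` need to be small.
  obtain ⟨R', hR', Q₀, -, hQ₀, hreach⟩ :=
    exists_reach_of_distinguish (G := G) disjoint_sdiff hSR h5 h6
  rw [union_sdiff_of_subset (subset_univ _)] at hreach
  set W := S ∪ R' ∪ Q₀ with hW
  have hSW : S ⊆ W := subset_union_left.trans subset_union_left
  obtain ⟨M, hM, I, hIS, hI, hMc⟩ := exists_isEdgeFamily (G := Gᶜ) S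
  have hIu : #I < u := h1 I (hIS.trans subset_union_left) fun x hx y hy hxy => by
    by_contra hn
    exact hI x hx y hy ((compl_adj _ _ _).2 ⟨hxy, hn⟩)
  set π := pairMap M with hπ
  set Γ := G.parityQuotient π with hΓ
  set T := M.image Prod.fst with hT
  have hTc : #T = #M := card_image_of_injOn hM.injOn_fst
  obtain ⟨𝒦, h𝒦, hd, hmax⟩ := exists_maximal_pairwiseDisjoint
    (T.powerset.filter fun A => Γ.IsNClique 4 A)
  have h𝒦T : ∀ K ∈ 𝒦, K ⊆ T ∧ Γ.IsNClique 4 K := fun K hK => by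
    have := mem_filter.1 (h𝒦 hK)
    exact ⟨mem_powerset.1 this.1, this.2⟩
  have hinj : ∀ {𝒞 : Finset (Finset V)}, (𝒞 : Set (Finset V)).PairwiseDisjoint id →
      (∀ K ∈ 𝒞, K ⊆ T ∧ K.Nonempty) → Set.InjOn (classes π) (𝒞 : Set (Finset V)) := by
    intro 𝒞 hd hc K hK K' hK' h
    by_contra hne
    have hdis := disjoint_classes (π := π) (hd hK hK' hne)
    simp only [id] at hdis
    rw [← h, disjoint_self_iff_empty, ← card_eq_zero, card_classes_pairMap hM (hc K hK).1] at hdis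
    have := (hc K hK).2.card_pos
    omega
  have hpd : ∀ {𝒞 : Finset (Finset V)}, (𝒞 : Set (Finset V)).PairwiseDisjoint id →
      ((𝒞.image (classes π) : Finset (Finset V)) : Set (Finset V)).PairwiseDisjoint id := by
    intro 𝒞 hd A hA B hB hAB
    obtain ⟨K, hK, rfl⟩ := mem_image.1 hA
    obtain ⟨K', hK', rfl⟩ := mem_image.1 hB
    exact disjoint_classes (hd hK hK' fun h => hAB (h ▸ rfl))
  -- A `K₄` of the parity graph on four pairs spans eight vertices with ten non-edges: one inside
  -- each pair and one between any two pairs.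
  have h𝒦u : #𝒦 < u := by
    rw [← card_image_of_injOn (hinj hd fun K hK => ⟨(h𝒦T K hK).1,
      card_pos.1 (by rw [(h𝒦T K hK).2.card_eq]; omega)⟩)]
    refine h2 _ (hpd hd) fun A hA => ?_
    obtain ⟨K, hK, rfl⟩ := mem_image.1 hA
    obtain ⟨hKT, hKc⟩ := h𝒦T K hK
    refine ⟨classes_pairMap_subset hM hKT, by rw [card_classes_pairMap hM hKT, hKc.card_eq], ?_⟩
    have := edgeRich_classes hM hKT fun i hi j hj hij =>
      exists_compl_adj_of_parityQuotient_adj hM (hKT hj) (hKc.isClique hi hj hij)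
    rwa [hKc.card_eq] at this
  set X := T \ 𝒦.biUnion id with hX
  have hXT : X ⊆ T := sdiff_subset
  have h𝒦card : #(𝒦.biUnion id) ≤ #𝒦 * 4 := card_biUnion_le_card_mul _ _ _ fun A hA =>
    (h𝒦T A hA).2.card_eq.le
  have hXc : #T ≤ #X + 4 * u := by
    have h5 := le_card_sdiff (𝒦.biUnion id) T
    rw [← hX] at h5
    omega
  have hfree : Γ.CliqueFreeOn (X : Set V) 4 := by
    intro t ht hc
    have ht' : t ⊆ X := coe_subset.1 ht
    refine hmax t (mem_filter.2 ⟨mem_powerset.2 (ht'.trans hXT), hc⟩)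
      (card_pos.1 (by rw [hc.card_eq]; omega)) ?_
    exact disjoint_of_subset_left ht' sdiff_disjoint
  -- A matching of `Γ` is extracted from one of the larger graph `Λ`, which joins pairs with any
  -- non-edge between them. The representatives of a `Λ`-independent set form a clique of `G`, so
  -- `h1` bounds such sets; this would fail for `Γ`.
  let Λ : SimpleGraph V :=
    { Adj := fun i j => i ≠ j ∧ ∃ x ∈ classes π {i}, ∃ y ∈ classes π {j}, Gᶜ.Adj x y
      symm := ⟨fun _ _ h => ⟨h.1.symm, by
        obtain ⟨-, x, hx, y, hy, hxy⟩ := h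
        exact ⟨y, hy, x, hx, hxy.symm⟩⟩⟩
      loopless := ⟨fun _ h => h.1 rfl⟩ }
  obtain ⟨E₁, hE₁, I₁, hI₁X, hI₁, hE₁c⟩ := exists_isEdgeFamily (G := Λ) X
  have hI₁u : #I₁ < u := by
    have hsub : ∀ x ∈ I₁, x ∈ classes π {x} ∧ x ∈ S := by
      intro x hx
      obtain ⟨e, he, rfl⟩ := mem_image.1 (hXT (hI₁X hx))
      exact ⟨by simp [classes, hπ, pairMap_fst hM he], hM.left_mem e he⟩
    refine h1 I₁ (fun x hx => mem_union_left _ (hsub x hx).2) fun x hx y hy hxy => ?_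
    by_contra hn
    exact hI₁ x hx y hy ⟨hxy, x, (hsub x hx).1, y, (hsub y hy).1, (compl_adj _ _ _).2 ⟨hxy, hn⟩⟩
  set E := E₁.filter fun e => Γ.Adj e.1 e.2 with hE
  set E₂ := E₁.filter fun e => ¬ Γ.Adj e.1 e.2 with hE₂
  have hEc : #E + #E₂ = #E₁ := card_filter_add_card_filter_not _
  have hEf : Γ.IsEdgeFamily X E := ⟨fun e he => hE₁.left_mem e (mem_filter.1 he).1,
    fun e he => hE₁.right_mem e (mem_filter.1 he).1, fun e he => (mem_filter.1 he).2,
    fun e he f hf => hE₁.disjoint e (mem_filter.1 he).1 f (mem_filter.1 hf).1⟩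
  -- A `Λ`-edge outside `Γ` has a positive even number of non-edges across it, hence four non-edges
  -- on four vertices, and `h3` bounds disjoint families of these.
  have hE₂u : #E₂ < u := by
    have hpair : Set.InjOn (fun e : V × V => ({e.1, e.2} : Finset V)) (E₂ : Set (V × V)) := by
      intro e he f hf hef
      have hef' : ({e.1, e.2} : Finset V) = {f.1, f.2} := hef
      exact hE₁.eq_of_mem (mem_filter.1 he).1 (mem_filter.1 hf).1 (x := e.1) (by simp)
        (by rw [← hef']; simp)
    have hd₂ : ((E₂.image fun e : V × V => ({e.1, e.2} : Finset V) : Finset (Finset V)) :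
        Set (Finset V)).PairwiseDisjoint id := by
      intro A hA B hB hAB
      obtain ⟨e, he, rfl⟩ := mem_image.1 hA
      obtain ⟨f, hf, rfl⟩ := mem_image.1 hB
      exact hE₁.disjoint e (mem_filter.1 he).1 f (mem_filter.1 hf).1 fun h => hAB (h ▸ rfl)
    have hsub : ∀ e ∈ E₂, e.1 ∈ T ∧ e.2 ∈ T := fun e he =>
      ⟨hXT (hE₁.left_mem e (mem_filter.1 he).1), hXT (hE₁.right_mem e (mem_filter.1 he).1)⟩
    rw [← card_image_of_injOn hpair, ← card_image_of_injOn (hinj hd₂ fun K hK => by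
      obtain ⟨e, he, rfl⟩ := mem_image.1 hK
      exact ⟨by simp [insert_subset_iff, hsub e he], by simp⟩)]
    refine h3 _ (hpd hd₂) fun A hA => ?_
    obtain ⟨K, hK, rfl⟩ := mem_image.1 hA
    obtain ⟨e, he, rfl⟩ := mem_image.1 hK
    have hKT : ({e.1, e.2} : Finset V) ⊆ T := by simp [insert_subset_iff, hsub e he]
    obtain ⟨hne, x, hx, y, hy, hxy⟩ := hE₁.adj e (mem_filter.1 he).1
    refine ⟨classes_pairMap_subset hM hKT, by rw [card_classes_pairMap hM hKT, card_pair hne], ?_⟩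
    refine edgeRich_four hM (hsub e he).1 (hsub e he).2 hne hx hy hxy ?_
    have hc : #(classes π {e.2}) = 2 := by
      rw [card_classes_pairMap hM (singleton_subset_iff.2 (hsub e he).2)]; simp
    rw [crossPar_compl_of_card_eq_two (disjoint_classes_singleton hne) hc]
    exact (zmod_two_cases _).resolve_right fun h => (mem_filter.1 he).2 ⟨hne, h⟩
  have hTA : T ⊆ W.image π := by
    intro x hx
    obtain ⟨e, he, rfl⟩ := mem_image.1 hx
    exact mem_image.2 ⟨e.1, hSW (hM.left_mem e he), pairMap_fst hM he⟩
  -- Outside `X` there are at most `4 * u` vertices of packed `K₄`'s, the unpaired vertices in `S ∪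
  -- R`, on which `Γ`-adjacency implies `G`-adjacency, and at most one vertex of `Q₀`.
  have hB : ∀ Q ⊆ W.image π \ X, Γ.IsClique (Q : Set V) → #Q ≤ 5 * u := by
    intro Q hQ hQc
    have hsplit : Q ⊆ 𝒦.biUnion id ∪ ((Q \ T).filter (· ∈ S ∪ R) ∪ Q₀) := by
      intro x hx
      have hx' := mem_sdiff.1 (hQ hx)
      by_cases hxT : x ∈ T
      · refine mem_union_left _ ?_
        by_contra hn
        exact hx'.2 (mem_sdiff.2 ⟨hxT, hn⟩)
      · refine mem_union_right _ ?_
        rcases mem_image_pairMap hM hx'.1 with ⟨e, he, rfl⟩ | ⟨hxW, -⟩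
        · exact absurd (mem_image_of_mem _ he) hxT
        · rw [hW, mem_union, mem_union] at hxW
          rcases hxW with (h | h) | h
          · exact mem_union_left _ (mem_filter.2 ⟨mem_sdiff.2 ⟨hx, hxT⟩, mem_union_left _ h⟩)
          · exact mem_union_left _
              (mem_filter.2 ⟨mem_sdiff.2 ⟨hx, hxT⟩, mem_union_right _ (hR' h)⟩)
          · exact mem_union_right _ h
    have hcl : #((Q \ T).filter (· ∈ S ∪ R)) < u := by
      refine h1 _ (fun x hx => (mem_filter.1 hx).2) fun x hx y hy hxy => ?_
      have aux : ∀ z ∈ (Q \ T).filter (· ∈ S ∪ R), z ∈ Q ∧ ∀ e ∈ M, z ≠ e.1 ∧ z ≠ e.2 := by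
        intro z hz
        have hz' := mem_sdiff.1 (mem_filter.1 hz).1
        refine ⟨hz'.1, ?_⟩
        rcases mem_image_pairMap hM (mem_sdiff.1 (hQ hz'.1)).1 with ⟨e, he, rfl⟩ | ⟨-, h⟩
        · exact absurd (mem_image_of_mem _ he) hz'.2
        · exact h
      exact parityQuotient_adj_of_notMem hM (aux x hx).2 (aux y hy).2
        (hQc (aux x hx).1 (aux y hy).1 hxy)
    have e1 := (card_le_card hsplit).trans (card_union_le _ _)
    have e2 := card_union_le ((Q \ T).filter (· ∈ S ∪ R)) Q₀
    omega
  -- The absorption needs `7 * u` edges; the counts above leave more than `21 * u` edges in `E`.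
  obtain ⟨X', hX', hr⟩ := exists_reach_subset (G := Γ) (b := 2 * u) (w := 5 * u)
    (B := W.image π \ X) disjoint_sdiff hEf
    (fun q hq E' hE' hadj => card_edgeFamily_le_of_parityQuotient_adj hM (fun v => (h4 v).le) hXT
      (hEf.subset hE') (mem_sdiff.1 hq).1 fun e he => (hadj e he).1) hB (by omega)
  rw [union_sdiff_of_subset (hXT.trans hTA)] at hr
  exact not_evenNonDecomposable_of_parityQuotient (not_adj_of_pairMap_eq hM)
    (by rwa [classes_image_pairMap hM hSW]) hr fun t ht => hfree (ht.trans (coe_subset.2 hX'))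

end SimpleGraph

/-! ### The criterion for intermediate densities: disjoint paths in the complement -/

namespace SimpleGraph

open Finset

set_option linter.unusedSectionVars false

variable {V : Type*} [Fintype V] [DecidableEq V] {G : SimpleGraph V}

/-- The pairs that are consecutive on one of `m` disjoint paths with four vertices. -/
def PathPair {m : ℕ} (x y : Fin m × Fin 4) : Prop :=
  x.1 = y.1 ∧ (x.2.val + 1 = y.2.val ∨ y.2.val + 1 = x.2.val)

/-- The first and the last edge of each of `m` disjoint paths with four vertices. -/
def pathEnds {m : ℕ} (s : Fin m × Fin 4 → V) : Finset (V × V) :=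
  univ.image fun i : Fin m × Fin 2 => (s (i.1, ![0, 2] i.2), s (i.1, ![1, 3] i.2))

section PathPattern

variable {m : ℕ} {s : Fin m × Fin 4 → V}

lemma mem_pathEnds {e : V × V} : e ∈ pathEnds s ↔
    ∃ i, e = (s (i, 0), s (i, 1)) ∨ e = (s (i, 2), s (i, 3)) := by
  simp only [pathEnds, mem_image, mem_univ, true_and, Prod.exists, Fin.exists_fin_two,
    Matrix.cons_val_zero, Matrix.cons_val_one, eq_comm]

lemma isEdgeFamily_pathEnds (hs : Function.Injective s)
    (hG : ∀ x y, x ≠ y → (G.Adj (s x) (s y) ↔ ¬ PathPair x y)) :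
    Gᶜ.IsEdgeFamily (univ.image s) (pathEnds s) := by
  refine ⟨?_, ?_, ?_, ?_⟩
  · intro e he
    obtain ⟨i, rfl | rfl⟩ := mem_pathEnds.1 he <;> exact mem_image_of_mem _ (mem_univ _)
  · intro e he
    obtain ⟨i, rfl | rfl⟩ := mem_pathEnds.1 he <;> exact mem_image_of_mem _ (mem_univ _)
  · intro e he
    obtain ⟨i, rfl | rfl⟩ := mem_pathEnds.1 he
    · have hne : ((i, 0) : Fin m × Fin 4) ≠ (i, 1) := by simp
      exact (compl_adj _ _ _).2 ⟨hs.ne hne, by rw [hG _ _ hne]; simp [PathPair]⟩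
    · have hne : ((i, 2) : Fin m × Fin 4) ≠ (i, 3) := by simp
      exact (compl_adj _ _ _).2 ⟨hs.ne hne, by rw [hG _ _ hne]; simp [PathPair]⟩
  · intro e he f hf hef
    obtain ⟨i, rfl | rfl⟩ := mem_pathEnds.1 he <;> obtain ⟨j, rfl | rfl⟩ := mem_pathEnds.1 hf <;>
      · simp only [disjoint_insert_left, disjoint_singleton_left, mem_insert, mem_singleton,
          hs.eq_iff, Prod.mk.injEq]
        by_cases hij : i = j
        · subst hij; first | exact absurd rfl hef | simp
        · simp [hij]

lemma mem_fst_pathEnds {x : V} : x ∈ (pathEnds s).image Prod.fst ↔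
    ∃ i, x = s (i, 0) ∨ x = s (i, 2) := by
  simp only [mem_image, mem_pathEnds]
  constructor
  · rintro ⟨e, ⟨i, rfl | rfl⟩, rfl⟩
    exacts [⟨i, Or.inl rfl⟩, ⟨i, Or.inr rfl⟩]
  · rintro ⟨i, rfl | rfl⟩
    exacts [⟨_, ⟨i, Or.inl rfl⟩, rfl⟩, ⟨_, ⟨i, Or.inr rfl⟩, rfl⟩]

lemma classes_pathEnds_zero (hM : Gᶜ.IsEdgeFamily (univ.image s) (pathEnds s)) (i : Fin m) :
    classes (pairMap (pathEnds s)) {s (i, 0)} = {s (i, 0), s (i, 1)} :=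
  classes_pairMap_fst hM (e := (s (i, 0), s (i, 1))) (mem_pathEnds.2 ⟨i, Or.inl rfl⟩)

lemma classes_pathEnds_two (hM : Gᶜ.IsEdgeFamily (univ.image s) (pathEnds s)) (i : Fin m) :
    classes (pairMap (pathEnds s)) {s (i, 2)} = {s (i, 2), s (i, 3)} :=
  classes_pairMap_fst hM (e := (s (i, 2), s (i, 3))) (mem_pathEnds.2 ⟨i, Or.inr rfl⟩)

lemma crossPar_pair_pair {a b c d : V} (hab : a ≠ b) (hcd : c ≠ d) :
    G.crossPar {a, b} {c, d} =
      G.adjPar a c + G.adjPar a d + (G.adjPar b c + G.adjPar b d) := by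
  simp only [crossPar, degPar, sum_pair hab, sum_pair hcd]

/-- Of the four cross pairs only the middle edge of the path is missing, and three is odd. -/
lemma parityQuotient_pathEnds_adj (hs : Function.Injective s)
    (hG : ∀ x y, x ≠ y → (G.Adj (s x) (s y) ↔ ¬ PathPair x y)) (i : Fin m) :
    (G.parityQuotient (pairMap (pathEnds s))).Adj (s (i, 0)) (s (i, 2)) := by
  have hM := isEdgeFamily_pathEnds hs hG
  refine ⟨hs.ne (by simp), ?_⟩
  rw [classes_pathEnds_zero hM, classes_pathEnds_two hM,
    crossPar_pair_pair (hs.ne (by simp)) (hs.ne (by simp)),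
    adjPar_of_adj ((hG _ _ (by simp)).2 (by simp [PathPair])),
    adjPar_of_adj ((hG _ _ (by simp)).2 (by simp [PathPair])),
    adjPar_of_not_adj (by rw [hG _ _ (by simp)]; simp [PathPair]),
    adjPar_of_adj ((hG _ _ (by simp)).2 (by simp [PathPair]))]
  decide

/-- Between different paths all four cross pairs are edges of `G`, an even number. -/
lemma not_parityQuotient_pathEnds_adj (hs : Function.Injective s)
    (hG : ∀ x y, x ≠ y → (G.Adj (s x) (s y) ↔ ¬ PathPair x y)) {i j : Fin m} (hij : i ≠ j)
    {x y : V} (hx : x = s (i, 0) ∨ x = s (i, 2)) (hy : y = s (j, 0) ∨ y = s (j, 2)) :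
    ¬ (G.parityQuotient (pairMap (pathEnds s))).Adj x y := by
  have hM := isEdgeFamily_pathEnds hs hG
  have ha : ∀ a b, G.adjPar (s (i, a)) (s (j, b)) = 1 := fun a b =>
    adjPar_of_adj ((hG _ _ (by simp [hij])).2 (by simp [PathPair, hij]))
  rintro ⟨-, h⟩
  revert h
  rcases hx with rfl | rfl <;> rcases hy with rfl | rfl <;>
  · simp only [classes_pathEnds_zero hM, classes_pathEnds_two hM]
    rw [crossPar_pair_pair (hs.ne (by simp)) (hs.ne (by simp))]
    simp only [ha]
    decide

/-- On the path ends the parity graph is a perfect matching, so one additional vertex creates at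
most triangles. -/
lemma cliqueFreeOn_pathEnds (hs : Function.Injective s)
    (hG : ∀ x y, x ≠ y → (G.Adj (s x) (s y) ↔ ¬ PathPair x y)) {Q : Finset V} (hQ : #Q ≤ 1) :
    (G.parityQuotient (pairMap (pathEnds s))).CliqueFreeOn
      (((pathEnds s).image Prod.fst ∪ Q : Finset V) : Set V) 4 := by
  intro t ht hc
  have h3 : 3 ≤ #(t \ Q) := by
    have := le_card_sdiff Q t
    rw [hc.card_eq] at this
    omega
  have hT : ∀ x ∈ t \ Q, ∃ i, x = s (i, 0) ∨ x = s (i, 2) := by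
    intro x hx
    rw [mem_sdiff] at hx
    exact mem_fst_pathEnds.1 ((mem_union.1 (coe_subset.1 ht hx.1)).resolve_right hx.2)
  obtain ⟨x, hx⟩ := card_pos.1 (by omega : 0 < #(t \ Q))
  obtain ⟨i, hi⟩ := hT x hx
  have hsub : t \ Q ⊆ {s (i, 0), s (i, 2)} := by
    intro y hy
    obtain ⟨j, hj⟩ := hT y hy
    by_cases hxy : x = y
    · subst hxy; simpa using hi
    by_cases hij : i = j
    · subst hij; simpa using hj
    exact absurd (hc.isClique (mem_sdiff.1 hx).1 (mem_sdiff.1 hy).1 hxy)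
      (not_parityQuotient_pathEnds_adj hs hG hij hi hj)
  have := (card_le_card hsub).trans card_le_two
  omega

end PathPattern

lemma crossPar_singleton_pair {q a b : V} (hab : a ≠ b)
    (h : G.crossPar {q} {a, b} = 1) : ¬ (G.Adj q a ↔ G.Adj q b) := by
  intro hq
  simp only [crossPar, degPar, sum_singleton, sum_pair hab] at h
  by_cases ha : G.Adj q a
  · rw [adjPar_of_adj ha, adjPar_of_adj (hq.1 ha)] at h
    exact absurd h (by decide)
  · rw [adjPar_of_not_adj ha, adjPar_of_not_adj fun h => ha (hq.2 h)] at h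
    exact absurd h (by decide)

open Classical in
/-- The deterministic criterion for graphs of intermediate density. -/
lemma not_evenNonDecomposable_of_pathPattern {m k b w : ℕ} {s : Fin m × Fin 4 → V}
    (hs : Function.Injective s) (hG : ∀ x y, x ≠ y → (G.Adj (s x) (s y) ↔ ¬ PathPair x y))
    {R : Finset V} (hSR : Disjoint (univ.image s) R)
    (hbad : ∀ q ∈ R, #{i | ¬ (G.Adj q (s (i, 0)) ↔ G.Adj q (s (i, 1))) ∧
      ¬ (G.Adj q (s (i, 2)) ↔ G.Adj q (s (i, 3)))} ≤ b)
    (hk : ∀ Q ⊆ R, G.IsClique (Q : Set V) → #Q ≤ k) (hm : b + k ≤ m)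
    (h5 : ∀ Q ⊆ univ \ (univ.image s ∪ R), G.IsClique (Q : Set V) → #Q ≤ w)
    (h6 : ∀ q ∈ univ \ (univ.image s ∪ R), ∀ q' ∈ univ \ (univ.image s ∪ R), q ≠ q' →
      w ≤ #{r ∈ R | ¬ (G.Adj r q ↔ G.Adj r q')}) : ¬ G.EvenNonDecomposable := by
  set S := univ.image s with hS
  obtain ⟨R', hR', Q₀, hQ₀R, hQ₀, hreach⟩ :=
    exists_reach_of_distinguish (G := G) disjoint_sdiff hSR h5 h6
  rw [union_sdiff_of_subset (subset_univ _)] at hreach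
  set W := S ∪ R' ∪ Q₀ with hW
  have hSW : S ⊆ W := subset_union_left.trans subset_union_left
  have hM := isEdgeFamily_pathEnds hs hG
  set M := pathEnds s with hMdef
  set Γ := G.parityQuotient (pairMap M) with hΓ
  set T := M.image Prod.fst with hT
  have hout : ∀ v, v ∉ S → ∀ e ∈ M, v ≠ e.1 ∧ v ≠ e.2 := fun v hv e he =>
    ⟨fun h => hv (h ▸ hM.left_mem e he), fun h => hv (h ▸ hM.right_mem e he)⟩
  have hTA : T ∪ Q₀ ⊆ W.image (pairMap M) := by
    intro x hx
    rcases mem_union.1 hx with hx | hx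
    · obtain ⟨e, he, rfl⟩ := mem_image.1 hx
      exact mem_image.2 ⟨e.1, hSW (hM.left_mem e he), pairMap_fst hM he⟩
    · refine mem_image.2 ⟨x, mem_union_right _ hx, pairMap_of_notMem (hout x fun h => ?_)⟩
      exact (mem_sdiff.1 (hQ₀R hx)).2 (mem_union_left _ h)
  have hB : ∀ x ∈ W.image (pairMap M) \ (T ∪ Q₀), x ∈ R ∧ x ∉ S := by
    intro x hx
    rw [mem_sdiff, mem_union, not_or] at hx
    have hxR : x ∈ R := by
      rcases mem_image_pairMap hM hx.1 with ⟨e, he, rfl⟩ | ⟨hxW, hxM⟩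
      · exact absurd (mem_image_of_mem _ he) hx.2.1
      · rw [hW, mem_union, mem_union] at hxW
        rcases hxW with (h | h) | h
        · obtain ⟨⟨i, c⟩, -, rfl⟩ := mem_image.1 h
          have h0 := hxM _ (mem_pathEnds.2 ⟨i, Or.inl rfl⟩)
          have h2 := hxM _ (mem_pathEnds.2 ⟨i, Or.inr rfl⟩)
          fin_cases c <;> simp at h0 h2
        · exact hR' h
        · exact absurd h hx.2.2
    exact ⟨hxR, Finset.disjoint_right.1 hSR hxR⟩
  set E : Finset (V × V) := univ.image fun i : Fin m => (s (i, 0), s (i, 2)) with hE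
  have hEinj : Function.Injective fun i : Fin m => (s (i, 0), s (i, 2)) := by
    intro i j hij
    have := hs (Prod.mk.inj hij).1
    exact (Prod.mk.inj this).1
  have hEf : Γ.IsEdgeFamily (T ∪ Q₀) E := by
    refine ⟨?_, ?_, ?_, ?_⟩
    · intro e he
      obtain ⟨i, -, rfl⟩ := mem_image.1 he
      exact mem_union_left _ (mem_fst_pathEnds.2 ⟨i, Or.inl rfl⟩)
    · intro e he
      obtain ⟨i, -, rfl⟩ := mem_image.1 he
      exact mem_union_left _ (mem_fst_pathEnds.2 ⟨i, Or.inr rfl⟩)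
    · intro e he
      obtain ⟨i, -, rfl⟩ := mem_image.1 he
      exact parityQuotient_pathEnds_adj hs hG i
    · intro e he f hf hef
      obtain ⟨i, -, rfl⟩ := mem_image.1 he
      obtain ⟨j, -, rfl⟩ := mem_image.1 hf
      have hij : i ≠ j := fun h => hef (h ▸ rfl)
      simp [hs.eq_iff, hij.symm]
  -- A singleton class is adjacent to a pair only if its vertex sees exactly one member of that
  -- pair. Hence an edge inside the neighbourhood of `q` comes from a path counted in `hbad`.
  have hbadE : ∀ q ∈ W.image (pairMap M) \ (T ∪ Q₀), ∀ E' ⊆ E,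
      (∀ e ∈ E', Γ.Adj q e.1 ∧ Γ.Adj q e.2) → #E' ≤ b := by
    intro q hq E' hE' hadj
    obtain ⟨hqR, hqS⟩ := hB q hq
    refine le_trans ?_ (hbad q hqR)
    refine (card_le_card fun e he => ?_).trans
      (card_image_le (f := fun i : Fin m => (s (i, 0), s (i, 2))))
    obtain ⟨i, -, rfl⟩ := mem_image.1 (hE' he)
    obtain ⟨ha, hb⟩ := hadj _ he
    have ha' := ha.2
    have hb' := hb.2
    rw [classes_pairMap_of_notMem hM (hout q hqS)] at ha' hb'
    simp only at ha' hb'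
    rw [classes_pathEnds_zero hM] at ha'
    rw [classes_pathEnds_two hM] at hb'
    exact mem_image_of_mem _ (mem_filter.2 ⟨mem_univ _,
      crossPar_singleton_pair (hs.ne (by simp)) ha', crossPar_singleton_pair (hs.ne (by simp)) hb'⟩)
  obtain ⟨X', hX', hr⟩ := exists_reach_subset (G := Γ) (b := b) (w := k)
    (B := W.image (pairMap M) \ (T ∪ Q₀)) disjoint_sdiff hEf hbadE
    (fun Q hQ hQc => hk Q (fun x hx => (hB x (hQ hx)).1) fun x hx y hy hxy =>
      parityQuotient_adj_of_notMem hM (hout x (hB x (hQ hx)).2) (hout y (hB y (hQ hy)).2)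
        (hQc hx hy hxy))
    (by rw [card_image_of_injective _ hEinj, card_univ, Fintype.card_fin]; exact hm)
  rw [union_sdiff_of_subset hTA] at hr
  exact not_evenNonDecomposable_of_parityQuotient (not_adj_of_pairMap_eq hM)
    (by rwa [classes_image_pairMap hM hSW]) hr
    fun t ht => cliqueFreeOn_pathEnds hs hG hQ₀ (ht.trans (coe_subset.2 hX'))

end SimpleGraph

/-! ### Product structure of the binomial random graph -/

namespace SimpleGraph

open Finset MeasureTheory ProbabilityTheory unitInterval

set_option linter.unusedSectionVars false

variable {V : Type*} [Fintype V] [DecidableEq V]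

/-- The law of the indicator of an unordered pair in the binomial random graph. -/
noncomputable def slotLaw (p : I) (e : Sym2 V) : Measure Prop :=
  toNNReal p • .dirac (¬ e.IsDiag) + toNNReal (σ p) • .dirac False

instance (p : I) (e : Sym2 V) : IsProbabilityMeasure (slotLaw p e) := by
  unfold slotLaw
  infer_instance

lemma binomialRandom_apply_preimage (p : I) (A : Set (SimpleGraph V)) :
    binomialRandom V p A =
      Measure.infinitePi (slotLaw (V := V) p) {f | fromEdgeSet {e | f e} ∈ A} := by
  have hA : MeasurableSet A := by
    have := measurableEmbedding_edgeSet (V := V)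
    rw [← Set.preimage_image_eq A edgeSet_injective]
    exact this.measurable ((Set.toFinite _).measurableSet)
  rw [binomialRandom_eq_map, Measure.map_apply (by fun_prop) hA, setBernoulli_apply']
  have : (fun i : Sym2 V => toNNReal p • Measure.dirac (i ∈ (Sym2.diagSetᶜ : Set (Sym2 V))) +
      toNNReal (σ p) • Measure.dirac False) = slotLaw p := by
    funext e; simp [slotLaw]
  rw [this]
  rfl

/-- The probability that all edges in `F` and no edges in `F'` are present. -/
lemma binomialRandom_real_cylinder (p : I) {F F' : Finset (Sym2 V)} (hF : Disjoint F F')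
    (hd : ∀ e ∈ F, ¬ e.IsDiag) (hd' : ∀ e ∈ F', ¬ e.IsDiag) :
    (binomialRandom V p).real {G | (∀ e ∈ F, e ∈ G.edgeSet) ∧ ∀ e ∈ F', e ∉ G.edgeSet} =
      (p : ℝ) ^ #F * (1 - p : ℝ) ^ #F' := by
  classical
  rw [measureReal_def, binomialRandom_apply_preimage]
  -- In the product space the event is a box, with `True` on `F` and `False` on `F'`;
  -- non-diagonality makes the coordinates agree with the edges.
  have h : {f : Sym2 V → Prop | fromEdgeSet {e | f e} ∈
      {G : SimpleGraph V | (∀ e ∈ F, e ∈ G.edgeSet) ∧ ∀ e ∈ F', e ∉ G.edgeSet}} =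
      Set.pi (F ∪ F' : Finset (Sym2 V)) fun e => if e ∈ F then {True} else {False} := by
    ext f
    simp only [Set.mem_ofPred_eq, edgeSet_fromEdgeSet, Set.mem_pi, coe_union, Set.mem_union,
      mem_coe]
    constructor
    · rintro ⟨h1, h2⟩ e he
      by_cases heF : e ∈ F
      · simpa [heF] using (h1 e heF).1
      · have := h2 e (he.resolve_left heF)
        simp only [heF, if_false, Set.mem_singleton_iff, eq_iff_iff, iff_false]
        exact fun hf => this ⟨hf, hd' e (he.resolve_left heF)⟩
    · intro h
      refine ⟨fun e he => ⟨?_, hd e he⟩, fun e he => ?_⟩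
      · simpa [he] using h e (Or.inl he)
      · have := h e (Or.inr he)
        simp only [Finset.disjoint_right.1 hF he, if_false, Set.mem_singleton_iff, eq_iff_iff,
          iff_false] at this
        exact fun hf => this hf.1
  rw [h, Measure.infinitePi_pi _ (fun i _ => (Set.toFinite _).measurableSet), prod_union hF]
  have h1 : ∀ e ∈ F, slotLaw p e (if e ∈ F then {True} else {False}) = toNNReal p := by
    intro e he
    simp [slotLaw, he, hd e he]
  have h2 : ∀ e ∈ F', slotLaw p e (if e ∈ F then {True} else {False}) = toNNReal (σ p) := by
    intro e he
    simp only [Finset.disjoint_right.1 hF he, slotLaw, hd' e he]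
    simp
  rw [prod_congr rfl h1, prod_congr rfl h2]
  simp

/-- Events depending on disjoint sets of pairs are independent. -/
lemma binomialRandom_real_inter (p : I) {D D' : Finset (Sym2 V)} (hD : Disjoint D D')
    {A A' : Set (SimpleGraph V)}
    (hA : ∀ G G', (∀ e ∈ D, e ∈ G.edgeSet ↔ e ∈ G'.edgeSet) → (G ∈ A ↔ G' ∈ A))
    (hA' : ∀ G G', (∀ e ∈ D', e ∈ G.edgeSet ↔ e ∈ G'.edgeSet) → (G ∈ A' ↔ G' ∈ A')) :
    (binomialRandom V p).real (A ∩ A') =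
      (binomialRandom V p).real A * (binomialRandom V p).real A' := by
  classical
  have hind : iIndepFun (fun (e : Sym2 V) (f : Sym2 V → Prop) => f e)
      (Measure.infinitePi (slotLaw (V := V) p)) :=
    iIndepFun_infinitePi (X := fun _ ω => ω) (by fun_prop)
  have h2 := hind.indepFun_finset _ _ hD (fun e => by fun_prop)
  -- An event depending only on the pairs in `E` is the preimage of a set under restriction to `E`,
  -- so independence of disjoint groups of coordinates applies.
  have key : ∀ (E : Finset (Sym2 V)) (B : Set (SimpleGraph V)),
      (∀ G G', (∀ e ∈ E, e ∈ G.edgeSet ↔ e ∈ G'.edgeSet) → (G ∈ B ↔ G' ∈ B)) →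
      ∃ C : Set (E → Prop), {f : Sym2 V → Prop | fromEdgeSet {e | f e} ∈ B} =
        (fun f (e : E) => f e) ⁻¹' C := by
    intro E B hB
    refine ⟨{g | fromEdgeSet {e | ∃ h : e ∈ E, g ⟨e, h⟩} ∈ B}, ?_⟩
    ext f
    simp only [Set.mem_ofPred_eq, Set.mem_preimage]
    refine hB _ _ fun e he => ?_
    simp [he]
  obtain ⟨C, hC⟩ := key D A hA
  obtain ⟨C', hC'⟩ := key D' A' hA'
  have h3 := h2.measure_inter_preimage_eq_mul C C' (Set.toFinite _).measurableSet
    (Set.toFinite _).measurableSet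
  rw [← hC, ← hC', ← binomialRandom_apply_preimage, ← binomialRandom_apply_preimage] at h3
  rw [measureReal_def, measureReal_def, measureReal_def, ← ENNReal.toReal_mul, ← h3,
    binomialRandom_apply_preimage]
  rfl

lemma binomialRandom_real_iInter_le (p : I) {ι : Type*} [DecidableEq ι] {D : ι → Finset (Sym2 V)}
    (J : Finset ι) (hD : (J : Set ι).PairwiseDisjoint D) {A : ι → Set (SimpleGraph V)}
    (hA : ∀ i G G', (∀ e ∈ D i, e ∈ G.edgeSet ↔ e ∈ G'.edgeSet) → (G ∈ A i ↔ G' ∈ A i)) {x : ℝ}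
    (hx : ∀ i ∈ J, (binomialRandom V p).real (A i) ≤ x) :
    (binomialRandom V p).real {G | ∀ i ∈ J, G ∈ A i} ≤ x ^ #J := by
  induction J using Finset.induction_on with
  | empty => simp
  | insert i J hi ih =>
    have hdis : Disjoint (D i) (J.biUnion D) := by
      rw [Finset.disjoint_biUnion_right]
      exact fun j hj => hD (by simp) (by simp [hj]) fun h => hi (h ▸ hj)
    have h4 : {G : SimpleGraph V | ∀ j ∈ insert i J, G ∈ A j} =
        A i ∩ {G | ∀ j ∈ J, G ∈ A j} := by
      ext G; simp
    rw [h4, binomialRandom_real_inter p hdis (hA i), card_insert_of_notMem hi, pow_succ']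
    · have h0 := hx i (mem_insert_self _ _)
      exact mul_le_mul h0 (ih (hD.subset (by simp)) fun j hj => hx j (mem_insert_of_mem hj))
        measureReal_nonneg (measureReal_nonneg.trans h0)
    · intro G G' h
      simp only [Set.mem_ofPred_eq]
      exact forall₂_congr fun j hj => hA j G G' fun e he => h e (mem_biUnion.2 ⟨j, hj, he⟩)

/-- The union bound over a finite set. -/
lemma measureReal_exists_le {Ω : Type*} [MeasurableSpace Ω] (μ : Measure Ω) [IsFiniteMeasure μ]
    {ι : Type*} (J : Finset ι) (A : ι → Set Ω) {x : ℝ} (hA : ∀ i ∈ J, μ.real (A i) ≤ x) :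
    μ.real {ω | ∃ i ∈ J, ω ∈ A i} ≤ #J * x := by
  have : {ω | ∃ i ∈ J, ω ∈ A i} = ⋃ i ∈ J, A i := by ext; simp
  rw [this]
  calc μ.real (⋃ i ∈ J, A i) ≤ ∑ i ∈ J, μ.real (A i) := measureReal_biUnion_finset_le _ _
    _ ≤ ∑ i ∈ J, x := sum_le_sum hA
    _ = #J * x := by simp

end SimpleGraph

/-! ### First moment bounds -/

namespace SimpleGraph

open Finset MeasureTheory ProbabilityTheory unitInterval

set_option linter.unusedSectionVars false

variable {V : Type*} [Fintype V] [DecidableEq V]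

/-- The random graph `H G`, where `G` is a binomial random graph, contains every given set of
edges with probability at most the corresponding power of `x`. -/
def EdgeBound (p : I) (H : SimpleGraph V → SimpleGraph V) (x : ℝ) : Prop :=
  0 ≤ x ∧ ∀ F : Finset (Sym2 V), (∀ e ∈ F, ¬ e.IsDiag) →
    (binomialRandom V p).real {G | ∀ e ∈ F, e ∈ (H G).edgeSet} ≤ x ^ #F

lemma edgeBound_id (p : I) : EdgeBound (V := V) p id p := by
  refine ⟨p.2.1, fun F hF => ?_⟩
  have := binomialRandom_real_cylinder p (disjoint_empty_right F) hF (by simp)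
  simp only [notMem_empty, false_imp_iff, implies_true, and_true, card_empty, pow_zero,
    mul_one] at this
  exact this.le

lemma edgeBound_compl (p : I) : EdgeBound (V := V) p compl (1 - p) := by
  refine ⟨sub_nonneg.2 p.2.2, fun F hF => ?_⟩
  have := binomialRandom_real_cylinder p (disjoint_empty_left F) (by simp) hF
  simp only [notMem_empty, false_imp_iff, implies_true, true_and, card_empty, pow_zero,
    one_mul] at this
  rw [← this]
  refine measureReal_mono fun G hG e he => ?_
  have h := hG e he
  induction e with | _ a b =>
  exact ((compl_adj _ _ _).1 h).2

variable {p : I} {H : SimpleGraph V → SimpleGraph V} {x : ℝ}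

/-- Stated through `EdgeBound`, this covers cliques of `G` and, with `H = compl`, independent sets
of `G`. -/
lemma measureReal_exists_isClique_le (hx : EdgeBound p H x) (Z : Finset V) (u : ℕ) :
    (binomialRandom V p).real {G | ∃ Q ⊆ Z, (H G).IsClique (Q : Set V) ∧ u ≤ #Q} ≤
      (#Z).choose u * x ^ u.choose 2 := by
  rw [← card_powersetCard]
  refine le_trans (measureReal_mono ?_) (measureReal_exists_le _ (powersetCard u Z)
    (fun Q => {G | ∀ e ∈ Q.offDiag.image fun x : V × V => s(x.1, x.2), e ∈ (H G).edgeSet})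
    fun Q hQ => ?_)
  · rintro G ⟨Q, hQZ, hc, hu⟩
    obtain ⟨Q', hQ', hc'⟩ := exists_subset_card_eq hu
    refine ⟨Q', mem_powersetCard.2 ⟨hQ'.trans hQZ, hc'⟩, fun e he => ?_⟩
    obtain ⟨⟨a, b⟩, hab, rfl⟩ := mem_image.1 he
    rw [mem_offDiag] at hab
    exact hc (hQ' hab.1) (hQ' hab.2.1) hab.2.2
  · have := hx.2 (Q.offDiag.image fun x : V × V => s(x.1, x.2)) (by
      intro e he
      obtain ⟨⟨a, b⟩, hab, rfl⟩ := mem_image.1 he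
      simpa using (mem_offDiag.1 hab).2.2)
    have hcard : #(Q.offDiag.image fun x : V × V => s(x.1, x.2)) = u.choose 2 := by
      have := Sym2.card_image_offDiag Q
      rwa [(mem_powersetCard.1 hQ).2] at this
    rwa [hcard] at this

open Classical in
lemma measureReal_exists_degree_le (hx : EdgeBound p H x) (S : Finset V) (u : ℕ) :
    (binomialRandom V p).real {G | ∃ v, u ≤ #{y ∈ S | (H G).Adj v y}} ≤
      Fintype.card V * (#S).choose u * x ^ u := by
  have hset : {G : SimpleGraph V | ∃ v, u ≤ #{y ∈ S | (H G).Adj v y}} ⊆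
      {G | ∃ a ∈ (univ : Finset V) ×ˢ powersetCard u S,
        G ∈ {G | (∀ y ∈ a.2, (H G).Adj a.1 y)}} := by
    rintro G ⟨v, hv⟩
    obtain ⟨Y, hY, hc⟩ := exists_subset_card_eq hv
    exact ⟨(v, Y), mem_product.2 ⟨mem_univ _, mem_powersetCard.2 ⟨hY.trans (filter_subset _ _), hc⟩⟩,
      fun y hy => (mem_filter.1 (hY hy)).2⟩
  refine (measureReal_mono hset).trans ?_
  have hle := measureReal_exists_le (binomialRandom V p) (univ ×ˢ powersetCard u S)
    (fun a : V × Finset V => {G | ∀ y ∈ a.2, (H G).Adj a.1 y}) (x := x ^ u) ?_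
  · rwa [card_product, card_powersetCard, card_univ, Nat.cast_mul] at hle
  rintro ⟨v, Y⟩ hvY
  rw [mem_product, mem_powersetCard] at hvY
  by_cases hv : v ∈ Y
  · have : {G : SimpleGraph V | ∀ y ∈ Y, (H G).Adj v y} = ∅ :=
      Set.eq_empty_of_forall_notMem fun G hG => (H G).irrefl (hG v hv)
    simp only [this, measureReal_empty]
    exact pow_nonneg hx.1 _
  · have := hx.2 (Y.image fun y => s(v, y)) (by
      intro e he
      obtain ⟨y, hy, rfl⟩ := mem_image.1 he
      simp only [Sym2.mk_isDiag_iff]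
      rintro rfl
      exact hv hy)
    rw [card_image_of_injective _ (fun a b hab => by simpa only [Sym2.congr_right] using hab),
      hvY.2.2] at this
    simpa using this

/-- Disjoint vertex sets span disjoint edge sets, so a choice of `k` edges in each of `u` sets
prescribes `k * u` distinct edges. The factor `2 ^ (v + 1).choose 2` crudely bounds the choices in
one set, counting every subset of its unordered pairs, loops included. -/
lemma measureReal_exists_edgeRich_le (hx : EdgeBound p H x) (S : Finset V) (u v k : ℕ) :
    (binomialRandom V p).real {G | ∃ 𝒜 : Finset (Finset V),
      (𝒜 : Set (Finset V)).PairwiseDisjoint id ∧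
      (∀ A ∈ 𝒜, A ⊆ S ∧ #A = v ∧ (H G).EdgeRich k A) ∧ u ≤ #𝒜} ≤
      ((#S).choose v).choose u * (2 ^ (v + 1).choose 2 * x ^ k) ^ u := by
  classical
  set J := (powersetCard u (powersetCard v S)).filter
    (fun 𝒜 : Finset (Finset V) => (𝒜 : Set (Finset V)).PairwiseDisjoint id) with hJ
  have hJc : (#J : ℝ) ≤ ((#S).choose v).choose u := by
    rw [← card_powersetCard v S, ← card_powersetCard u (powersetCard v S)]
    exact_mod_cast card_filter_le _ _
  have h0 : 0 ≤ 2 ^ (v + 1).choose 2 * x ^ k := mul_nonneg (by positivity) (pow_nonneg hx.1 _)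
  refine le_trans (measureReal_mono ?_) (le_trans (measureReal_exists_le _ J
    (fun 𝒜 => {G | ∀ A ∈ 𝒜, (H G).EdgeRich k A}) (x := (2 ^ (v + 1).choose 2 * x ^ k) ^ u) ?_)
    (mul_le_mul_of_nonneg_right hJc (pow_nonneg h0 _)))
  · rintro G ⟨𝒜, hd, h𝒜, hu⟩
    obtain ⟨ℬ, hℬ, hc⟩ := exists_subset_card_eq hu
    refine ⟨ℬ, mem_filter.2 ⟨mem_powersetCard.2 ⟨fun A hA => ?_, hc⟩,
      hd.subset (coe_subset.2 hℬ)⟩, fun A hA => (h𝒜 A (hℬ hA)).2.2⟩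
    exact mem_powersetCard.2 ⟨(h𝒜 A (hℬ hA)).1, (h𝒜 A (hℬ hA)).2.1⟩
  · intro 𝒜 h𝒜
    rw [hJ, mem_filter, mem_powersetCard] at h𝒜
    obtain ⟨⟨h𝒜S, h𝒜c⟩, hd⟩ := h𝒜
    have hset : {G | ∀ A ∈ 𝒜, (H G).EdgeRich k A} ⊆
        {G | ∃ f ∈ 𝒜.pi fun A => powersetCard k (A.sym2.filter fun e => ¬ e.IsDiag),
          G ∈ {G | ∀ e ∈ 𝒜.attach.biUnion fun A => f A.1 A.2, e ∈ (H G).edgeSet}} := by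
      intro G hG
      choose! F hF1 hF2 using hG
      refine ⟨fun A _ => F A, mem_pi.2 fun A hA => mem_powersetCard.2 ⟨fun e he => ?_, hF1 A hA⟩,
        fun e he => ?_⟩
      · refine mem_filter.2 ⟨?_, (H G).not_isDiag_of_mem_edgeSet (hF2 A hA e he).1⟩
        rw [mem_sym2_iff]
        exact (hF2 A hA e he).2
      · obtain ⟨A, -, heA⟩ := mem_biUnion.1 he
        exact (hF2 A.1 A.2 e heA).1
    refine (measureReal_mono hset).trans (le_trans (measureReal_exists_le _ _ _
      (x := (x ^ k) ^ u) ?_) ?_)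
    · intro f hf
      have hf' := mem_pi.1 hf
      have := hx.2 (𝒜.attach.biUnion fun A => f A.1 A.2) (by
        intro e he
        obtain ⟨A, -, heA⟩ := mem_biUnion.1 he
        exact (mem_filter.1 ((mem_powersetCard.1 (hf' A.1 A.2)).1 heA)).2)
      rw [card_biUnion, sum_congr rfl (g := fun _ => k)
        (fun A _ => (mem_powersetCard.1 (hf' A.1 A.2)).2), sum_const, card_attach, h𝒜c, smul_eq_mul,
        mul_comm, pow_mul] at this
      · exact this
      · intro A _ B _ hAB
        refine Finset.disjoint_left.2 fun e heA heB => ?_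
        have hA := (mem_filter.1 ((mem_powersetCard.1 (hf' A.1 A.2)).1 heA)).1
        have hB := (mem_filter.1 ((mem_powersetCard.1 (hf' B.1 B.2)).1 heB)).1
        rw [mem_sym2_iff] at hA hB
        induction e with | _ a b =>
        exact Finset.disjoint_left.1 (hd A.2 B.2 fun h => hAB (Subtype.ext h))
          (hA a (by simp)) (hB a (by simp))
    · rw [mul_pow]
      refine mul_le_mul_of_nonneg_right ?_ (pow_nonneg (pow_nonneg hx.1 _) _)
      rw [card_pi, Nat.cast_prod, ← h𝒜c]
      rw [← prod_const]
      refine prod_le_prod (fun _ _ => by positivity) fun A hA => ?_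
      have hA' := (mem_powersetCard.1 (h𝒜S hA)).2
      have h1 : #(powersetCard k (A.sym2.filter fun e => ¬ e.IsDiag)) ≤ 2 ^ (v + 1).choose 2 := by
        refine (card_le_card (fun B hB => mem_powerset.2 (mem_powersetCard.1 hB).1)).trans ?_
        rw [card_powerset, ← hA', ← card_sym2]
        exact Nat.pow_le_pow_right (by omega) (card_filter_le _ _)
      exact_mod_cast h1

open Classical in
-- Failure means that `q` and `q'` agree on at least `#R - w` vertices of `R`. For fixed `r` they
-- agree with probability `p ^ 2 + (1 - p) ^ 2`, independently over `r`, because `q` and `q'` lie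
-- outside `R`.
lemma measureReal_exists_not_distinguish_le (p : I) (R : Finset V) (w : ℕ) :
    (binomialRandom V p).real {G | ∃ q ∈ univ \ R, ∃ q' ∈ univ \ R, q ≠ q' ∧
      #{r ∈ R | ¬ (G.Adj r q ↔ G.Adj r q')} < w} ≤
      Fintype.card V ^ 2 * (#R).choose (#R - w) *
        ((p : ℝ) ^ 2 + (1 - p : ℝ) ^ 2) ^ (#R - w) := by
  have h0 : (0 : ℝ) ≤ (p : ℝ) ^ 2 + (1 - p : ℝ) ^ 2 := by positivity
  have hset : {G : SimpleGraph V | ∃ q ∈ univ \ R, ∃ q' ∈ univ \ R, q ≠ q' ∧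
      #{r ∈ R | ¬ (G.Adj r q ↔ G.Adj r q')} < w} ⊆
      {G | ∃ a ∈ (univ ×ˢ univ) ×ˢ powersetCard (#R - w) R,
        G ∈ {G | a.1.1 ∉ R ∧ a.1.2 ∉ R ∧ a.1.1 ≠ a.1.2 ∧
          ∀ r ∈ a.2, (G.Adj r a.1.1 ↔ G.Adj r a.1.2)}} := by
    rintro G ⟨q, hq, q', hq', hne, hlt⟩
    have := card_filter_add_card_filter_not (s := R) fun r => ¬ (G.Adj r q ↔ G.Adj r q')
    obtain ⟨Y, hY, hc⟩ := exists_subset_card_eq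
      (show #R - w ≤ #{r ∈ R | ¬ ¬ (G.Adj r q ↔ G.Adj r q')} by omega)
    refine ⟨((q, q'), Y), ?_, (mem_sdiff.1 hq).2, (mem_sdiff.1 hq').2, hne, fun r hr => ?_⟩
    · simp [hc, hY.trans (filter_subset _ _)]
    · exact not_not.1 (mem_filter.1 (hY hr)).2
  refine (measureReal_mono hset).trans ?_
  have hle := measureReal_exists_le (binomialRandom V p)
    ((univ ×ˢ univ) ×ˢ powersetCard (#R - w) R)
    (fun a : (V × V) × Finset V => {G | a.1.1 ∉ R ∧ a.1.2 ∉ R ∧ a.1.1 ≠ a.1.2 ∧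
          ∀ r ∈ a.2, (G.Adj r a.1.1 ↔ G.Adj r a.1.2)})
    (x := ((p : ℝ) ^ 2 + (1 - p : ℝ) ^ 2) ^ (#R - w)) ?_
  · rw [card_product, card_product, card_powersetCard, card_univ] at hle
    push_cast at hle
    rwa [← sq] at hle
  rintro ⟨⟨q, q'⟩, Y⟩ ha
  simp only [mem_product, mem_univ, mem_powersetCard, true_and] at ha
  by_cases hq : q ∉ R ∧ q' ∉ R ∧ q ≠ q'
  swap
  · have : {G : SimpleGraph V | q ∉ R ∧ q' ∉ R ∧ q ≠ q' ∧
        ∀ r ∈ Y, (G.Adj r q ↔ G.Adj r q')} = ∅ :=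
      Set.eq_empty_of_forall_notMem fun G hG => hq ⟨hG.1, hG.2.1, hG.2.2.1⟩
    simp only [this, measureReal_empty]
    exact pow_nonneg h0 _
  obtain ⟨hqR, hqR', hne⟩ := hq
  set J : Finset V → Finset (Sym2 V) :=
    fun B => B.image (fun r => s(r, q)) ∪ B.image (fun r => s(r, q')) with hJ
  have hJd : ∀ B ⊆ Y, ∀ e ∈ J B, ¬ e.IsDiag := by
    intro B hB e he
    rcases mem_union.1 he with he | he
    · obtain ⟨r, hr, rfl⟩ := mem_image.1 he
      simp only [Sym2.mk_isDiag_iff]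
      rintro rfl; exact hqR (ha.1 (hB hr))
    · obtain ⟨r, hr, rfl⟩ := mem_image.1 he
      simp only [Sym2.mk_isDiag_iff]
      rintro rfl; exact hqR' (ha.1 (hB hr))
  have hJc : ∀ B ⊆ Y, #(J B) = 2 * #B := by
    intro B hB
    rw [hJ, card_union_of_disjoint, card_image_of_injective, card_image_of_injective]
    · ring
    · exact fun a b hab => by simpa only [Sym2.congr_left] using hab
    · exact fun a b hab => by simpa only [Sym2.congr_left] using hab
    · rw [Finset.disjoint_left]
      intro e he he'
      obtain ⟨r, hr, rfl⟩ := mem_image.1 he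
      obtain ⟨r', hr', h⟩ := mem_image.1 he'
      rw [Sym2.eq_iff] at h
      rcases h with ⟨-, h⟩ | ⟨h, -⟩
      · exact hne h.symm
      · exact hqR (h ▸ ha.1 (hB hr'))
  have hJdis : ∀ B ⊆ Y, Disjoint (J B) (J (Y \ B)) := by
    intro B hB
    have hmem : ∀ C ⊆ Y, ∀ e ∈ J C, ∃ r ∈ C, r ∈ e ∧ ∀ r' ∈ e, r' ∈ Y → r' = r := by
      intro C hC e he
      rcases mem_union.1 he with he | he
      · obtain ⟨r, hr, rfl⟩ := mem_image.1 he
        refine ⟨r, hr, by simp, fun r' hr' hY => ?_⟩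
        rcases Sym2.mem_iff.1 hr' with rfl | rfl
        · rfl
        · exact absurd (ha.1 hY) hqR
      · obtain ⟨r, hr, rfl⟩ := mem_image.1 he
        refine ⟨r, hr, by simp, fun r' hr' hY => ?_⟩
        rcases Sym2.mem_iff.1 hr' with rfl | rfl
        · rfl
        · exact absurd (ha.1 hY) hqR'
    rw [Finset.disjoint_left]
    intro e he he'
    obtain ⟨r, hr, hre, h⟩ := hmem B hB e he
    obtain ⟨r', hr', hre', -⟩ := hmem _ sdiff_subset e he'
    have := h r' hre' (mem_sdiff.1 hr').1
    exact (mem_sdiff.1 hr').2 (this ▸ hr)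
  have hsub : {G : SimpleGraph V | q ∉ R ∧ q' ∉ R ∧ q ≠ q' ∧
      ∀ r ∈ Y, (G.Adj r q ↔ G.Adj r q')} ⊆ ⋃ B ∈ Y.powerset,
      {G | (∀ e ∈ J B, e ∈ G.edgeSet) ∧ ∀ e ∈ J (Y \ B), e ∉ G.edgeSet} := by
    rintro G ⟨-, -, -, hG⟩
    simp only [Set.mem_iUnion]
    refine ⟨Y.filter fun r => G.Adj r q, mem_powerset.2 (filter_subset _ _), ?_, ?_⟩
    · intro e he
      rcases mem_union.1 he with he | he
      · obtain ⟨r, hr, rfl⟩ := mem_image.1 he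
        exact (mem_filter.1 hr).2
      · obtain ⟨r, hr, rfl⟩ := mem_image.1 he
        exact (hG r (mem_filter.1 hr).1).1 (mem_filter.1 hr).2
    · intro e he
      have haux : ∀ r ∈ Y \ Y.filter fun r => G.Adj r q, r ∈ Y ∧ ¬ G.Adj r q := by
        intro r hr
        rw [mem_sdiff, mem_filter] at hr
        tauto
      rcases mem_union.1 he with he | he
      · obtain ⟨r, hr, rfl⟩ := mem_image.1 he
        exact (haux r hr).2
      · obtain ⟨r, hr, rfl⟩ := mem_image.1 he
        exact fun h => (haux r hr).2 ((hG r (haux r hr).1).2 h)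
  refine (measureReal_mono hsub (measure_ne_top _ _)).trans ((measureReal_biUnion_finset_le _ _).trans ?_)
  -- Summing over the common neighbourhood `B` in `Y` expands the power of `p ^ 2 + (1 - p) ^ 2`.
  rw [← ha.2, ← sum_pow_mul_eq_add_pow]
  refine sum_le_sum fun B hB => ?_
  have hB' := mem_powerset.1 hB
  rw [binomialRandom_real_cylinder p (hJdis B hB') (hJd B hB') (hJd _ sdiff_subset), hJc B hB',
    hJc _ sdiff_subset, pow_mul, pow_mul, card_sdiff_of_subset hB']

lemma IsNClique.edgeRich_six {G : SimpleGraph V} {A : Finset V} (h : G.IsNClique 4 A) :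
    #A = 4 ∧ G.EdgeRich 6 A := by
  refine ⟨h.card_eq, A.offDiag.image fun x : V × V => s(x.1, x.2), ?_, fun e he => ?_⟩
  · have := Sym2.card_image_offDiag A
    rwa [h.card_eq] at this
  · obtain ⟨⟨a, b⟩, hab, rfl⟩ := mem_image.1 he
    rw [mem_offDiag] at hab
    refine ⟨h.isClique hab.1 hab.2.1 hab.2.2, fun y hy => ?_⟩
    rcases Sym2.mem_iff.1 hy with rfl | rfl
    exacts [hab.1, hab.2.1]

end SimpleGraph

/-! ### Random path patterns in independent blocks -/

namespace SimpleGraph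

open Finset MeasureTheory ProbabilityTheory unitInterval

set_option linter.unusedSectionVars false

variable {V : Type*} [Fintype V] [DecidableEq V] {m : ℕ} {s : Fin m × Fin 4 → V} {R : Finset V}

/-- The complement of `G` induces exactly `m` disjoint paths on the range of `s`. -/
def PathPattern (G : SimpleGraph V) (s : Fin m × Fin 4 → V) : Prop :=
  ∀ x y, x ≠ y → (G.Adj (s x) (s y) ↔ ¬ PathPair x y)

/-- The vertex `q` sees exactly one end of the first and of the last edge of the `i`-th path. -/
def SplitsPath (G : SimpleGraph V) (s : Fin m × Fin 4 → V) (q : V) (i : Fin m) : Prop :=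
  ¬ (G.Adj q (s (i, 0)) ↔ G.Adj q (s (i, 1))) ∧ ¬ (G.Adj q (s (i, 2)) ↔ G.Adj q (s (i, 3)))

lemma measureReal_pathPattern_ge (p : I) (hs : Function.Injective s) :
    (p : ℝ) ^ (4 * m).choose 2 * (1 - p : ℝ) ^ (3 * m) ≤
      (binomialRandom V p).real {G | G.PathPattern s} := by
  set F' : Finset (Sym2 V) := univ.image fun x : Fin m × Fin 3 =>
    s(s (x.1, x.2.castSucc), s (x.1, x.2.succ)) with hF'
  set F : Finset (Sym2 V) :=
    ((univ.image s).offDiag.image fun x : V × V => s(x.1, x.2)) \ F' with hF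
  have hmem : ∀ x y, s(s x, s y) ∈ F' ↔ PathPair x y := by
    rintro ⟨i, a⟩ ⟨j, b⟩
    simp only [hF', mem_image, mem_univ, true_and, Prod.exists, Sym2.eq_iff, hs.eq_iff,
      Prod.mk.injEq, PathPair]
    constructor
    · rintro ⟨c, d, h⟩
      rcases h with ⟨⟨rfl, rfl⟩, rfl, rfl⟩ | ⟨⟨rfl, rfl⟩, rfl, rfl⟩ <;> simp
    · rintro ⟨rfl, h | h⟩
      · refine ⟨i, ⟨a.val, by omega⟩, Or.inl ⟨⟨rfl, Fin.ext rfl⟩, rfl, Fin.ext ?_⟩⟩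
        simpa using h
      · refine ⟨i, ⟨b.val, by omega⟩, Or.inr ⟨⟨rfl, Fin.ext rfl⟩, rfl, Fin.ext ?_⟩⟩
        simpa using h
  have hd' : ∀ e ∈ F', ¬ e.IsDiag := by
    intro e he
    obtain ⟨x, -, rfl⟩ := mem_image.1 he
    rw [Sym2.mk_isDiag_iff, hs.eq_iff]
    simp [Fin.ext_iff]
  have hd : ∀ e ∈ F, ¬ e.IsDiag := by
    intro e he
    obtain ⟨x, hx, rfl⟩ := mem_image.1 (mem_sdiff.1 he).1
    exact (mem_offDiag.1 hx).2.2
  have hc' : #F' ≤ 3 * m := by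
    refine card_image_le.trans ?_
    simp [mul_comm]
  have hc : #F ≤ (4 * m).choose 2 := by
    refine (card_le_card sdiff_subset).trans ?_
    have := Sym2.card_image_offDiag (univ.image s)
    rw [card_image_of_injective _ hs] at this
    simp only [card_univ, Fintype.card_prod, Fintype.card_fin] at this
    rw [mul_comm 4 m]
    exact this.le
  refine le_trans ?_ (le_trans (binomialRandom_real_cylinder p
    (disjoint_sdiff.symm : Disjoint F F') hd hd').ge (measureReal_mono ?_))
  · have h1 : 0 ≤ 1 - (p : ℝ) := sub_nonneg.2 p.2.2
    exact mul_le_mul (pow_le_pow_of_le_one p.2.1 p.2.2 hc)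
      (pow_le_pow_of_le_one h1 (by linarith [p.2.1]) hc') (pow_nonneg h1 _) (pow_nonneg p.2.1 _)
  · rintro G ⟨h1, h2⟩ x y hxy
    constructor
    · exact fun h hp => h2 _ ((hmem x y).2 hp) h
    · intro hp
      refine h1 _ (mem_sdiff.2 ⟨mem_image.2 ⟨(s x, s y), ?_, rfl⟩, fun h => hp ((hmem x y).1 h)⟩)
      simp [hs.ne hxy]

/-- The probability is `2 * p * (1 - p)`. -/
lemma measureReal_not_iff_le (p : I) {e e' : Sym2 V} (he : ¬ e.IsDiag) (he' : ¬ e'.IsDiag)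
    (hne : e ≠ e') :
    (binomialRandom V p).real {G | ¬ (e ∈ G.edgeSet ↔ e' ∈ G.edgeSet)} ≤ 1 / 2 := by
  have h1 := binomialRandom_real_cylinder p (F := {e}) (F' := {e'}) (by simpa using hne)
    (by simpa using he) (by simpa using he')
  have h2 := binomialRandom_real_cylinder p (F := {e'}) (F' := {e}) (by simpa using hne.symm)
    (by simpa using he') (by simpa using he)
  simp only [mem_singleton, forall_eq, card_singleton, pow_one] at h1 h2
  refine (measureReal_mono (s₂ := {G : SimpleGraph V | e ∈ G.edgeSet ∧ e' ∉ G.edgeSet} ∪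
    {G | e' ∈ G.edgeSet ∧ e ∉ G.edgeSet}) fun G hG => ?_).trans
    ((measureReal_union_le _ _).trans ?_)
  · simp only [Set.mem_ofPred_eq, Set.mem_union] at hG ⊢
    tauto
  · rw [h1, h2]
    nlinarith [sq_nonneg (2 * (p : ℝ) - 1)]

open Classical in
-- Splitting a path means two events on disjoint pairs of edge slots, each of probability at most `1
-- / 2`; this gives `1 / 4` per path, independently over the paths.
lemma measureReal_exists_splitsPath_le (p : I) (hs : Function.Injective s)
    (hsR : Disjoint (univ.image s) R) (b : ℕ) :
    (binomialRandom V p).real {G | ∃ q ∈ R, b ≤ #{i | G.SplitsPath s q i}} ≤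
      #R * (m.choose b * (1 / 4) ^ b) := by
  suffices hA : ∀ q ∈ R, (binomialRandom V p).real {G | b ≤ #{i | G.SplitsPath s q i}} ≤
      m.choose b * (1 / 4) ^ b by
    have := measureReal_exists_le _ R _ hA
    simpa only [Set.mem_ofPred_eq] using this
  intro q hq
  have hq' : ∀ x, s x ≠ q := fun x hx =>
    Finset.disjoint_left.1 hsR (mem_image_of_mem s (mem_univ x)) (hx ▸ hq)
  have hle := measureReal_exists_le (binomialRandom V p) (powersetCard b (univ : Finset (Fin m)))
    (fun B => {G | ∀ x ∈ B ×ˢ (univ : Finset (Fin 2)), G ∈ {G : SimpleGraph V |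
      ¬ (s(q, s (x.1, ![0, 2] x.2)) ∈ G.edgeSet ↔ s(q, s (x.1, ![1, 3] x.2)) ∈ G.edgeSet)}})
    (x := (1 / 4) ^ b) ?_
  · rw [card_powersetCard, card_univ, Fintype.card_fin] at hle
    refine (measureReal_mono fun G hG => ?_).trans hle
    obtain ⟨B, hB, hc⟩ := exists_subset_card_eq (show b ≤ #{i | G.SplitsPath s q i} from hG)
    refine ⟨B, mem_powersetCard.2 ⟨subset_univ _, hc⟩, ?_⟩
    rintro ⟨i, j⟩ hij
    have hi := (mem_filter.1 (hB (mem_product.1 hij).1)).2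
    fin_cases j
    exacts [hi.1, hi.2]
  · intro B hB
    have h := binomialRandom_real_iInter_le p (B ×ˢ (univ : Finset (Fin 2)))
      (D := fun x => {s(q, s (x.1, ![0, 2] x.2)), s(q, s (x.1, ![1, 3] x.2))})
      (A := fun x => {G : SimpleGraph V |
        ¬ (s(q, s (x.1, ![0, 2] x.2)) ∈ G.edgeSet ↔ s(q, s (x.1, ![1, 3] x.2)) ∈ G.edgeSet)})
      (x := 1 / 2) ?_ ?_ ?_
    · rw [card_product, (mem_powersetCard.1 hB).2, card_univ, Fintype.card_fin, mul_comm b 2,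
        pow_mul] at h
      norm_num at h ⊢
      exact h
    · rintro ⟨i, a⟩ - ⟨j, c⟩ - hne
      simp only [Function.onFun, disjoint_insert_left, disjoint_singleton_left, mem_insert,
        mem_singleton, Sym2.congr_right, hs.eq_iff, Prod.mk.injEq]
      by_cases hij : i = j
      · subst hij
        have hac : a ≠ c := fun h => hne (by rw [h])
        revert hac
        clear hne
        revert a c
        simp only [true_and]
        decide
      · simp [hij]
    · intro x G G' h
      simp only [Set.mem_ofPred_eq]
      rw [h _ (by simp), h _ (by simp)]
    · rintro ⟨i, a⟩ -
      refine measureReal_not_iff_le p ?_ ?_ ?_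
      · rw [Sym2.mk_isDiag_iff]; exact (hq' _).symm
      · rw [Sym2.mk_isDiag_iff]; exact (hq' _).symm
      · rw [Ne, Sym2.congr_right, hs.eq_iff, Prod.mk.injEq, not_and]
        intro _
        fin_cases a <;> simp

open Classical in
/-- The block consisting of the range of `s` and of `R` allows the reduction of
`not_evenNonDecomposable_of_pathPattern`. -/
def GoodBlock (G : SimpleGraph V) (k : ℕ) (s : Fin m × Fin 4 → V) (R : Finset V) : Prop :=
  G.PathPattern s ∧ (∀ q ∈ R, #{i | G.SplitsPath s q i} ≤ 2 * k) ∧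
    ∀ Q ⊆ R, G.IsClique (Q : Set V) → #Q ≤ k

/-- The pattern depends on pairs inside the range of `s`, and the two failures on pairs meeting `R`.
By independence each failure costs at most a quarter of the probability of the pattern, which leaves
half of it. -/
lemma measureReal_goodBlock_ge (p : I) (hs : Function.Injective s)
    (hsR : Disjoint (univ.image s) R) {k : ℕ}
    (h1 : (#R * (m.choose (2 * k + 1) * (1 / 4) ^ (2 * k + 1)) : ℝ) ≤ 1 / 4)
    (h2 : (#R).choose (k + 1) * (p : ℝ) ^ (k + 1).choose 2 ≤ 1 / 4) :
    (p : ℝ) ^ (4 * m).choose 2 * (1 - p : ℝ) ^ (3 * m) / 2 ≤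
      (binomialRandom V p).real {G | G.GoodBlock k s R} := by
  classical
  set μ := binomialRandom V p with hμ
  set P := {G : SimpleGraph V | G.PathPattern s} with hP
  set B₁ := {G : SimpleGraph V | ∃ q ∈ R, 2 * k + 1 ≤ #{i | G.SplitsPath s q i}} with hB₁
  set B₂ := {G : SimpleGraph V | ∃ Q ⊆ R, G.IsClique (Q : Set V) ∧ k + 1 ≤ #Q} with hB₂
  have hadj : ∀ (D : Finset (Sym2 V)) (G G' : SimpleGraph V),
      (∀ e ∈ D, e ∈ G.edgeSet ↔ e ∈ G'.edgeSet) → ∀ x y, s(x, y) ∈ D → (G.Adj x y ↔ G'.Adj x y) :=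
    fun D G G' h x y hxy => h _ hxy
  have hPdep : ∀ G G' : SimpleGraph V, (∀ e ∈ (univ.image s).sym2, e ∈ G.edgeSet ↔ e ∈ G'.edgeSet) →
      (G ∈ P ↔ G' ∈ P) := by
    intro G G' h
    simp only [hP, Set.mem_ofPred_eq, PathPattern]
    refine forall₃_congr fun x y _ => ?_
    rw [hadj _ _ _ h _ _ (by simp)]
  have hB₁dep : ∀ G G' : SimpleGraph V, (∀ e ∈ (R ×ˢ univ.image s).image fun x : V × V => s(x.1, x.2),
      e ∈ G.edgeSet ↔ e ∈ G'.edgeSet) → (G ∈ B₁ ↔ G' ∈ B₁) := by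
    intro G G' h
    simp only [hB₁, Set.mem_ofPred_eq]
    refine exists_congr fun q => and_congr_right fun hq => ?_
    have : ∀ x, G.Adj q (s x) ↔ G'.Adj q (s x) := fun x =>
      hadj _ _ _ h _ _ (mem_image.2 ⟨(q, s x), by simp [hq], rfl⟩)
    rw [filter_congr (q := fun i => G'.SplitsPath s q i) fun i _ => by simp only [SplitsPath, this]]
  have hB₂dep : ∀ G G' : SimpleGraph V, (∀ e ∈ R.sym2, e ∈ G.edgeSet ↔ e ∈ G'.edgeSet) →
      (G ∈ B₂ ↔ G' ∈ B₂) := by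
    intro G G' h
    simp only [hB₂, Set.mem_ofPred_eq, isClique_iff, Set.Pairwise]
    refine exists_congr fun Q => and_congr_right fun hQ => and_congr_left fun _ => ?_
    refine forall₂_congr fun x hx => forall₂_congr fun y hy => imp_congr_right fun _ => ?_
    rw [hadj _ _ _ h _ _ (by simp [hQ hx, hQ hy])]
  have hD₁ : Disjoint (univ.image s).sym2
      ((R ×ˢ univ.image s).image fun x : V × V => s(x.1, x.2)) := by
    refine Finset.disjoint_left.2 fun e he he' => ?_
    obtain ⟨x, hx, rfl⟩ := mem_image.1 he'
    exact Finset.disjoint_left.1 hsR (mem_sym2_iff.1 he x.1 (by simp)) (mem_product.1 hx).1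
  have hD₂ : Disjoint (univ.image s).sym2 R.sym2 := by
    refine Finset.disjoint_left.2 fun e he he' => ?_
    induction e with | _ x y =>
    exact Finset.disjoint_left.1 hsR (mem_sym2_iff.1 he x (by simp)) (mem_sym2_iff.1 he' x (by simp))
  have e1 := binomialRandom_real_inter p hD₁ hPdep hB₁dep
  have e2 := binomialRandom_real_inter p hD₂ hPdep hB₂dep
  have b1 : μ.real B₁ ≤ 1 / 4 := (measureReal_exists_splitsPath_le p hs hsR _).trans h1
  have b2 : μ.real B₂ ≤ 1 / 4 := (measureReal_exists_isClique_le (edgeBound_id p) R (k + 1)).trans h2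
  have hsub : P ⊆ {G | G.GoodBlock k s R} ∪ (P ∩ B₁ ∪ P ∩ B₂) := by
    intro G hG
    by_cases h₁ : G ∈ B₁
    · exact Or.inr (Or.inl ⟨hG, h₁⟩)
    by_cases h₂ : G ∈ B₂
    · exact Or.inr (Or.inr ⟨hG, h₂⟩)
    refine Or.inl ⟨hG, fun q hq => ?_, fun Q hQ hc => ?_⟩
    · by_contra hlt
      exact h₁ ⟨q, hq, by omega⟩
    · by_contra hlt
      exact h₂ ⟨Q, hQ, hc, by omega⟩
  have h3 := (measureReal_mono (μ := μ) hsub).trans ((measureReal_union_le _ _).trans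
    (add_le_add_right (measureReal_union_le _ _) _))
  have h4 := measureReal_pathPattern_ge p hs
  have h5 : 0 ≤ μ.real P := measureReal_nonneg
  rw [e1, e2] at h3
  nlinarith

open Classical in
lemma GoodBlock.not_evenNonDecomposable {G : SimpleGraph V} {k w : ℕ}
    {s : Fin (3 * k) × Fin 4 → V} (h : G.GoodBlock k s R) (hs : Function.Injective s)
    (hsR : Disjoint (univ.image s) R)
    (h5 : ∀ Q : Finset V, G.IsClique (Q : Set V) → #Q ≤ w)
    (h6 : ∀ q ∈ univ \ R, ∀ q' ∈ univ \ R, q ≠ q' →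
      w ≤ #{r ∈ R | ¬ (G.Adj r q ↔ G.Adj r q')}) : ¬ G.EvenNonDecomposable := by
  have hsub : ∀ q ∈ univ \ (univ.image s ∪ R), q ∈ univ \ R := fun q hq =>
    sdiff_subset_sdiff subset_rfl subset_union_right hq
  -- Of the `3 * k` paths at most `2 * k` are useless for a given vertex; the other `k` absorb a
  -- clique of size `k`.
  refine not_evenNonDecomposable_of_pathPattern hs h.1 hsR (b := 2 * k) (k := k) (w := w) ?_ h.2.2
    (by omega) (fun Q _ => h5 Q) fun q hq q' hq' => h6 q (hsub q hq) q' (hsub q' hq')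
  intro q hq
  convert h.2.1 q hq
  rfl

/-- The three terms bound: no block is good; the set `R` of some block fails to distinguish two
outside vertices; `G` has a clique of size `w + 1`. Blocks use disjoint vertex sets, so their
failures multiply. -/
lemma measureReal_evenNonDecomposable_le_of_blocks (p : I) {N k r w : ℕ}
    (hcard : N * (12 * k + r) ≤ Fintype.card V)
    (h1 : (r * ((3 * k).choose (2 * k + 1) * (1 / 4) ^ (2 * k + 1)) : ℝ) ≤ 1 / 4)
    (h2 : r.choose (k + 1) * (p : ℝ) ^ (k + 1).choose 2 ≤ 1 / 4) :
    (binomialRandom V p).real {G | G.EvenNonDecomposable} ≤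
      (1 - (p : ℝ) ^ (12 * k).choose 2 * (1 - p : ℝ) ^ (9 * k) / 2) ^ N +
      N * (Fintype.card V ^ 2 * r.choose (r - w) * ((p : ℝ) ^ 2 + (1 - p : ℝ) ^ 2) ^ (r - w)) +
      (Fintype.card V).choose (w + 1) * (p : ℝ) ^ (w + 1).choose 2 := by
  classical
  have hc : Fintype.card (Fin N × ((Fin (3 * k) × Fin 4) ⊕ Fin r)) ≤ Fintype.card V := by
    simp only [Fintype.card_prod, Fintype.card_sum, Fintype.card_fin]
    convert hcard using 2
    ring
  obtain ⟨f⟩ := Function.Embedding.nonempty_of_card_le hc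
  set s : Fin N → Fin (3 * k) × Fin 4 → V := fun i x => f (i, Sum.inl x) with hsdef
  set R : Fin N → Finset V := fun i => univ.image fun x => f (i, Sum.inr x) with hRdef
  have hs : ∀ i, Function.Injective (s i) := fun i x y h => by
    simpa [hsdef] using h
  have hsR : ∀ i, Disjoint (univ.image (s i)) (R i) := fun i => by
    refine Finset.disjoint_left.2 fun v hv hv' => ?_
    obtain ⟨x, -, rfl⟩ := mem_image.1 hv
    obtain ⟨y, -, h⟩ := mem_image.1 hv'
    simp [hsdef] at h
  have hR : ∀ i, #(R i) = r := fun i => by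
    rw [hRdef, card_image_of_injective _ fun x y h => by simpa using h]
    simp
  set μ := binomialRandom V p with hμ
  have hblock := fun i => measureReal_goodBlock_ge p (hs i) (hsR i) (k := k)
    (by rw [hR]; exact h1) (by rw [hR]; exact h2)
  rw [show 4 * (3 * k) = 12 * k by ring, show 3 * (3 * k) = 9 * k by ring] at hblock
  set D : Fin N → Finset (Sym2 V) := fun i => (univ.image (s i) ∪ R i).sym2 with hDdef
  have hD : Set.PairwiseDisjoint ((univ : Finset (Fin N)) : Set (Fin N)) D := by
    intro i _ j _ hij
    have hmem : ∀ i, ∀ v ∈ univ.image (s i) ∪ R i, ∃ x, v = f (i, x) := by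
      intro i v hv
      rcases mem_union.1 hv with hv | hv
      · obtain ⟨x, -, rfl⟩ := mem_image.1 hv; exact ⟨_, rfl⟩
      · obtain ⟨x, -, rfl⟩ := mem_image.1 hv; exact ⟨_, rfl⟩
    refine Finset.disjoint_left.2 fun e he he' => ?_
    induction e with | _ a b =>
    obtain ⟨x, hx⟩ := hmem i a (mem_sym2_iff.1 he a (by simp))
    obtain ⟨y, hy⟩ := hmem j a (mem_sym2_iff.1 he' a (by simp))
    have := f.injective (hx.symm.trans hy)
    exact hij (Prod.mk.inj this).1
  have hdep : ∀ i (G G' : SimpleGraph V), (∀ e ∈ D i, e ∈ G.edgeSet ↔ e ∈ G'.edgeSet) →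
      (G ∈ {G | G.GoodBlock k (s i) (R i)}ᶜ ↔ G' ∈ {G | G.GoodBlock k (s i) (R i)}ᶜ) := by
    intro i G G' h
    have hS : ∀ x, s i x ∈ univ.image (s i) ∪ R i := fun x =>
      mem_union_left _ (mem_image_of_mem _ (mem_univ _))
    have hadj : ∀ x ∈ univ.image (s i) ∪ R i, ∀ y ∈ univ.image (s i) ∪ R i,
        (G.Adj x y ↔ G'.Adj x y) := fun x hx y hy => h s(x, y) (by
          rw [hDdef, mk_mem_sym2_iff]; exact ⟨hx, hy⟩)
    simp only [Set.mem_compl_iff, Set.mem_ofPred_eq, not_iff_not, GoodBlock]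
    refine and_congr ?_ (and_congr ?_ ?_)
    · simp only [PathPattern]
      exact forall₃_congr fun x y _ => by rw [hadj _ (hS x) _ (hS y)]
    · refine forall₂_congr fun q hq => ?_
      have : ∀ x, G.Adj q (s i x) ↔ G'.Adj q (s i x) := fun x =>
        hadj _ (mem_union_right _ hq) _ (hS x)
      rw [filter_congr (q := fun j => G'.SplitsPath (s i) q j) fun j _ => by
        simp only [SplitsPath, this]]
    · refine forall₂_congr fun Q hQ => imp_congr_left ?_
      simp only [isClique_iff, Set.Pairwise]
      refine forall₂_congr fun x hx => forall₂_congr fun y hy => imp_congr_right fun _ => ?_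
      rw [hadj _ (mem_union_right _ (hQ hx)) _ (mem_union_right _ (hQ hy))]
  have hnone := binomialRandom_real_iInter_le p univ hD hdep
    (x := 1 - (p : ℝ) ^ (12 * k).choose 2 * (1 - p : ℝ) ^ (9 * k) / 2) fun i _ => by
      have hms : MeasurableSet {G : SimpleGraph V | G.GoodBlock k (s i) (R i)} := by
        rw [← Set.preimage_image_eq {G : SimpleGraph V | G.GoodBlock k (s i) (R i)}
          edgeSet_injective]
        exact (measurableEmbedding_edgeSet (V := V)).measurable (Set.toFinite _).measurableSet
      rw [probReal_compl_eq_one_sub hms]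
      linarith [hblock i]
  rw [card_univ, Fintype.card_fin] at hnone
  have hdist := measureReal_exists_le μ (univ : Finset (Fin N))
    (fun i => {G | ∃ q ∈ univ \ R i, ∃ q' ∈ univ \ R i, q ≠ q' ∧
      #{r ∈ R i | ¬ (G.Adj r q ↔ G.Adj r q')} < w}) fun i _ => by
        have := measureReal_exists_not_distinguish_le p (R i) w
        rwa [hR] at this
  rw [card_univ, Fintype.card_fin] at hdist
  have hcl := measureReal_exists_isClique_le (edgeBound_id p) (univ : Finset V) (w + 1)
  rw [card_univ] at hcl
  refine le_trans (measureReal_mono ?_) ((measureReal_union_le _ _).trans (add_le_add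
    ((measureReal_union_le _ _).trans (add_le_add hnone hdist)) hcl))
  intro G hG
  by_contra hn
  simp only [Set.mem_union, not_or] at hn
  obtain ⟨⟨hn1, hn2⟩, hn3⟩ := hn
  simp only [Set.mem_ofPred_eq, mem_univ, forall_const, not_forall,
    Set.mem_compl_iff, not_not] at hn1
  obtain ⟨i, hi⟩ := hn1
  refine GoodBlock.not_evenNonDecomposable hi (hs i) (hsR i) (w := w) (fun Q hQ => ?_)
    (fun q hq q' hq' hne => ?_) hG
  · by_contra hlt
    exact hn3 ⟨Q, subset_univ _, hQ, by omega⟩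
  · by_contra hlt
    exact hn2 ⟨i, mem_univ _, q, hq, q', hq', hne, not_le.1 hlt⟩

end SimpleGraph

/-! ### Numerical estimates and bounds in terms of parameters -/

namespace SimpleGraph

open Finset MeasureTheory ProbabilityTheory unitInterval

set_option linter.unusedSectionVars false

section Estimates

lemma exp_two_le_eight : Real.exp 2 ≤ 8 := by
  have h := Real.exp_one_lt_d9
  have h0 := Real.exp_pos 1
  rw [show (2 : ℝ) = 1 + 1 by norm_num, Real.exp_add]
  nlinarith

/-- The left side is at most `(N * x) ^ u / u!`. Since `exp 2 ≤ 8`, the hypothesis gives `N * x ≤ u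
* exp (-2)`, and `u ^ u / u! ≤ exp u`. -/
lemma choose_mul_pow_le_exp {N u : ℕ} {x : ℝ} (hx : 0 ≤ x) (h : 8 * (N * x) ≤ u) :
    N.choose u * x ^ u ≤ Real.exp (-u) := by
  rcases Nat.eq_zero_or_pos u with rfl | hu
  · simp
  have hu' : (0 : ℝ) < u := by exact_mod_cast hu
  have h1 : (N.choose u : ℝ) ≤ N ^ u / u.factorial := by
    exact_mod_cast Nat.choose_le_pow_div (α := ℝ) u N
  have h2 := Real.pow_div_factorial_le_exp (u : ℝ) hu'.le u
  have h3 : N * x ≤ u * Real.exp (-2) := by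
    have h4 : 1 / 8 ≤ Real.exp (-2) := by
      rw [Real.exp_neg, ← one_div]
      exact one_div_le_one_div_of_le (Real.exp_pos _) exp_two_le_eight
    nlinarith
  calc N.choose u * x ^ u ≤ N ^ u / u.factorial * x ^ u := by gcongr
    _ = (N * x) ^ u / u.factorial := by rw [mul_pow]; ring
    _ ≤ (u * Real.exp (-2)) ^ u / u.factorial := by gcongr
    _ = (u : ℝ) ^ u / u.factorial * Real.exp (-2) ^ u := by rw [mul_pow]; ring
    _ ≤ Real.exp u * Real.exp (-2) ^ u := by gcongr
    _ = Real.exp (-u) := by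
      rw [← Real.exp_nat_mul, ← Real.exp_add]; congr 1; ring

lemma choose_mul_pow_choose_two_le_exp {N u : ℕ} {x y : ℝ} (hx : 0 ≤ x) (hxy : x ≤ Real.exp (-y))
    (h : 8 * (N * Real.exp (-(y * (u - 1) / 2))) ≤ u) :
    N.choose u * x ^ u.choose 2 ≤ Real.exp (-u) := by
  refine le_trans ?_ (choose_mul_pow_le_exp (Real.exp_pos _).le h)
  refine mul_le_mul_of_nonneg_left ?_ (Nat.cast_nonneg _)
  refine (pow_le_pow_left₀ hx hxy _).trans (le_of_eq ?_)
  rw [← Real.exp_nat_mul, ← Real.exp_nat_mul, Nat.cast_choose_two]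
  congr 1; ring

lemma one_sub_le_exp_neg (y : ℝ) : 1 - y ≤ Real.exp (-y) := by
  linarith [Real.add_one_le_exp (-y)]

lemma exp_neg_le_inv_pow {n : ℕ} (hn : 0 < n) {u : ℝ} (k : ℕ) (h : k * Real.log n ≤ u) :
    Real.exp (-u) ≤ 1 / (n : ℝ) ^ k := by
  have hn' : (0 : ℝ) < n := by exact_mod_cast hn
  calc Real.exp (-u) ≤ Real.exp (-(k * Real.log n)) := Real.exp_le_exp.2 (by linarith)
    _ = 1 / (n : ℝ) ^ k := by
      rw [Real.exp_neg, Real.exp_nat_mul, Real.exp_log hn', one_div]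

lemma mul_inv_pow_three_le {n : ℕ} (hn : 0 < n) {y : ℝ} (hy : y ≤ 1 / (n : ℝ) ^ 3) :
    n * y ≤ 1 / (n : ℝ) ^ 2 := by
  have hn' : (0 : ℝ) < n := by exact_mod_cast hn
  calc n * y ≤ n * (1 / (n : ℝ) ^ 3) := by gcongr
    _ = 1 / (n : ℝ) ^ 2 := by field_simp

lemma choose_four_cast_le (s : ℕ) : (s.choose 4 : ℝ) ≤ (s : ℝ) ^ 4 / 24 := by
  exact_mod_cast Nat.choose_le_pow_div (α := ℝ) 4 s

lemma choose_eight_cast_le (s : ℕ) : (s.choose 8 : ℝ) ≤ (s : ℝ) ^ 8 / 40320 := by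
  exact_mod_cast Nat.choose_le_pow_div (α := ℝ) 8 s

end Estimates

variable {V : Type*} [Fintype V] [DecidableEq V]

/-- The terms correspond to the hypotheses of `not_evenNonDecomposable_of_sparse`: independent sets
in `S`, disjoint `K₄`'s in `S`, degrees into `S`, cliques in `G`. -/
lemma measureReal_evenNonDecomposable_le_of_sparse (p : I) {S : Finset V} {u : ℕ}
    (hS : #S = 100 * u) :
    (binomialRandom V p).real {G | G.EvenNonDecomposable} ≤
      (100 * u).choose u * (1 - p : ℝ) ^ u.choose 2 +
      ((100 * u).choose 4).choose u * (2 ^ 10 * (p : ℝ) ^ 6) ^ u +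
      Fintype.card V * (100 * u).choose u * (p : ℝ) ^ u +
      (Fintype.card V).choose u * (p : ℝ) ^ u.choose 2 := by
  classical
  have h1 := measureReal_exists_isClique_le (edgeBound_compl p) S u
  have h2 := measureReal_exists_edgeRich_le (edgeBound_id p) S u 4 6
  have h3 := measureReal_exists_degree_le (edgeBound_id p) S u
  have h4 := measureReal_exists_isClique_le (edgeBound_id p) (univ : Finset V) u
  rw [hS] at h1 h2 h3
  rw [card_univ] at h4
  refine le_trans (measureReal_mono ?_) ((measureReal_union_le _ _).trans (add_le_add
    ((measureReal_union_le _ _).trans (add_le_add ((measureReal_union_le _ _).trans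
      (add_le_add h1 h2)) h3)) h4))
  intro G hG
  by_contra hn
  simp only [Set.mem_union, not_or] at hn
  obtain ⟨⟨⟨hn1, hn2⟩, hn3⟩, hn4⟩ := hn
  refine not_evenNonDecomposable_of_sparse (S := S) (u := u) hS.ge ?_ ?_ ?_ ?_ hG
  · intro A hA hind
    by_contra hlt
    exact hn1 ⟨A, hA, fun x hx y hy hxy => (compl_adj _ _ _).2 ⟨hxy, hind x hx y hy⟩, by omega⟩
  · intro 𝒜 hd h𝒜
    by_contra hlt
    exact hn2 ⟨𝒜, hd, fun A hA => ⟨(h𝒜 A hA).1, (h𝒜 A hA).2.edgeRich_six⟩, by omega⟩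
  · intro v
    by_contra hlt
    exact hn3 ⟨v, by simpa using hlt⟩
  · intro Q hQ
    by_contra hlt
    exact hn4 ⟨Q, subset_univ _, hQ, by omega⟩

open Classical in
lemma measureReal_evenNonDecomposable_le_of_dense (p : I) {S R : Finset V} {u w : ℕ}
    (hSR : Disjoint S R) (hS : #S = 100 * u) :
    (binomialRandom V p).real {G | G.EvenNonDecomposable} ≤
      (100 * u + #R).choose u * (p : ℝ) ^ u.choose 2 +
      ((100 * u).choose 8).choose u * (2 ^ 36 * (1 - p : ℝ) ^ 10) ^ u +
      ((100 * u).choose 4).choose u * (2 ^ 10 * (1 - p : ℝ) ^ 4) ^ u +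
      Fintype.card V * (100 * u).choose u * (1 - p : ℝ) ^ u +
      ((binomialRandom V p).real {G | ∃ Q ⊆ univ \ (S ∪ R), G.IsClique (Q : Set V) ∧ w + 1 ≤ #Q} +
      (binomialRandom V p).real {G | ∃ q ∈ univ \ (S ∪ R), ∃ q' ∈ univ \ (S ∪ R), q ≠ q' ∧
        #{r ∈ R | ¬ (G.Adj r q ↔ G.Adj r q')} < w}) := by
  have h1 := measureReal_exists_isClique_le (edgeBound_id p) (S ∪ R) u
  have h2 := measureReal_exists_edgeRich_le (edgeBound_compl p) S u 8 10
  have h3 := measureReal_exists_edgeRich_le (edgeBound_compl p) S u 4 4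
  have h4 := measureReal_exists_degree_le (edgeBound_compl p) S u
  rw [card_union_of_disjoint hSR] at h1
  rw [hS] at h1 h2 h3 h4
  refine le_trans (measureReal_mono ?_) ((measureReal_union_le _ _).trans (add_le_add
    ((measureReal_union_le _ _).trans (add_le_add ((measureReal_union_le _ _).trans
      (add_le_add ((measureReal_union_le _ _).trans (add_le_add h1 h2)) h3)) h4))
      (measureReal_union_le _ _)))
  intro G hG
  by_contra hn
  simp only [Set.mem_union, not_or] at hn
  obtain ⟨⟨⟨⟨hn1, hn2⟩, hn3⟩, hn4⟩, hn5, hn6⟩ := hn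
  refine not_evenNonDecomposable_of_dense (S := S) (R := R) (u := u) (w := w) hSR hS.ge
    ?_ ?_ ?_ ?_ ?_ ?_ hG
  · intro A hA hc
    by_contra hlt
    exact hn1 ⟨A, hA, hc, by omega⟩
  · intro 𝒜 hd h𝒜
    by_contra hlt
    exact hn2 ⟨𝒜, hd, h𝒜, by omega⟩
  · intro 𝒜 hd h𝒜
    by_contra hlt
    exact hn3 ⟨𝒜, hd, h𝒜, by omega⟩
  · intro v
    by_contra hlt
    refine hn4 ⟨v, ?_⟩
    convert Nat.not_lt.1 hlt
  · intro Q hQ hc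
    by_contra hlt
    exact hn5 ⟨Q, hQ, hc, by omega⟩
  · intro q hq q' hq' hne
    by_contra hlt
    refine hn6 ⟨q, hq, q', hq', hne, ?_⟩
    convert not_le.1 hlt

/-- `h1` controls independent sets of size `u`. `h2` controls packings of `K₄`'s: the expected
number of these is of order `u ^ 4 * p ^ 6 = u * (u * p ^ 2) ^ 3`. -/
lemma measureReal_evenNonDecomposable_le_of_sparse_parameters (p : I) {u : ℕ}
    (hu : 100 * u ≤ Fintype.card V) (hlog : 3 * Real.log (Fintype.card V) + 1 ≤ u)
    (h1 : 14 ≤ (p : ℝ) * (u - 1)) (h2 : u * (p : ℝ) ^ 2 ≤ 3 / 10 ^ 4) (h3 : (p : ℝ) ≤ 1 / 1000) :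
    (binomialRandom V p).real {G | G.EvenNonDecomposable} ≤ 4 / (Fintype.card V : ℝ) ^ 2 := by
  set n := Fintype.card V with hn
  have hp := p.2.1
  have hlog0 : 0 ≤ Real.log n := Real.log_natCast_nonneg n
  have hu1 : (1 : ℝ) ≤ u := by linarith
  have hu1' : 1 ≤ u := by exact_mod_cast hu1
  have hn0 : 0 < n := by omega
  obtain ⟨S, -, hS⟩ := exists_subset_card_eq (s := (univ : Finset V)) (n := 100 * u)
    (by rw [card_univ]; exact hu)
  have hexp3 : Real.exp (-u) ≤ 1 / (n : ℝ) ^ 3 := exp_neg_le_inv_pow hn0 3 (by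
    push_cast; linarith)
  have hexp2 : Real.exp (-u) ≤ 1 / (n : ℝ) ^ 2 := exp_neg_le_inv_pow hn0 2 (by
    push_cast; linarith)
  have t1 : ((100 * u).choose u : ℝ) * (1 - p : ℝ) ^ u.choose 2 ≤ 1 / (n : ℝ) ^ 2 := by
    refine (choose_mul_pow_choose_two_le_exp (sub_nonneg.2 p.2.2)
      (one_sub_le_exp_neg _) ?_).trans hexp2
    have h7 : Real.exp (-((p : ℝ) * (u - 1) / 2)) ≤ 1 / 800 := by
      calc Real.exp (-((p : ℝ) * (u - 1) / 2)) ≤ Real.exp (-7) :=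
            Real.exp_le_exp.2 (by linarith)
        _ ≤ 1 / 800 := by
          rw [Real.exp_neg, ← one_div]
          refine one_div_le_one_div_of_le (by norm_num) ?_
          have h := Real.exp_one_gt_d9
          calc (800 : ℝ) ≤ 2.7 ^ 7 := by norm_num
            _ ≤ Real.exp 1 ^ 7 := by gcongr; linarith
            _ = Real.exp 7 := by rw [← Real.exp_nat_mul]; norm_num
    push_cast
    nlinarith
  have t2 : (((100 * u).choose 4).choose u : ℝ) * (2 ^ 10 * (p : ℝ) ^ 6) ^ u ≤
      1 / (n : ℝ) ^ 2 := by
    refine (choose_mul_pow_le_exp (by positivity) ?_).trans hexp2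
    have h5 := choose_four_cast_le (100 * u)
    have h6 : (u * (p : ℝ) ^ 2) ^ 3 ≤ (3 / 10 ^ 4) ^ 3 := by gcongr
    calc 8 * ((((100 * u).choose 4 : ℕ) : ℝ) * (2 ^ 10 * (p : ℝ) ^ 6))
        ≤ 8 * (((100 * u : ℕ) : ℝ) ^ 4 / 24 * (2 ^ 10 * (p : ℝ) ^ 6)) := by gcongr
      _ = 8 * 100 ^ 4 * 2 ^ 10 / 24 * (u * (p : ℝ) ^ 2) ^ 3 * u := by push_cast; ring
      _ ≤ 8 * 100 ^ 4 * 2 ^ 10 / 24 * (3 / 10 ^ 4) ^ 3 * u := by gcongr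
      _ ≤ 1 * u := by gcongr; norm_num
      _ = u := one_mul _
  have t3 : (n : ℝ) * (100 * u).choose u * (p : ℝ) ^ u ≤ 1 / (n : ℝ) ^ 2 := by
    rw [mul_assoc]
    refine mul_inv_pow_three_le hn0 ((choose_mul_pow_le_exp hp ?_).trans hexp3)
    push_cast
    nlinarith
  have t4 : (n.choose u : ℝ) * (p : ℝ) ^ u.choose 2 ≤ 1 / (n : ℝ) ^ 2 := by
    have hpe : (p : ℝ) ≤ Real.exp (-6) := by
      refine h3.trans ?_
      rw [Real.exp_neg, ← one_div]
      refine one_div_le_one_div_of_le (Real.exp_pos _) ?_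
      have h := Real.exp_one_lt_d9
      calc Real.exp 6 = Real.exp 1 ^ 6 := by rw [← Real.exp_nat_mul]; norm_num
        _ ≤ 2.8 ^ 6 := by gcongr; linarith
        _ ≤ 1000 := by norm_num
    refine (choose_mul_pow_choose_two_le_exp hp hpe ?_).trans hexp2
    have h8 : Real.exp (-(6 * ((u : ℝ) - 1) / 2)) ≤ 1 / (n : ℝ) ^ 3 :=
      exp_neg_le_inv_pow hn0 3 (by push_cast; linarith)
    have h9 := mul_inv_pow_three_le hn0 h8
    have h10 : (1 : ℝ) / (n : ℝ) ^ 2 ≤ 1 / 100 ^ 2 := by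
      have : (100 : ℝ) ≤ n := by exact_mod_cast (show 100 ≤ n by omega)
      gcongr
    linarith
  have := measureReal_evenNonDecomposable_le_of_sparse p hS
  rw [← hn] at this
  rw [show (4 : ℝ) / (n : ℝ) ^ 2 = 1 / (n : ℝ) ^ 2 + 1 / (n : ℝ) ^ 2 + 1 / (n : ℝ) ^ 2 +
    1 / (n : ℝ) ^ 2 by ring]
  exact this.trans (add_le_add (add_le_add (add_le_add t1 t2) t3) t4)

/-- The main part of the bound for dense random graphs. -/
lemma dense_terms_le {n u z : ℕ} {d : ℝ} (hn : 0 < n) (hd0 : 0 ≤ d) (hd1 : d ≤ 1 / 1000)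
    (hlog : 3 * Real.log n + 1 ≤ u) (h1 : 35 * 10 ^ 9 * ((u : ℝ) ^ 3 * d ^ 4) ≤ 1)
    (h2 : 8 * (z * Real.exp (-(d * (u - 1) / 2))) ≤ u) :
    z.choose u * (1 - d) ^ u.choose 2 +
      ((100 * u).choose 8).choose u * (2 ^ 36 * d ^ 10) ^ u +
      ((100 * u).choose 4).choose u * (2 ^ 10 * d ^ 4) ^ u +
      n * (100 * u).choose u * d ^ u ≤ 4 / (n : ℝ) ^ 2 := by
  have hlog0 : 0 ≤ Real.log n := Real.log_natCast_nonneg n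
  have hu1 : (1 : ℝ) ≤ u := by linarith
  have hexp3 : Real.exp (-u) ≤ 1 / (n : ℝ) ^ 3 := exp_neg_le_inv_pow hn 3 (by
    push_cast; linarith)
  have hexp2 : Real.exp (-u) ≤ 1 / (n : ℝ) ^ 2 := exp_neg_le_inv_pow hn 2 (by
    push_cast; linarith)
  have t1 : (z.choose u : ℝ) * (1 - d) ^ u.choose 2 ≤ 1 / (n : ℝ) ^ 2 :=
    (choose_mul_pow_choose_two_le_exp (by linarith) (one_sub_le_exp_neg _) h2).trans hexp2
  have t2 : (((100 * u).choose 8).choose u : ℝ) * (2 ^ 36 * d ^ 10) ^ u ≤ 1 / (n : ℝ) ^ 2 := by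
    refine (choose_mul_pow_le_exp (by positivity) ?_).trans hexp2
    have h5 := choose_eight_cast_le (100 * u)
    -- The condition for sets with ten non-edges follows from `h1`, as `(u ^ 7 * d ^ 10) ^ 3 = (u ^
    -- 3 * d ^ 4) ^ 7 * d ^ 2`.
    have h6 : 14 * 10 ^ 22 * ((u : ℝ) ^ 7 * d ^ 10) ≤ 1 := by
      rw [← pow_le_one_iff_of_nonneg (by positivity) (three_ne_zero)]
      have h7 : (u : ℝ) ^ 3 * d ^ 4 ≤ 1 / (35 * 10 ^ 9) := by
        rw [le_div_iff₀ (by norm_num)]; linarith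
      calc (14 * 10 ^ 22 * ((u : ℝ) ^ 7 * d ^ 10)) ^ 3
          = (14 * 10 ^ 22) ^ 3 * (((u : ℝ) ^ 3 * d ^ 4) ^ 7 * d ^ 2) := by ring
        _ ≤ (14 * 10 ^ 22) ^ 3 * ((1 / (35 * 10 ^ 9)) ^ 7 * (1 / 1000) ^ 2) := by gcongr
        _ ≤ 1 := by norm_num
    calc 8 * ((((100 * u).choose 8 : ℕ) : ℝ) * (2 ^ 36 * d ^ 10))
        ≤ 8 * (((100 * u : ℕ) : ℝ) ^ 8 / 40320 * (2 ^ 36 * d ^ 10)) := by gcongr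
      _ = 8 * 100 ^ 8 * 2 ^ 36 / 40320 / (14 * 10 ^ 22) *
          (14 * 10 ^ 22 * ((u : ℝ) ^ 7 * d ^ 10)) * u := by push_cast; ring
      _ ≤ 8 * 100 ^ 8 * 2 ^ 36 / 40320 / (14 * 10 ^ 22) * 1 * u := by gcongr
      _ ≤ 1 * u := by gcongr; norm_num
      _ = u := one_mul _
  have t3 : (((100 * u).choose 4).choose u : ℝ) * (2 ^ 10 * d ^ 4) ^ u ≤ 1 / (n : ℝ) ^ 2 := by
    refine (choose_mul_pow_le_exp (by positivity) ?_).trans hexp2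
    have h5 := choose_four_cast_le (100 * u)
    calc 8 * ((((100 * u).choose 4 : ℕ) : ℝ) * (2 ^ 10 * d ^ 4))
        ≤ 8 * (((100 * u : ℕ) : ℝ) ^ 4 / 24 * (2 ^ 10 * d ^ 4)) := by gcongr
      _ = 8 * 100 ^ 4 * 2 ^ 10 / 24 / (35 * 10 ^ 9) * (35 * 10 ^ 9 * ((u : ℝ) ^ 3 * d ^ 4)) * u := by
          push_cast; ring
      _ ≤ 8 * 100 ^ 4 * 2 ^ 10 / 24 / (35 * 10 ^ 9) * 1 * u := by gcongr
      _ ≤ 1 * u := by gcongr; norm_num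
      _ = u := one_mul _
  have t4 : (n : ℝ) * (100 * u).choose u * d ^ u ≤ 1 / (n : ℝ) ^ 2 := by
    rw [mul_assoc]
    refine mul_inv_pow_three_le hn ((choose_mul_pow_le_exp hd0 ?_).trans hexp3)
    push_cast
    nlinarith
  rw [show (4 : ℝ) / (n : ℝ) ^ 2 = 1 / (n : ℝ) ^ 2 + 1 / (n : ℝ) ^ 2 + 1 / (n : ℝ) ^ 2 +
    1 / (n : ℝ) ^ 2 by ring]
  linarith

end SimpleGraph

namespace SimpleGraph

open Finset MeasureTheory ProbabilityTheory unitInterval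

set_option linter.unusedSectionVars false

section Estimates

/-- The left side is at most `(n * exp (-(d * w / 2))) ^ (w + 1)`. -/
lemma choose_mul_pow_le_of_le_mul {n w : ℕ} {d : ℝ} (hn : 0 < n) (hd : d ≤ 1)
    (h : 6 * Real.log n ≤ d * w) :
    n.choose (w + 1) * (1 - d) ^ (w + 1).choose 2 ≤ 1 / (n : ℝ) ^ 2 := by
  have hn' : (0 : ℝ) < n := by exact_mod_cast hn
  have hL : 0 ≤ Real.log n := Real.log_natCast_nonneg n
  calc n.choose (w + 1) * (1 - d) ^ (w + 1).choose 2
      ≤ (n : ℝ) ^ (w + 1) * Real.exp (-d) ^ (w + 1).choose 2 := by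
        have h1 : (n.choose (w + 1) : ℝ) ≤ (n : ℝ) ^ (w + 1) := by
          exact_mod_cast Nat.choose_le_pow n (w + 1)
        have h2 : 0 ≤ 1 - d := by linarith
        have h3 := one_sub_le_exp_neg d
        gcongr
    _ = Real.exp (-((w + 1) * (d * w / 2 - Real.log n))) := by
        conv_lhs => rw [← Real.exp_log hn']
        rw [← Real.exp_nat_mul, ← Real.exp_nat_mul, ← Real.exp_add, Nat.cast_choose_two]
        congr 1; push_cast; ring
    _ ≤ 1 / (n : ℝ) ^ 2 := by
        refine exp_neg_le_inv_pow hn 2 ?_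
        have : 2 * Real.log n ≤ d * w / 2 - Real.log n := by linarith
        have hw : (0 : ℝ) ≤ w := Nat.cast_nonneg w
        push_cast
        nlinarith

/-- Here `r.choose (r - w) = r.choose w ≤ r ^ w`, and `p ^ 2 + (1 - p) ^ 2 = 1 - 2 * p * (1 - p)`.
-/
lemma choose_sub_mul_pow_le {n r w : ℕ} {p : ℝ} (hn : 0 < n) (hr : 0 < r) (hw : w ≤ r)
    (h : 5 * Real.log n + w * Real.log r ≤ 2 * (p * (1 - p)) * (r - w : ℝ)) :
    r.choose (r - w) * (p ^ 2 + (1 - p) ^ 2) ^ (r - w) ≤ 1 / (n : ℝ) ^ 5 := by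
  have hr' : (0 : ℝ) < r := by exact_mod_cast hr
  calc r.choose (r - w) * (p ^ 2 + (1 - p) ^ 2) ^ (r - w)
      ≤ (r : ℝ) ^ w * Real.exp (-(2 * (p * (1 - p)))) ^ (r - w) := by
        have h1 : (r.choose (r - w) : ℝ) ≤ (r : ℝ) ^ w := by
          rw [Nat.choose_symm hw]
          exact_mod_cast Nat.choose_le_pow r w
        have h3 : p ^ 2 + (1 - p) ^ 2 ≤ Real.exp (-(2 * (p * (1 - p)))) := by
          refine le_trans (le_of_eq ?_) (one_sub_le_exp_neg _)
          ring
        gcongr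
    _ = Real.exp (-(2 * (p * (1 - p)) * (r - w : ℝ) - w * Real.log r)) := by
        conv_lhs => rw [← Real.exp_log hr']
        rw [← Real.exp_nat_mul, ← Real.exp_nat_mul, ← Real.exp_add, Nat.cast_sub hw]
        congr 1; ring_nf
    _ ≤ 1 / (n : ℝ) ^ 5 := exp_neg_le_inv_pow hn 5 (by push_cast; linarith)

end Estimates

variable {V : Type*} [Fintype V] [DecidableEq V]

/-- Take `R = univ \ S` and `w = 0`: nothing lies outside `S ∪ R`, so no distinguishing is needed,
but cliques of the whole graph have to be smaller than `u`. -/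
lemma measureReal_evenNonDecomposable_le_of_dense_parameters (p : I) {u : ℕ} {d : ℝ}
    (hd : d = 1 - p) (hu : 100 * u ≤ Fintype.card V) (hd1 : d ≤ 1 / 1000)
    (hlog : 3 * Real.log (Fintype.card V) + 1 ≤ u) (h1 : 35 * 10 ^ 9 * ((u : ℝ) ^ 3 * d ^ 4) ≤ 1)
    (h2 : 8 * (Fintype.card V * Real.exp (-(d * (u - 1) / 2))) ≤ u) :
    (binomialRandom V p).real {G | G.EvenNonDecomposable} ≤ 4 / (Fintype.card V : ℝ) ^ 2 := by
  classical
  have hL : 0 ≤ Real.log (Fintype.card V) := Real.log_natCast_nonneg _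
  have hu1 : (1 : ℝ) ≤ u := by linarith
  have hu1' : 1 ≤ u := by exact_mod_cast hu1
  obtain ⟨S, -, hS⟩ := exists_subset_card_eq (s := (univ : Finset V)) (n := 100 * u)
    (by rw [card_univ]; exact hu)
  have hn0 : 0 < Fintype.card V := by omega
  have h := measureReal_evenNonDecomposable_le_of_dense p (S := S) (R := univ \ S) (w := 0)
    disjoint_sdiff hS
  have he1 : {G : SimpleGraph V | ∃ Q ⊆ univ \ (S ∪ (univ \ S)), G.IsClique (Q : Set V) ∧
      0 + 1 ≤ #Q} = ∅ := by
    refine Set.eq_empty_of_forall_notMem fun G hG => ?_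
    obtain ⟨Q, hQ, -, hQ1⟩ := hG
    obtain ⟨x, hx⟩ := card_pos.1 hQ1
    have := hQ hx
    simp only [mem_sdiff, mem_union, mem_univ, true_and] at this
    tauto
  simp only [he1, measureReal_empty, Nat.not_lt_zero, and_false, exists_false, Set.ofPred_false,
    add_zero, card_sdiff_of_subset (subset_univ S), hS, card_univ, Nat.add_sub_cancel' hu,
    ← hd] at h
  refine h.trans ?_
  have h3 := dense_terms_le (n := Fintype.card V) hn0 (d := d)
    (by rw [hd]; exact sub_nonneg.2 p.2.2) hd1 hlog h1 h2
  rwa [show 1 - d = (p : ℝ) by rw [hd]; ring] at h3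

/-- With a smaller `R`, only cliques in `100 * u + r` vertices have to be smaller than `u`. Cliques
elsewhere may have size `w`, which distinguishing vertices in `R` pay for. -/
lemma measureReal_evenNonDecomposable_le_of_dense_distinguish (p : I) {u r w : ℕ} {d : ℝ}
    (hd : d = 1 - p) (hu : 100 * u + r ≤ Fintype.card V) (hd1 : d ≤ 1 / 1000)
    (hlog : 3 * Real.log (Fintype.card V) + 1 ≤ u) (h1 : 35 * 10 ^ 9 * ((u : ℝ) ^ 3 * d ^ 4) ≤ 1)
    (h2 : 8 * (((100 * u + r : ℕ) : ℝ) * Real.exp (-(d * (u - 1) / 2))) ≤ u)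
    (h3 : 6 * Real.log (Fintype.card V) ≤ d * w) (hr : 0 < r) (hw : w ≤ r)
    (h4 : 5 * Real.log (Fintype.card V) + w * Real.log r ≤ d * (r - w : ℝ)) :
    (binomialRandom V p).real {G | G.EvenNonDecomposable} ≤ 6 / (Fintype.card V : ℝ) ^ 2 := by
  classical
  have hp : (p : ℝ) = 1 - d := by rw [hd]; ring
  have hd0 : 0 ≤ d := by rw [hd]; exact sub_nonneg.2 p.2.2
  have hn0 : 0 < Fintype.card V := by omega
  have hn1 : (1 : ℝ) ≤ Fintype.card V := by exact_mod_cast hn0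
  obtain ⟨S, -, hS⟩ := exists_subset_card_eq (s := (univ : Finset V)) (n := 100 * u)
    (by rw [card_univ]; omega)
  obtain ⟨R, hRS, hR⟩ := exists_subset_card_eq (s := univ \ S) (n := r)
    (by rw [card_sdiff_of_subset (subset_univ S), card_univ]; omega)
  have hSR : Disjoint S R := disjoint_sdiff.mono_right hRS
  have h := measureReal_evenNonDecomposable_le_of_dense p (w := w) hSR hS
  have h5 := dense_terms_le (n := Fintype.card V) hn0 hd0 hd1 hlog h1 h2
  have h6 : (binomialRandom V p).real {G | ∃ Q ⊆ univ \ (S ∪ R), G.IsClique (Q : Set V) ∧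
      w + 1 ≤ #Q} ≤ 1 / (Fintype.card V : ℝ) ^ 2 := by
    have h7 := measureReal_exists_isClique_le (edgeBound_id p) (univ : Finset V) (w + 1)
    rw [card_univ, hp] at h7
    refine (measureReal_mono ?_).trans (h7.trans
      (choose_mul_pow_le_of_le_mul hn0 (by linarith) h3))
    rintro G ⟨Q, -, hQ⟩
    exact ⟨Q, subset_univ _, hQ⟩
  have h8 : (binomialRandom V p).real {G | ∃ q ∈ univ \ (S ∪ R), ∃ q' ∈ univ \ (S ∪ R), q ≠ q' ∧
      #{r ∈ R | ¬ (G.Adj r q ↔ G.Adj r q')} < w} ≤ 1 / (Fintype.card V : ℝ) ^ 2 := by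
    have h9 := measureReal_exists_not_distinguish_le p R w
    have hsub : ∀ q ∈ univ \ (S ∪ R), q ∈ univ \ R := fun q hq =>
      sdiff_subset_sdiff subset_rfl subset_union_right hq
    refine (measureReal_mono ?_).trans (h9.trans ?_)
    · rintro G ⟨q, hq, q', hq', hne, hlt⟩
      exact ⟨q, hsub q hq, q', hsub q' hq', hne, hlt⟩
    · rw [hR, mul_assoc]
      have hrw : 0 ≤ (r - w : ℝ) := by
        rw [sub_nonneg]; exact_mod_cast hw
      have h10 := choose_sub_mul_pow_le (n := Fintype.card V) (p := p) hn0 hr hw (by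
        refine h4.trans (mul_le_mul_of_nonneg_right ?_ hrw)
        rw [hp]; nlinarith)
      calc (Fintype.card V : ℝ) ^ 2 * _ ≤ (Fintype.card V : ℝ) ^ 2 *
            (1 / (Fintype.card V : ℝ) ^ 5) := by gcongr
        _ = 1 / (Fintype.card V : ℝ) ^ 3 := by field_simp
        _ ≤ 1 / (Fintype.card V : ℝ) ^ 2 := by gcongr; norm_num
  rw [hR, ← hd, hp] at h
  refine h.trans ((add_le_add h5 (add_le_add h6 h8)).trans (le_of_eq ?_))
  ring

/-- `h1` and `h2` make the two failures within a block unlikely; by `h5` the expected number of good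
blocks is at least `2 * log n`. -/
lemma measureReal_evenNonDecomposable_le_of_block_parameters (p : I) {N k r w : ℕ} {d : ℝ}
    (hd : d = 1 - p) (hN : N * (12 * k + r) ≤ Fintype.card V) (hn0 : 0 < Fintype.card V)
    (h1 : 4 * (r : ℝ) ≤ 2 ^ k) (h2 : Real.log r + 2 ≤ d * k / 2)
    (h3 : 6 * Real.log (Fintype.card V) ≤ d * w) (hr : 0 < r) (hw : w ≤ r)
    (h4 : 5 * Real.log (Fintype.card V) + w * Real.log r ≤ 2 * (p * (1 - p)) * (r - w : ℝ))
    (h5 : 4 * Real.log (Fintype.card V) ≤ N * ((p : ℝ) ^ (72 * k ^ 2) * d ^ (9 * k))) :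
    (binomialRandom V p).real {G | G.EvenNonDecomposable} ≤ 3 / (Fintype.card V : ℝ) ^ 2 := by
  have hp : (p : ℝ) = 1 - d := by rw [hd]; ring
  have hd0 : 0 ≤ d := by rw [hd]; exact sub_nonneg.2 p.2.2
  have hd1 : d ≤ 1 := by rw [hd]; linarith [p.2.1]
  have hr' : (0 : ℝ) < r := by exact_mod_cast hr
  have hn1 : (1 : ℝ) ≤ Fintype.card V := by exact_mod_cast hn0
  have a1 : (r * ((3 * k).choose (2 * k + 1) * (1 / 4) ^ (2 * k + 1)) : ℝ) ≤ 1 / 4 := by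
    have h6 : ((3 * k).choose (2 * k + 1) : ℝ) ≤ 2 ^ (3 * k) := by
      exact_mod_cast Nat.choose_le_two_pow _ _
    calc (r * ((3 * k).choose (2 * k + 1) * (1 / 4) ^ (2 * k + 1)) : ℝ)
        ≤ 2 ^ k / 4 * (2 ^ (3 * k) * (1 / 4) ^ (2 * k + 1)) := by gcongr; linarith
      _ = (2 * 2 ^ 3 * (1 / 4) ^ 2) ^ k * (1 / 16) := by
        rw [mul_pow, mul_pow, ← pow_mul, ← pow_mul]; ring
      _ ≤ 1 / 4 := by norm_num
  have a2 : r.choose (k + 1) * (p : ℝ) ^ (k + 1).choose 2 ≤ 1 / 4 := by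
    calc r.choose (k + 1) * (p : ℝ) ^ (k + 1).choose 2
        ≤ (r : ℝ) ^ (k + 1) * Real.exp (-d) ^ (k + 1).choose 2 := by
          have h6 : (r.choose (k + 1) : ℝ) ≤ (r : ℝ) ^ (k + 1) := by
            exact_mod_cast Nat.choose_le_pow r (k + 1)
          have h7 := one_sub_le_exp_neg d
          rw [← hp] at h7
          have h8 := p.2.1
          gcongr
      _ = Real.exp (-((k + 1) * (d * k / 2 - Real.log r))) := by
          conv_lhs => rw [← Real.exp_log hr']
          rw [← Real.exp_nat_mul, ← Real.exp_nat_mul, ← Real.exp_add, Nat.cast_choose_two]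
          congr 1; push_cast; ring
      _ ≤ Real.exp (-2) := by
          have hk : (0 : ℝ) ≤ k := Nat.cast_nonneg k
          refine Real.exp_le_exp.2 (neg_le_neg ?_)
          nlinarith
      _ ≤ 1 / 4 := by
          rw [Real.exp_neg, ← one_div]
          refine one_div_le_one_div_of_le (by norm_num) ?_
          have := Real.exp_one_gt_d9
          rw [show (2 : ℝ) = 1 + 1 by norm_num, Real.exp_add]
          nlinarith
  have h := measureReal_evenNonDecomposable_le_of_blocks p (w := w) hN a1 a2
  have t1 : (1 - (p : ℝ) ^ (12 * k).choose 2 * (1 - p : ℝ) ^ (9 * k) / 2) ^ N ≤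
      1 / (Fintype.card V : ℝ) ^ 2 := by
    have h6 : (12 * k).choose 2 ≤ 72 * k ^ 2 := by
      rw [Nat.choose_two_right]
      refine Nat.div_le_of_le_mul ?_
      calc 12 * k * (12 * k - 1) ≤ 12 * k * (12 * k) := by gcongr; omega
        _ = 2 * (72 * k ^ 2) := by ring
    have h7 : (p : ℝ) ^ (72 * k ^ 2) ≤ (p : ℝ) ^ (12 * k).choose 2 :=
      pow_le_pow_of_le_one p.2.1 p.2.2 h6
    have hd9 : 0 ≤ d ^ (9 * k) := by positivity
    have hle1 : (p : ℝ) ^ (12 * k).choose 2 * d ^ (9 * k) ≤ 1 :=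
      mul_le_one₀ (pow_le_one₀ p.2.1 p.2.2) hd9 (pow_le_one₀ hd0 hd1)
    rw [← hd]
    calc (1 - (p : ℝ) ^ (12 * k).choose 2 * d ^ (9 * k) / 2) ^ N
        ≤ Real.exp (-((p : ℝ) ^ (12 * k).choose 2 * d ^ (9 * k) / 2)) ^ N := by
          refine pow_le_pow_left₀ (by linarith) (one_sub_le_exp_neg _) _
      _ = Real.exp (-(N * ((p : ℝ) ^ (12 * k).choose 2 * d ^ (9 * k) / 2))) := by
          rw [← Real.exp_nat_mul]; congr 1; ring
      _ ≤ 1 / (Fintype.card V : ℝ) ^ 2 := by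
          refine exp_neg_le_inv_pow hn0 2 ?_
          have : (N : ℝ) * ((p : ℝ) ^ (72 * k ^ 2) * d ^ (9 * k)) ≤
              N * ((p : ℝ) ^ (12 * k).choose 2 * d ^ (9 * k)) := by gcongr
          push_cast
          linarith
  have t2 : N * (Fintype.card V ^ 2 * r.choose (r - w) *
      ((p : ℝ) ^ 2 + (1 - p : ℝ) ^ 2) ^ (r - w)) ≤ 1 / (Fintype.card V : ℝ) ^ 2 := by
    have h6 := choose_sub_mul_pow_le (n := Fintype.card V) (p := p) hn0 hr hw h4
    have h7 : (N : ℝ) ≤ Fintype.card V := by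
      exact_mod_cast (Nat.le_mul_of_pos_right N (by omega)).trans hN
    rw [mul_assoc]
    calc (N : ℝ) * ((Fintype.card V : ℝ) ^ 2 * _) ≤ Fintype.card V * ((Fintype.card V : ℝ) ^ 2 *
          (1 / (Fintype.card V : ℝ) ^ 5)) := by gcongr
      _ = 1 / (Fintype.card V : ℝ) ^ 2 := by field_simp
  have t3 : (Fintype.card V).choose (w + 1) * (p : ℝ) ^ (w + 1).choose 2 ≤
      1 / (Fintype.card V : ℝ) ^ 2 := by
    rw [hp]
    exact choose_mul_pow_le_of_le_mul hn0 hd1 h3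
  refine h.trans ((add_le_add (add_le_add t1 t2) t3).trans (le_of_eq ?_))
  ring

end SimpleGraph

/-! ### The individual ranges of `p` -/

namespace SimpleGraph

open Finset MeasureTheory ProbabilityTheory unitInterval

set_option linter.unusedSectionVars false

variable {V : Type*} [Fintype V] [DecidableEq V]

lemma sub_two_le_cast_div (n : ℕ) : (n : ℝ) / 100 - 1 ≤ (n / 100 : ℕ) := by
  have h : n < 100 * (n / 100 + 1) := by omega
  have h' : (n : ℝ) < 100 * ((n / 100 : ℕ) + 1) := by exact_mod_cast h
  linarith

/-- Without a `K₄` the graph is never even-non-decomposable, and the expected number of `K₄`'s is of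
order `n ^ 4 * p ^ 6`. -/
lemma measureReal_evenNonDecomposable_le_of_le_const_div (p : I) (hn : 0 < Fintype.card V) {K : ℝ}
    (hp : (p : ℝ) ≤ K / Fintype.card V) :
    (binomialRandom V p).real {G | G.EvenNonDecomposable} ≤
      2 ^ 10 * K ^ 6 / (Fintype.card V : ℝ) ^ 2 := by
  have hn' : (0 : ℝ) < Fintype.card V := by exact_mod_cast hn
  have h := measureReal_exists_edgeRich_le (edgeBound_id p) (univ : Finset V) 1 4 6
  refine (measureReal_mono ?_).trans (h.trans ?_)
  · intro G hG
    by_contra hno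
    refine not_evenNonDecomposable_of_reach (Reach.refl univ) (fun t _ ht => hno ?_) hG
    exact ⟨{t}, by simp, by simpa using ht.edgeRich_six, by simp⟩
  · rw [card_univ, Nat.choose_one_right, pow_one]
    have h4 : ((Fintype.card V).choose 4 : ℝ) ≤ (Fintype.card V : ℝ) ^ 4 := by
      exact_mod_cast Nat.choose_le_pow _ 4
    have hp0 := p.2.1
    calc ((Fintype.card V).choose 4 : ℝ) * (2 ^ (4 + 1).choose 2 * (p : ℝ) ^ 6)
        ≤ (Fintype.card V : ℝ) ^ 4 * (2 ^ (4 + 1).choose 2 * (K / Fintype.card V) ^ 6) := by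
          gcongr
      _ = 2 ^ 10 * K ^ 6 / (Fintype.card V : ℝ) ^ 2 := by
          rw [show Nat.choose (4 + 1) 2 = 10 from rfl]; field_simp

lemma measureReal_evenNonDecomposable_le_sparse_range (p : I) {q : ℝ} (hq : 10 ^ 10 ≤ q)
    (hL : Real.log (Fintype.card V) ≤ 65536 * q) (hn : q ^ 2 ≤ Fintype.card V)
    (hp1 : 10 ^ 5 / (Fintype.card V : ℝ) ≤ p) (hp2 : p * q ≤ 1) :
    (binomialRandom V p).real {G | G.EvenNonDecomposable} ≤ 4 / (Fintype.card V : ℝ) ^ 2 := by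
  set n := Fintype.card V with hnV
  have hn0 : (10 : ℝ) ^ 20 ≤ n := by nlinarith
  have hp0 : 0 < (p : ℝ) := lt_of_lt_of_le (by positivity) hp1
  have hps : (p : ℝ) ≤ 1 / 10 ^ 10 := by
    rw [le_div_iff₀ (by norm_num)]; nlinarith
  rw [div_le_iff₀ (by linarith)] at hp1
  set X := 3 / 10 ^ 4 / (p : ℝ) ^ 2 with hX
  have hXp : X * (p : ℝ) ^ 2 = 3 / 10 ^ 4 := div_mul_cancel₀ _ (by positivity)
  have hX0 : 0 ≤ X := by positivity
  have hXq : 3 / 10 ^ 4 * q ^ 2 ≤ X := by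
    have : (p * q : ℝ) ^ 2 ≤ 1 := pow_le_one₀ (by positivity) hp2
    rw [hX, le_div_iff₀ (by positivity)]
    nlinarith
  have hfl := Nat.lt_floor_add_one X
  have hdiv := sub_two_le_cast_div n
  have hfl' := Nat.floor_le hX0
  refine measureReal_evenNonDecomposable_le_of_sparse_parameters p
    (u := min (n / 100) ⌊X⌋₊) ?_ ?_ ?_ ?_ (by linarith)
  · have := min_le_left (n / 100) ⌊X⌋₊
    omega
  · rw [← hnV, Nat.cast_min]
    refine le_min ?_ ?_ <;> nlinarith
  · rw [Nat.cast_min]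
    rcases min_choice ((n / 100 : ℕ) : ℝ) (⌊X⌋₊ : ℝ) with h | h <;> rw [h]
    · nlinarith
    · have h1 : 3 / 10 ^ 4 - 2 * (p : ℝ) ^ 2 ≤ (p * (⌊X⌋₊ - 1)) * p := by nlinarith
      nlinarith
  · rw [Nat.cast_min]
    have : min ((n / 100 : ℕ) : ℝ) (⌊X⌋₊ : ℝ) ≤ X := (min_le_right _ _).trans hfl'
    rw [← hXp]
    gcongr

lemma measureReal_evenNonDecomposable_le_dense_range (p : I) {T y : ℝ} (hT : 10 ^ 10 ≤ T)
    (hL : Real.log (Fintype.card V) ≤ 65536 * T ^ 16) (hn : T ^ 100 ≤ Fintype.card V)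
    (hy : y ^ 3 = 1 - p) (hy0 : 0 < y) (hp1 : 10 ^ 5 / (Fintype.card V : ℝ) ≤ y ^ 3)
    (hyT : y * T ^ 17 ≤ 1) :
    (binomialRandom V p).real {G | G.EvenNonDecomposable} ≤ 4 / (Fintype.card V : ℝ) ^ 2 := by
  set n := Fintype.card V with hnV
  have hT0 : 0 < T := by linarith
  have hT1 : 1 ≤ T := by linarith
  have hTn : T ≤ n := (le_self_pow₀ hT1 (by norm_num)).trans hn
  have hT18 : T ^ 18 ≤ n := (pow_le_pow_right₀ hT1 (by norm_num)).trans hn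
  have hT16 : 1 ≤ T ^ 16 := one_le_pow₀ hT1
  have hn0 : 0 < (n : ℝ) := by linarith
  have hTT : T ≤ T ^ 17 := le_self_pow₀ hT1 (by norm_num)
  have hys : y ≤ 1 / 10 ^ 10 := by
    rw [le_div_iff₀ (by norm_num)]; nlinarith
  rw [div_le_iff₀ hn0] at hp1
  -- As `d = y ^ 3`, the constraint that `u ^ 3 * d ^ 4` be small allows `u` of order `y ^ (-4)`.
  -- Then `d * u` has order `1 / y`, at least of order `T ^ 17`, and so beats `log n`.
  set X := 1 / 3300 / y ^ 4 with hX
  have hXy : X * y ^ 4 = 1 / 3300 := div_mul_cancel₀ _ (by positivity)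
  have hX0 : 0 ≤ X := by positivity
  have h17 : T ^ 17 = T * T ^ 16 := by ring
  have hXT : 1 / 3300 * T ^ 17 ≤ X := by
    have h1 : (y * T ^ 17) ^ 4 ≤ 1 := pow_le_one₀ (by positivity) hyT
    have h2 : y ^ 4 * T ^ 17 ≤ 1 := by
      refine le_trans ?_ h1
      rw [mul_pow]
      gcongr
      exact le_self_pow₀ (one_le_pow₀ hT1) (by norm_num)
    rw [hX, le_div_iff₀ (by positivity)]
    nlinarith
  have hfl := Nat.lt_floor_add_one X
  have hdiv := sub_two_le_cast_div n
  have hfl' := Nat.floor_le hX0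
  -- The surplus beyond `+ 1` provides `8 ≤ u` for the last condition.
  have hmin : 3 * Real.log n + 9 ≤ (min (n / 100) ⌊X⌋₊ : ℕ) := by
    rw [Nat.cast_min]
    refine le_min ?_ ?_
    · have : 10 ^ 10 * T ^ 16 ≤ T ^ 17 := by rw [h17]; gcongr
      have : T ^ 17 ≤ n := (pow_le_pow_right₀ hT1 (by norm_num)).trans hn
      linarith
    · have : 10 ^ 10 * T ^ 16 ≤ T ^ 17 := by rw [h17]; gcongr
      linarith
  have hL0 : 0 ≤ Real.log n := Real.log_natCast_nonneg n
  refine measureReal_evenNonDecomposable_le_of_dense_parameters p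
    (u := min (n / 100) ⌊X⌋₊) hy ?_ ?_ ?_ ?_ ?_
  · have := min_le_left (n / 100) ⌊X⌋₊
    omega
  · calc y ^ 3 ≤ (1 / 10 ^ 10) ^ 3 := by gcongr
      _ ≤ 1 / 1000 := by norm_num
  · rw [← hnV]; linarith
  · rw [Nat.cast_min]
    have : min ((n / 100 : ℕ) : ℝ) (⌊X⌋₊ : ℝ) ≤ X := (min_le_right _ _).trans hfl'
    have h0 : 0 ≤ min ((n / 100 : ℕ) : ℝ) (⌊X⌋₊ : ℝ) := by positivity
    calc 35 * 10 ^ 9 * (min ((n / 100 : ℕ) : ℝ) (⌊X⌋₊ : ℝ) ^ 3 * (y ^ 3) ^ 4)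
        ≤ 35 * 10 ^ 9 * (X ^ 3 * (y ^ 3) ^ 4) := by gcongr
      _ = 35 * 10 ^ 9 * (X * y ^ 4) ^ 3 := by ring
      _ ≤ 1 := by rw [hXy]; norm_num
  · rw [← hnV]
    rw [Nat.cast_min] at hmin ⊢
    rcases min_choice ((n / 100 : ℕ) : ℝ) (⌊X⌋₊ : ℝ) with h | h <;> rw [h] at hmin ⊢
    · have h1 : Real.exp (-(y ^ 3 * (((n / 100 : ℕ) : ℝ) - 1) / 2)) ≤ 1 / 1600 := by
        have hy3 : 0 ≤ y ^ 3 := by positivity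
        have hy31 : y ^ 3 ≤ 1 := pow_le_one₀ hy0.le (by linarith)
        calc Real.exp (-(y ^ 3 * (((n / 100 : ℕ) : ℝ) - 1) / 2)) ≤ Real.exp (-8) :=
              Real.exp_le_exp.2 (by nlinarith)
          _ ≤ 1 / 1600 := by
            rw [Real.exp_neg, ← one_div]
            refine one_div_le_one_div_of_le (by norm_num) ?_
            have h := Real.exp_one_gt_d9
            calc (1600 : ℝ) ≤ 2.7 ^ 8 := by norm_num
              _ ≤ Real.exp 1 ^ 8 := by gcongr; linarith
              _ = Real.exp 8 := by rw [← Real.exp_nat_mul]; norm_num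
      nlinarith
    · have h2 : (1 / 3300 - 2 * y ^ 4) ≤ y * (y ^ 3 * ((⌊X⌋₊ : ℝ) - 1)) := by
        have hy4 : 0 ≤ y ^ 4 := by positivity
        have e : y * (y ^ 3 * ((⌊X⌋₊ : ℝ) - 1)) = y ^ 4 * ((⌊X⌋₊ : ℝ) - 1) := by ring
        rw [e]
        nlinarith
      have h3 : 1 / 6600 ≤ 1 / 3300 - 2 * y ^ 4 := by
        have : y ^ 4 ≤ (1 / 10 ^ 10) ^ 4 := by gcongr
        linarith
      have h4 : T ^ 17 / 6600 ≤ y ^ 3 * ((⌊X⌋₊ : ℝ) - 1) := by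
        have h5 : 0 ≤ y ^ 3 * ((⌊X⌋₊ : ℝ) - 1) := by
          have : (1 : ℝ) ≤ ⌊X⌋₊ := by linarith
          exact mul_nonneg (by positivity) (by linarith)
        nlinarith
      have h6 : Real.exp (-(y ^ 3 * ((⌊X⌋₊ : ℝ) - 1) / 2)) ≤ 1 / (n : ℝ) ^ 1 := by
        refine exp_neg_le_inv_pow (by exact_mod_cast hn0) 1 ?_
        have : 10 ^ 10 * T ^ 16 ≤ T ^ 17 := by rw [h17]; gcongr
        push_cast
        linarith
      calc 8 * (n * Real.exp (-(y ^ 3 * ((⌊X⌋₊ : ℝ) - 1) / 2))) ≤ 8 * (n * (1 / (n : ℝ) ^ 1)) := by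
            gcongr
        _ = 8 := by field_simp
        _ ≤ _ := by linarith

end SimpleGraph

namespace SimpleGraph

open Finset MeasureTheory ProbabilityTheory unitInterval

set_option linter.unusedSectionVars false

variable {V : Type*} [Fintype V] [DecidableEq V]

/-- Here `d * u`, of order `1 / y`, may fall below `log n`, so cliques of the whole graph can exceed
`u`. It still beats `log T`, which suffices for an `S ∪ R` of size polynomial in `T`. -/
lemma measureReal_evenNonDecomposable_le_dense_distinguish_range (p : I) {t : ℕ} {y : ℝ}
    (hT : 10 ^ 10 ≤ (t : ℝ)) (hlogT : 10 ^ 6 * Real.log t ≤ t)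
    (hL : Real.log (Fintype.card V) ≤ 65536 * (t : ℝ) ^ 16)
    (hn : t ^ 200 ≤ Fintype.card V) (hy : y ^ 3 = 1 - p) (hy0 : 0 < y)
    (hyT : 1 ≤ y * (t : ℝ) ^ 17) (hyT' : y ^ 3 * (t : ℝ) ^ 13 ≤ 1) :
    (binomialRandom V p).real {G | G.EvenNonDecomposable} ≤ 6 / (Fintype.card V : ℝ) ^ 2 := by
  set n := Fintype.card V with hnV
  set T : ℝ := (t : ℝ) with hTdef
  have hT0 : 0 < T := by linarith
  have ht0 : 0 < t := Nat.cast_pos.1 (show (0 : ℝ) < (t : ℝ) from hT0)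
  have hT1 : 1 ≤ T := by linarith
  have hpow : ∀ {a b : ℕ}, a ≤ b → T ^ a ≤ T ^ b := fun h => pow_le_pow_right₀ hT1 h
  have hstep : ∀ a : ℕ, 10 ^ 10 * T ^ a ≤ T ^ (a + 1) := fun a => by
    rw [pow_succ' T a]; exact mul_le_mul_of_nonneg_right hT (by positivity)
  have hlog1 : 1 ≤ Real.log T := by
    rw [Real.le_log_iff_exp_le hT0]
    linarith [Real.exp_one_lt_d9]
  have hy4 : y * T ^ 4 ≤ 1 := by
    rw [← pow_le_one_iff_of_nonneg (by positivity) three_ne_zero]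
    refine le_trans ?_ hyT'
    rw [mul_pow, ← pow_mul]
    gcongr
    norm_num
  have hys : y ≤ 1 / 10 ^ 10 := by
    rw [le_div_iff₀ (by norm_num)]
    have : T ≤ T ^ 4 := le_self_pow₀ hT1 (by norm_num)
    nlinarith
  set X := 1 / 3300 / y ^ 4 with hX
  have hXy : X * y ^ 4 = 1 / 3300 := div_mul_cancel₀ _ (by positivity)
  have hX0 : 0 ≤ X := by positivity
  have hXT : 1 / 3300 * T ^ 17 ≤ X := by
    have h2 : y ^ 4 * T ^ 17 ≤ 1 := by
      rw [← pow_le_one_iff_of_nonneg (by positivity) three_ne_zero]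
      calc (y ^ 4 * T ^ 17) ^ 3 = y ^ 12 * T ^ 51 := by ring
        _ ≤ y ^ 12 * T ^ 52 := by gcongr; norm_num
        _ = (y ^ 3 * T ^ 13) ^ 4 := by ring
        _ ≤ 1 := pow_le_one₀ (by positivity) hyT'
    rw [hX, le_div_iff₀ (by positivity)]
    nlinarith
  have hXT' : X ≤ T ^ 68 := by
    have h1 : 1 ≤ (y * T ^ 17) ^ 4 := one_le_pow₀ hyT
    rw [hX, div_le_iff₀ (by positivity)]
    have e : (y * T ^ 17) ^ 4 = T ^ 68 * y ^ 4 := by ring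
    rw [e] at h1
    linarith
  have hfl := Nat.lt_floor_add_one X
  have hfl' := Nat.floor_le hX0
  have h16 : 1 ≤ T ^ 16 := one_le_pow₀ hT1
  have h17 := hstep 16
  have hmin : 3 * Real.log n + 9 ≤ ⌊X⌋₊ := by
    norm_num at h17
    linarith
  have hL0 : 0 ≤ Real.log n := Real.log_natCast_nonneg n
  have hsum : 100 * (⌊X⌋₊ : ℝ) + T ^ 130 ≤ T ^ 131 := by
    have h1 := hstep 130
    have h2 : T ^ 68 ≤ T ^ 130 := hpow (by norm_num)
    have h3 : 0 ≤ T ^ 130 := by positivity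
    norm_num at h1
    linarith
  have hdT : 1 ≤ y ^ 3 * T ^ 51 := by
    calc 1 ≤ (y * T ^ 17) ^ 3 := one_le_pow₀ hyT
      _ = y ^ 3 * T ^ 51 := by ring
  have hd17 : T ^ 17 ≤ y ^ 3 * T ^ 68 := by
    calc T ^ 17 = 1 * T ^ 17 := (one_mul _).symm
      _ ≤ y ^ 3 * T ^ 51 * T ^ 17 := by gcongr
      _ = y ^ 3 * T ^ 68 := by ring
  -- Since `d ≥ T ^ (-51)`, the choice of `w` gives `d * w ≥ T ^ 17`, beyond `6 * log n`, and `d * r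
  -- ≥ T ^ 79` dominates `w * log r`.
  refine measureReal_evenNonDecomposable_le_of_dense_distinguish p
    (u := ⌊X⌋₊) (r := t ^ 130) (w := t ^ 68) hy ?_ ?_ ?_ ?_ ?_ ?_ ?_ ?_ ?_
  · have h1 : ((100 * ⌊X⌋₊ + t ^ 130 : ℕ) : ℝ) ≤ ((t ^ 200 : ℕ) : ℝ) := by
      push_cast
      exact hsum.trans (hpow (by norm_num))
    exact (Nat.cast_le.1 h1).trans hn
  · calc y ^ 3 ≤ (1 / 10 ^ 10) ^ 3 := by gcongr
      _ ≤ 1 / 1000 := by norm_num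
  · rw [← hnV]; linarith
  · calc 35 * 10 ^ 9 * ((⌊X⌋₊ : ℝ) ^ 3 * (y ^ 3) ^ 4)
        ≤ 35 * 10 ^ 9 * (X ^ 3 * (y ^ 3) ^ 4) := by gcongr
      _ = 35 * 10 ^ 9 * (X * y ^ 4) ^ 3 := by ring
      _ ≤ 1 := by rw [hXy]; norm_num
  · have h2 : (1 / 3300 - 2 * y ^ 4) ≤ y * (y ^ 3 * ((⌊X⌋₊ : ℝ) - 1)) := by
      have hy4 : 0 ≤ y ^ 4 := by positivity
      have e : y * (y ^ 3 * ((⌊X⌋₊ : ℝ) - 1)) = y ^ 4 * ((⌊X⌋₊ : ℝ) - 1) := by ring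
      rw [e]
      nlinarith
    have h3 : 1 / 6600 ≤ 1 / 3300 - 2 * y ^ 4 := by
      have : y ^ 4 ≤ (1 / 10 ^ 10) ^ 4 := by gcongr
      linarith
    have h4 : T ^ 4 / 6600 ≤ y ^ 3 * ((⌊X⌋₊ : ℝ) - 1) := by
      have h5 : 0 ≤ y ^ 3 * ((⌊X⌋₊ : ℝ) - 1) := by
        have : (1 : ℝ) ≤ ⌊X⌋₊ := by linarith
        exact mul_nonneg (by positivity) (by linarith)
      have h40 : 0 ≤ T ^ 4 := by positivity
      nlinarith
    have h5 : T ≤ y ^ 3 * ((⌊X⌋₊ : ℝ) - 1) / 2 := by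
      have h6 := hstep 3
      have h7 : T ≤ T ^ 3 := le_self_pow₀ hT1 (by norm_num)
      norm_num at h6
      linarith
    have h6 : Real.exp (-(y ^ 3 * ((⌊X⌋₊ : ℝ) - 1) / 2)) ≤ 1 / T ^ 131 := by
      refine exp_neg_le_inv_pow ht0 131 ?_
      push_cast
      rw [← hTdef]
      linarith
    have h7 : ((100 * ⌊X⌋₊ + t ^ 130 : ℕ) : ℝ) ≤ T ^ 131 := by push_cast; exact hsum
    calc 8 * (((100 * ⌊X⌋₊ + t ^ 130 : ℕ) : ℝ) * Real.exp (-(y ^ 3 * ((⌊X⌋₊ : ℝ) - 1) / 2)))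
        ≤ 8 * (T ^ 131 * (1 / T ^ 131)) := by gcongr
      _ = 8 := by field_simp
      _ ≤ _ := by linarith
  · rw [← hnV]
    push_cast
    norm_num at h17
    linarith
  · positivity
  · exact Nat.pow_le_pow_right ht0 (by norm_num)
  · rw [← hnV]
    push_cast
    rw [← hTdef, Real.log_pow]
    have h1 : T ^ 68 * ((130 : ℕ) * Real.log T) ≤ T ^ 69 := by
      rw [show T ^ 69 = T ^ 68 * T by ring]
      refine mul_le_mul_of_nonneg_left ?_ (by positivity)
      push_cast
      linarith
    have h2 : T ^ 79 ≤ y ^ 3 * T ^ 130 := by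
      calc T ^ 79 = 1 * T ^ 79 := (one_mul _).symm
        _ ≤ y ^ 3 * T ^ 51 * T ^ 79 := by gcongr
        _ = y ^ 3 * T ^ 130 := by ring
    have h3 : y ^ 3 * T ^ 68 ≤ T ^ 68 := by
      have : y ^ 3 ≤ 1 := pow_le_one₀ hy0.le (by linarith)
      have h0 : 0 ≤ T ^ 68 := by positivity
      nlinarith
    have h4 : T ^ 17 ≤ T ^ 69 := hpow (by norm_num)
    have h5 : T ^ 68 ≤ T ^ 69 := hpow (by norm_num)
    have h6 : 10 ^ 10 * T ^ 69 ≤ T ^ 79 := (hstep 69).trans (hpow (by norm_num))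
    have h7 : 0 ≤ T ^ 69 := by positivity
    norm_num at h17 h6
    rw [mul_sub]
    linarith

lemma exp_neg_le_of_le_half {d : ℝ} (h0 : 0 ≤ d) (h : d ≤ 1 / 2) : Real.exp (-(2 * d)) ≤ 1 - d := by
  rw [Real.exp_neg, inv_le_comm₀ (Real.exp_pos _) (by linarith), inv_le_iff_one_le_mul₀ (by linarith)]
  have := Real.add_one_le_exp (2 * d)
  nlinarith

lemma eight_mul_le_exp {x : ℝ} (hx : 256 ≤ x) : 8 * x ≤ Real.exp (x / 4) := by
  have h := Real.quadratic_le_exp_of_nonneg (show 0 ≤ x / 4 by linarith)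
  nlinarith

lemma measureReal_evenNonDecomposable_le_middle_range (p : I) {t : ℕ} {d : ℝ} (hd : d = 1 - p)
    (hT : 10 ^ 10 ≤ (t : ℝ)) (hlogT : 10 ^ 6 * Real.log t ≤ t)
    (hL : Real.log (Fintype.card V) ≤ 65536 * (t : ℝ) ^ 16)
    (hL' : (t : ℝ) ^ 16 ≤ Real.log (Fintype.card V))
    (hn : t ^ 200 ≤ Fintype.card V) (hpT : 1 ≤ p * (t : ℝ) ^ 16) (hdT : 1 ≤ d * (t : ℝ) ^ 13) :
    (binomialRandom V p).real {G | G.EvenNonDecomposable} ≤ 3 / (Fintype.card V : ℝ) ^ 2 := by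
  set n := Fintype.card V with hnV
  set T : ℝ := (t : ℝ) with hTdef
  have hT0 : 0 < T := by linarith
  have ht0 : 0 < t := Nat.cast_pos.1 (show (0 : ℝ) < (t : ℝ) from hT0)
  have hn0 : 0 < n := lt_of_lt_of_le (by positivity) hn
  have hT1 : 1 ≤ T := by linarith
  have hp : (p : ℝ) = 1 - d := by rw [hd]; ring
  have hp0 : (0 : ℝ) ≤ p := p.2.1
  have hd1 : d ≤ 1 := by rw [hd]; linarith
  have hd0 : 0 < d := by
    by_contra h
    have : d * T ^ 13 ≤ 0 := mul_nonpos_of_nonpos_of_nonneg (not_lt.1 h) (by positivity)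
    linarith
  have hpow : ∀ {a b : ℕ}, a ≤ b → T ^ a ≤ T ^ b := fun h => pow_le_pow_right₀ hT1 h
  have hstep : ∀ a : ℕ, 10 ^ 10 * T ^ a ≤ T ^ (a + 1) := fun a => by
    rw [pow_succ' T a]; exact mul_le_mul_of_nonneg_right hT (by positivity)
  set l := Real.log T with hl
  have hlog1 : 1 ≤ l := by
    rw [Real.le_log_iff_exp_le hT0]
    linarith [Real.exp_one_lt_d9]
  have hTexp : ∀ a : ℕ, T ^ a = Real.exp (a * l) := fun a => by
    rw [Real.exp_nat_mul, Real.exp_log hT0]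
  -- This makes `T ≤ d * k ≤ 2 * T`: large enough to exclude cliques of size `k + 1` in `T ^ 64`
  -- vertices, yet small enough for a path pattern to appear.
  set k := ⌈T / d⌉₊ with hk
  have hk1 : T / d ≤ k := Nat.le_ceil _
  have hTd : T ≤ T / d := by rw [le_div_iff₀ hd0]; nlinarith
  have hk2 : (k : ℝ) ≤ 2 * (T / d) := by
    have := Nat.ceil_lt_add_one (show 0 ≤ T / d by positivity)
    linarith
  have hdk1 : T ≤ d * k := by
    rw [div_le_iff₀ hd0] at hk1; linarith
  have hdk2 : d * k ≤ 2 * T := by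
    have : d * (2 * (T / d)) = 2 * T := by field_simp
    rw [← this]; gcongr
  have hkT : (k : ℝ) ≤ 2 * T ^ 14 := by
    have : T / d ≤ T ^ 14 := by
      rw [div_le_iff₀ hd0]
      calc T = T * 1 := (mul_one _).symm
        _ ≤ T * (d * T ^ 13) := by gcongr
        _ = T ^ 14 * d := by ring
    linarith
  have hL0 : 0 ≤ Real.log n := Real.log_natCast_nonneg n
  have h17 := hstep 16
  have hsqrt1 : t ^ 100 ≤ Nat.sqrt n := by
    rw [Nat.le_sqrt, ← pow_add]; exact hn
  have hlogn : 10 ^ 10 ≤ Real.log n := by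
    have : T ≤ T ^ 16 := le_self_pow₀ hT1 (by norm_num)
    linarith
  have hsqrt2 : Real.exp (Real.log n / 2) ≤ 2 * (Nat.sqrt n : ℝ) := by
    have h1 : n < (Nat.sqrt n + 1) * (Nat.sqrt n + 1) := Nat.lt_succ_sqrt n
    have h2 : (n : ℝ) < ((Nat.sqrt n : ℝ) + 1) ^ 2 := by
      rw [sq]; exact_mod_cast h1
    have h3 : (1 : ℝ) ≤ Nat.sqrt n := by
      exact_mod_cast le_trans (Nat.one_le_pow _ _ ht0) hsqrt1
    have h4 : Real.exp (Real.log n / 2) ^ 2 = n := by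
      rw [← Real.exp_nat_mul]
      conv_rhs => rw [← Real.exp_log (show (0 : ℝ) < n by exact_mod_cast hn0)]
      congr 1; push_cast; ring
    have h5 : Real.exp (Real.log n / 2) ≤ (Nat.sqrt n : ℝ) + 1 := by
      refine le_of_lt (lt_of_pow_lt_pow_left₀ 2 (by positivity) ?_)
      rw [h4]; exact h2
    linarith
  -- For `d ≤ 1 / 2` this is `1 - d ≥ exp (-2 * d)`; otherwise it is `p ≥ T ^ (-16)`. Keeping `d` in
  -- the exponent matters, because it turns `k ^ 2` into `k * (d * k)`.
  have hplow : Real.exp (-(32 * d * l)) ≤ p := by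
    rcases le_total d (1 / 2) with h | h
    · rw [hp]
      refine le_trans (Real.exp_le_exp.2 ?_) (exp_neg_le_of_le_half hd0.le h)
      nlinarith
    · have h1 : Real.exp (-(16 * l)) ≤ p := by
        rw [Real.exp_neg, inv_le_iff_one_le_mul₀ (Real.exp_pos _)]
        have := hTexp 16
        push_cast at this
        rwa [← this]
      refine le_trans (Real.exp_le_exp.2 ?_) h1
      nlinarith
  have hdlow : Real.exp (-(13 * l)) ≤ d := by
    rw [Real.exp_neg, inv_le_iff_one_le_mul₀ (Real.exp_pos _)]
    have := hTexp 13
    push_cast at this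
    rwa [← this]
  have hpd : 1 ≤ 2 * (p * (1 - p)) * T ^ 16 := by
    rw [← hd]
    rcases le_total d (1 / 2) with h | h
    · have h1 : 1 ≤ 2 * (p : ℝ) := by rw [hp]; linarith
      calc 1 ≤ d * T ^ 13 := hdT
        _ ≤ d * T ^ 16 := by gcongr; norm_num
        _ = 1 * d * T ^ 16 := by ring
        _ ≤ 2 * p * d * T ^ 16 := by gcongr
        _ = 2 * (p * d) * T ^ 16 := by ring
    · have h1 : 1 ≤ 2 * d := by linarith
      calc 1 ≤ p * T ^ 16 := hpT
        _ = p * 1 * T ^ 16 := by ring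
        _ ≤ p * (2 * d) * T ^ 16 := by gcongr
        _ = 2 * (p * d) * T ^ 16 := by ring
  refine measureReal_evenNonDecomposable_le_of_block_parameters p (N := Nat.sqrt n) (k := k)
    (r := t ^ 64) (w := t ^ 33) hd ?_ hn0 ?_ ?_ ?_ ?_ ?_ ?_ ?_
  · refine le_trans (Nat.mul_le_mul_left _ ?_) (Nat.sqrt_le n)
    refine le_trans ?_ hsqrt1
    have h1 : ((12 * k + t ^ 64 : ℕ) : ℝ) ≤ ((t ^ 100 : ℕ) : ℝ) := by
      push_cast
      have h2 := hstep 64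
      have h3 : T ^ 14 ≤ T ^ 64 := hpow (by norm_num)
      have h4 : T ^ 65 ≤ T ^ 100 := hpow (by norm_num)
      have h5 : 0 ≤ T ^ 64 := by positivity
      norm_num at h2
      linarith
    exact_mod_cast h1
  · push_cast
    rw [← hTdef, hTexp 64]
    have h4 : (4 : ℝ) ≤ Real.exp 2 := by
      have := Real.exp_one_gt_d9
      rw [show (2 : ℝ) = 1 + 1 by norm_num, Real.exp_add]
      nlinarith
    calc 4 * Real.exp ((64 : ℕ) * l) ≤ Real.exp 2 * Real.exp ((64 : ℕ) * l) := by gcongr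
      _ = Real.exp (2 + 64 * l) := by rw [← Real.exp_add]; norm_num
      _ ≤ Real.exp (k * Real.log 2) := by
        refine Real.exp_le_exp.2 ?_
        have := Real.log_two_gt_d9
        have h5 : T ≤ k := hTd.trans hk1
        nlinarith
      _ = 2 ^ k := by rw [Real.exp_nat_mul, Real.exp_log (by norm_num)]
  · push_cast
    rw [← hTdef, Real.log_pow, ← hl]
    push_cast
    linarith
  · rw [← hnV]
    push_cast
    have h1 : T ^ 20 ≤ d * T ^ 33 := by
      calc T ^ 20 = 1 * T ^ 20 := (one_mul _).symm
        _ ≤ d * T ^ 13 * T ^ 20 := by gcongr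
        _ = d * T ^ 33 := by ring
    have h2 : T ^ 17 ≤ T ^ 20 := hpow (by norm_num)
    have h3 : 0 ≤ T ^ 16 := by positivity
    norm_num at h17
    linarith
  · positivity
  · exact Nat.pow_le_pow_right ht0 (by norm_num)
  · rw [← hnV]
    push_cast
    rw [← hTdef, Real.log_pow, ← hl]
    have h1 : T ^ 33 * ((64 : ℕ) * l) ≤ T ^ 34 := by
      rw [show T ^ 34 = T ^ 33 * T by ring]
      refine mul_le_mul_of_nonneg_left ?_ (by positivity)
      push_cast
      linarith
    have h2 : T ^ 33 ≤ T ^ 64 / 2 := by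
      have := hstep 33
      have h3 : T ^ 34 ≤ T ^ 64 := hpow (by norm_num)
      have h4 : 0 ≤ T ^ 33 := by positivity
      norm_num at this
      linarith
    have hp1 : 0 ≤ 2 * ((p : ℝ) * (1 - p)) := by
      rw [← hd]; positivity
    have h3 : T ^ 48 / 2 ≤ 2 * (p * (1 - p)) * (T ^ 64 - T ^ 33) := by
      calc T ^ 48 / 2 = 1 * (T ^ 48 / 2) := (one_mul _).symm
        _ ≤ 2 * (p * (1 - p)) * T ^ 16 * (T ^ 48 / 2) := by gcongr
        _ = 2 * (p * (1 - p)) * (T ^ 64 / 2) := by ring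
        _ ≤ 2 * (p * (1 - p)) * (T ^ 64 - T ^ 33) := by gcongr; linarith
    have h4 : T ^ 17 ≤ T ^ 34 := hpow (by norm_num)
    have h5 : 10 ^ 10 * T ^ 34 ≤ T ^ 48 := (hstep 34).trans (hpow (by norm_num))
    have h6 : 0 ≤ T ^ 16 := by positivity
    norm_num at h17 h5
    linarith
  · rw [← hnV]
    -- The cost of the pattern is of order `k * (d * k) * log T`, with `k ≤ 2 * T ^ 14`, `d * k ≤ 2
    -- * T` and `log T ≤ T / 10 ^ 6`: a small multiple of `T ^ 16 ≤ log n`. A block thus has the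
    -- pattern with probability at least `n ^ (-1 / 4)`, against about `n ^ (1 / 2)` blocks.
    have h1 : Real.exp (-(Real.log n / 4)) ≤ (p : ℝ) ^ (72 * k ^ 2) * d ^ (9 * k) := by
      calc Real.exp (-(Real.log n / 4))
          ≤ Real.exp (-(72 * k ^ 2 * (32 * d * l) + 9 * k * (13 * l))) := by
            refine Real.exp_le_exp.2 (neg_le_neg ?_)
            have h2 : (k : ℝ) * (d * k) * l ≤ 2 * T ^ 14 * (2 * T) * (T / 10 ^ 6) := by
              gcongr
              linarith
            have h3 : (k : ℝ) * l ≤ 2 * T ^ 14 * (T / 10 ^ 6) := by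
              gcongr
              linarith
            have h4 : T ^ 15 ≤ T ^ 16 := hpow (by norm_num)
            have e2 : 2 * T ^ 14 * (2 * T) * (T / 10 ^ 6) = 4 * T ^ 16 / 10 ^ 6 := by ring
            have e3 : 2 * T ^ 14 * (T / 10 ^ 6) = 2 * T ^ 15 / 10 ^ 6 := by ring
            rw [e2] at h2
            rw [e3] at h3
            have e4 : 72 * (k : ℝ) ^ 2 * (32 * d * l) + 9 * k * (13 * l) =
              2304 * (k * (d * k) * l) + 117 * (k * l) := by ring
            rw [e4]
            linarith
        _ = Real.exp (-(32 * d * l)) ^ (72 * k ^ 2) * Real.exp (-(13 * l)) ^ (9 * k) := by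
            rw [← Real.exp_nat_mul, ← Real.exp_nat_mul, ← Real.exp_add]
            congr 1; push_cast; ring
        _ ≤ (p : ℝ) ^ (72 * k ^ 2) * d ^ (9 * k) := by gcongr
    have h2 : 8 * Real.log n ≤ Real.exp (Real.log n / 4) :=
      eight_mul_le_exp (by linarith)
    calc 4 * Real.log n ≤ Real.exp (Real.log n / 4) / 2 := by linarith
      _ = Real.exp (Real.log n / 2) / 2 * Real.exp (-(Real.log n / 4)) := by
        rw [div_mul_eq_mul_div, ← Real.exp_add]; congr 2; ring
      _ ≤ Nat.sqrt n * ((p : ℝ) ^ (72 * k ^ 2) * d ^ (9 * k)) := by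
        gcongr
        linarith

end SimpleGraph

/-! ### Assembling the ranges -/

namespace SimpleGraph

open Finset MeasureTheory ProbabilityTheory unitInterval

lemma mul_log_le_self {x : ℝ} (hx : 4 * 10 ^ 12 ≤ x) : 10 ^ 6 * Real.log x ≤ x := by
  have hx0 : 0 ≤ x := by linarith
  have h1 : Real.log x = 2 * Real.log √x := by rw [Real.log_sqrt hx0]; ring
  have h2 := Real.log_le_self (Real.sqrt_nonneg x)
  have h3 : 2 * 10 ^ 6 ≤ √x := Real.le_sqrt_of_sq_le (by linarith)
  nlinarith [Real.mul_self_sqrt hx0]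

lemma exists_nat_pow_le_lt_pow {x : ℝ} (hx : 0 ≤ x) {k : ℕ} (hk : k ≠ 0) :
    ∃ t : ℕ, (t : ℝ) ^ k ≤ x ∧ x < ((t : ℝ) + 1) ^ k := by
  have h0 : 0 ≤ x ^ (k : ℝ)⁻¹ := Real.rpow_nonneg hx _
  have h1 : (x ^ (k : ℝ)⁻¹) ^ k = x := Real.rpow_inv_natCast_pow hx hk
  refine ⟨⌊x ^ (k : ℝ)⁻¹⌋₊, ?_, ?_⟩
  · conv_rhs => rw [← h1]
    exact pow_le_pow_left₀ (Nat.cast_nonneg _) (Nat.floor_le h0) k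
  · conv_lhs => rw [← h1]
    exact pow_lt_pow_left₀ (Nat.lt_floor_add_one _) h0 hk

/-- For large `n`, random graphs which are not too close to being complete are
even-non-decomposable with probability `O(1 / n ^ 2)`. -/
theorem exists_measureReal_evenNonDecomposable_le :
    ∃ N : ℕ, ∀ n : ℕ, N ≤ n → ∀ p : I, (p : ℝ) ≤ 1 - 10 ^ 5 / (n : ℝ) →
      (binomialRandom (Fin n) p).real {G | G.EvenNonDecomposable} ≤
        2 ^ 10 * (10 ^ 5) ^ 6 / (n : ℝ) ^ 2 := by
  -- This is the threshold of `mul_log_le_self`.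
  set T₀ : ℝ := 4 * 10 ^ 12 with hT₀
  refine ⟨⌈Real.exp ((T₀ + 1) ^ 16)⌉₊, fun n hn p hp => ?_⟩
  have hn' : Real.exp ((T₀ + 1) ^ 16) ≤ n := Nat.ceil_le.1 hn
  have hn0 : (0 : ℝ) < n := lt_of_lt_of_le (Real.exp_pos _) hn'
  have hnpos : 0 < n := by exact_mod_cast hn0
  have hL0 : (T₀ + 1) ^ 16 ≤ Real.log n := (Real.le_log_iff_exp_le hn0).2 hn'
  have hcard : Fintype.card (Fin n) = n := Fintype.card_fin n
  have hmono : ∀ {C : ℝ}, C ≤ 2 ^ 10 * (10 ^ 5) ^ 6 →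
      (binomialRandom (Fin n) p).real {G | G.EvenNonDecomposable} ≤ C / (n : ℝ) ^ 2 →
      (binomialRandom (Fin n) p).real {G | G.EvenNonDecomposable} ≤
        2 ^ 10 * (10 ^ 5) ^ 6 / (n : ℝ) ^ 2 := fun hC h => h.trans (by gcongr)
  -- With `t` the integer part of the sixteenth root of `log n`, all thresholds are powers of an
  -- integer; `65536 = 2 ^ 16` below comes from `t + 1 ≤ 2 * t`.
  obtain ⟨t, ht1, ht2⟩ := exists_nat_pow_le_lt_pow (k := 16) (Real.log_natCast_nonneg n)
    (by norm_num)
  have hT : T₀ ≤ t := by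
    have := lt_of_pow_lt_pow_left₀ 16 (by positivity) (lt_of_le_of_lt hL0 ht2)
    linarith
  have hT10 : (10 : ℝ) ^ 10 ≤ t := le_trans (by rw [hT₀]; norm_num) hT
  have hT1 : (1 : ℝ) ≤ t := by linarith
  have hlogT := mul_log_le_self hT
  have hL : Real.log n ≤ 65536 * (t : ℝ) ^ 16 := by
    refine ht2.le.trans ?_
    calc ((t : ℝ) + 1) ^ 16 ≤ (2 * t) ^ 16 := by gcongr; linarith
      _ = 65536 * (t : ℝ) ^ 16 := by rw [mul_pow]; norm_num
  have hT16 : (t : ℝ) ≤ (t : ℝ) ^ 16 := le_self_pow₀ hT1 (by norm_num)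
  have htn : (t : ℝ) ^ 200 ≤ n := by
    rw [← Real.log_le_log_iff (by positivity) hn0, Real.log_pow]
    have : 0 ≤ Real.log t := Real.log_nonneg hT1
    push_cast
    linarith
  have htn' : t ^ 200 ≤ Fintype.card (Fin n) := by rw [hcard]; exact_mod_cast htn
  set d : ℝ := 1 - p with hd
  have hd1 : 10 ^ 5 / (n : ℝ) ≤ d := by linarith
  have hd0 : 0 < d := lt_of_lt_of_le (by positivity) hd1
  -- This first case produces the final constant; the other ranges have constants at most 6.
  rcases le_total (p : ℝ) (10 ^ 5 / n) with h | h
  · have := measureReal_evenNonDecomposable_le_of_le_const_div (V := Fin n) p (by rwa [hcard])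
      (K := 10 ^ 5) (by rwa [hcard])
    rwa [hcard] at this
  rcases le_total (p * (t : ℝ) ^ 16) 1 with h1 | h1
  · have := measureReal_evenNonDecomposable_le_sparse_range (V := Fin n) p (q := (t : ℝ) ^ 16)
      (by linarith) (by rwa [hcard]) (by
        rw [hcard, ← pow_mul]
        exact (pow_le_pow_right₀ hT1 (by norm_num)).trans htn) (by rwa [hcard]) h1
    rw [hcard] at this
    exact hmono (by norm_num) this
  rcases le_total 1 (d * (t : ℝ) ^ 13) with h2 | h2
  · have := measureReal_evenNonDecomposable_le_middle_range (V := Fin n) p hd hT10 hlogT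
      (by rwa [hcard]) (by rwa [hcard]) htn' h1 h2
    rw [hcard] at this
    exact hmono (by norm_num) this
  obtain ⟨y, hy0, hy⟩ : ∃ y : ℝ, 0 < y ∧ y ^ 3 = d :=
    ⟨d ^ ((3 : ℕ) : ℝ)⁻¹, Real.rpow_pos_of_pos hd0 _,
      Real.rpow_inv_natCast_pow hd0.le (by norm_num)⟩
  rcases le_total (y * (t : ℝ) ^ 17) 1 with h3 | h3
  · have := measureReal_evenNonDecomposable_le_dense_range (V := Fin n) p hT10 (by rwa [hcard])
      (by rw [hcard]; exact (pow_le_pow_right₀ hT1 (by norm_num)).trans htn) hy hy0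
      (by rwa [hcard, hy]) h3
    rw [hcard] at this
    exact hmono (by norm_num) this
  · have := measureReal_evenNonDecomposable_le_dense_distinguish_range (V := Fin n) p hT10 hlogT
      (by rwa [hcard]) htn' hy hy0 h3 (by rwa [hy])
    rw [hcard] at this
    exact hmono (by norm_num) this

end SimpleGraph

theorem mainTheorem2 :
    (∃ c₁ : ℝ, 0 < c₁ ∧ ∀ ε : ℝ, 0 < ε → ∃ N : ℕ, ∀ n : ℕ, N ≤ n → 1 ≤ n →
      ∀ p : unitInterval, (p : ℝ) ≤ 1 - c₁ / (n : ℝ) →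
        (SimpleGraph.binomialRandom (Fin n) p).real
          {G : SimpleGraph (Fin n) | G.EvenNonDecomposable} ≤ ε) ∧
    (∃ C : ℝ, 0 < C ∧ ∀ n : ℕ, 1 ≤ n →
      ∀ p : unitInterval, (p : ℝ) ≤ 1 - 10 ^ 5 / (n : ℝ) →
        (SimpleGraph.binomialRandom (Fin n) p).real
          {G : SimpleGraph (Fin n) | G.EvenNonDecomposable} ≤ C / (n : ℝ) ^ 2) := by
  obtain ⟨N, hN⟩ := SimpleGraph.exists_measureReal_evenNonDecomposable_le
  set K : ℝ := 2 ^ 10 * (10 ^ 5) ^ 6 with hK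
  have hK0 : 0 < K := by positivity
  -- Part (i) follows from the large-`n` bound with `c₁ = 10 ^ 5`. The summand `N ^ 2` in `C` makes
  -- the bound trivial for `n ≤ N`.
  refine ⟨⟨10 ^ 5, by norm_num, fun ε hε => ?_⟩, K + N ^ 2, by positivity, fun n hn p hp => ?_⟩
  · refine ⟨max N ⌈K / ε⌉₊, fun n hn hn1 p hp => ?_⟩
    refine (hN n (le_of_max_le_left hn) p hp).trans ?_
    have h1 : K / ε ≤ n := Nat.ceil_le.1 (le_of_max_le_right hn)
    have h2 : (1 : ℝ) ≤ n := by exact_mod_cast hn1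
    rw [div_le_iff₀ hε] at h1
    rw [div_le_iff₀ (by positivity)]
    nlinarith
  · have hn' : (1 : ℝ) ≤ n := by exact_mod_cast hn
    rcases le_total N n with h | h
    · refine (hN n h p hp).trans ?_
      gcongr
      linarith [sq_nonneg (N : ℝ)]
    · refine MeasureTheory.measureReal_le_one.trans ?_
      rw [le_div_iff₀ (by positivity), one_mul]
      have : (n : ℝ) ≤ N := by exact_mod_cast h
      nlinarith
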